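/- Let $E,U$ be real Hilbert spaces, $0<\alpha<1$, $a>0$, $J=[0,a]$, $t_1,\dots,t_m\in J$, $c_1,\dots,c_m\in\mathbb R$. Consider the nonlocal Caputo fractional control system $${}^{C}D^{\alpha}x(t)=Ax(t)+Bv(t)+f(t,x(t)),\quad t\in J,\qquad x(0)=\sum_{k=1}^m c_k\,x(t_k),\tag{P}$$ where $A:D(A)\subseteq E\to E$ generates a $C_0$-semigroup, $B:U\to E$ is bounded and linear, and $f:J\times E\to E$ is a Carathéodory function ($f(\cdot,x)$ is strongly measurable for every $x$, and $f(t,\cdot)$ is continuous for a.e. $t$). Let $(T_\alpha(t))_{t\ge0}$ be the $\alpha$-order solution operator generated by $A$: it is strongly continuous on $[0,\infty)$, $T_\alpha(0)=I$, $T_\alpha(t)D(A)\subseteq D(A)$, and for $x\in D(A)$, $AT_\alpha(t)x=T_\alpha(t)Ax$ and $T_\alpha(t)x=x+\frac1{\Gamma(\alpha)}\int_0^t(t-s)^{\alpha-1}AT_\alpha(s)x\,ds$. Let $(S_\alpha(t))_{t>0}$ be the $\alpha$-order resolvent family generated by $A$: it is strongly continuous on $(0,\infty)$ and, for some $\omega\ge0$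 and all $\nu>\omega$, $\nu^\alpha$ is in the resolvent set of $A$ and $(\nu^\alpha I-A)^{-1}u=\int_0^\infty e^{-\nu t}S_\alpha(t)u\,dt$ (absolutely convergent) for all $u\in E$. Assume $M_T\sum_{k}|c_k|<1$, where $M_T=\sup_{t\ge0}\|T_\alpha(t)\|$. Put $\mathcal O=(I-\sum_kc_kT_\alpha(t_k))^{-1}$ and $$G(t,s)=\sum_{k=1}^m c_k\mathbf 1_{\{s<t_k\}}T_\alpha(t)\,\mathcal O\,S_\alpha(t_k-s)+\mathbf 1_{\{s<t\}}S_\alpha(t-s),\qquad t,s\in J.$$ A mild solution of (P) for a control $v\in L^2(J,U)$ is an $x\in L^2(J,E)$ such that, with $h(s)=Bv(s)+f(s,x(s))$, each $s\mapsto S_\alpha(t_k-s)h(s)$ is Bochner integrable on $(0,t_k)$ and, for a.e. $t\in J$, $s\mapsto G(t,s)h(s)$ is Bochner integrable on $J$ and $x(t)=\int_0^aG(t,s)h(s)\,ds$. Assume: 1. There is $\mu>0$ with $\langle -Ax,x\rangle\ge\mu\|x\|^2$ for all $x\in D(A)$. 2. There are $p\in L^2(J)$ and $b>0$ with $\|f(t,x)\|\le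 p(t)+b\|x\|$ for all $t\in J$, $x\in E$; and $\langle f(t,x)-f(t,y),x-y\rangle\le0$ for all $t\in J$, $x,y\in E$. Moreover $\int_0^{t_k}(t_k-s)^{\alpha-1}p(s)\,ds<\infty$ for each $k$ (automatic if $\alpha>1/2$). 3. $G(t,s)$ is a compact operator whenever $0\le s<t\le a$. 4. $U_{ad}\subseteq U$ is nonempty, convex and weakly compact. 5. $g:J\times U_{ad}\times E\to\mathbb R$ is approximately lower semicontinuous: for every $\varepsilon>0$ there is a compact $K\subseteq J$ with $|J\setminus K|<\varepsilon$ such that $g$ restricted to $K\times U_{ad}\times E$ is lower semicontinuous (norm topologies). For every $t\in J$, $(u,x)\mapsto g(t,u,x)$ is lower semicontinuous for the weak topology on $U_{ad}$ and the norm topology on $E$. For every $(t,x)\in J\times E$, $u\mapsto g(t,u,x)$ is convex on $U_{ad}$. Moreover, for some $\psi\in L^1(J)$, $g(t,u,x)\ge-\psi(t)$ for all $(t,u,x)\in J\times U_{ad}\times E$. Call $(v,x)\in L^2(J,U)\times L^2(J,E)$ admissible if $v(t)\in U_{ad}$ for a.e. $t\in J$ and $x$ is a mild solution of (P) for $v$.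 Then there is an optimal pair: an admissible pair $(v^*,x^*)$ such that $$\int_0^ag(t,v^*(t),x^*(t))\,dt\le\int_0^ag(t,v(t),x(t))\,dt$$ for every admissible pair $(v,x)$ (the integrals take values in $(-\infty,+\infty]$). -/

import Mathlib

open MeasureTheory Set Filter Topology
open scoped NNReal ENNReal RealInnerProductSpace

noncomputable section

namespace FracControl

variable {E U : Type*} [NormedAddCommGroup E] [InnerProductSpace ℝ E]
  [NormedAddCommGroup U] [InnerProductSpace ℝ U]

/-- `S` is a strongly continuous (`C₀`) semigroup of bounded operators on `E`; only the values
`S t` with `0 ≤ t` matter. -/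
structure IsC0Semigroup (S : ℝ → E →L[ℝ] E) : Prop where
  map_zero : S 0 = 1
  map_add : ∀ s t : ℝ, 0 ≤ s → 0 ≤ t → S (s + t) = S s * S t
  strongly_continuous : ∀ x : E, ContinuousOn (fun t => S t x) (Ici 0)

/-- The unbounded operator `A` is the infinitesimal generator of some `C₀` semigroup:
`D(A)` is the set of all `x` for which `(S h x - x) / h` converges as `h ↓ 0`,
and `A x` is the limit. -/
def GeneratesC0Semigroup (A : E →ₗ.[ℝ] E) : Prop :=
  ∃ S : ℝ → E →L[ℝ] E, IsC0Semigroup S ∧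
    ∀ x y : E, (x, y) ∈ A.graph ↔
      Tendsto (fun h : ℝ => h⁻¹ • (S h x - x)) (𝓝[>] 0) (𝓝 y)

/-- `T` is an `α`-order solution operator generated by `A`; only the values `T t` with `0 ≤ t`
matter. In `integral_eq` the integrand is written as `T s (A x)`, which equals `A (T s x)`
by `comm`. -/
structure IsSolutionOperator (α : ℝ) (A : E →ₗ.[ℝ] E) (T : ℝ → E →L[ℝ] E) : Prop where
  strongly_continuous : ∀ x : E, ContinuousOn (fun t => T t x) (Ici 0)
  map_zero : T 0 = 1
  comm : ∀ t : ℝ, 0 ≤ t → ∀ x : A.domain, ∃ h : T t x ∈ A.domain, A ⟨T t x, h⟩ = T t (A x)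
  integral_eq : ∀ t : ℝ, 0 ≤ t → ∀ x : A.domain,
    T t x = (x : E) + (Real.Gamma α)⁻¹ • ∫ s in (0 : ℝ)..t, (t - s) ^ (α - 1) • T s (A x)

/-- The bounded operator `R` is the two-sided inverse of `lam I - A : D(A) → E`. -/
def IsResolventAt (A : E →ₗ.[ℝ] E) (lam : ℝ) (R : E →L[ℝ] E) : Prop :=
  (∀ u : E, ∃ h : R u ∈ A.domain, lam • R u - A ⟨R u, h⟩ = u) ∧
    ∀ x : A.domain, R (lam • (x : E) - A x) = x

/-- `S` is an `α`-order resolvent family generated by `A`: it is strongly continuous on `(0, ∞)`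
and its (absolutely convergent) Laplace transform at `ν` is `(ν ^ α I - A)⁻¹` for large `ν`.
By analytic continuation it is the same to ask this for real `ν > ω` or for complex `ν` with
`Re ν > ω`. -/
def IsResolventFamily (α : ℝ) (A : E →ₗ.[ℝ] E) (S : ℝ → E →L[ℝ] E) : Prop :=
  (∀ u : E, ContinuousOn (fun t => S t u) (Ioi 0)) ∧
    ∃ ω : ℝ, 0 ≤ ω ∧ ∀ ν : ℝ, ω < ν →
      ∃ R : E →L[ℝ] E, IsResolventAt A (ν ^ α) R ∧
        ∀ u : E, IntegrableOn (fun t : ℝ => Real.exp (-(ν * t)) • S t u) (Ioi 0) ∧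
          R u = ∫ t in Ioi (0 : ℝ), Real.exp (-(ν * t)) • S t u

/-- The operator `(I - ∑ₖ cₖ T(tₖ))⁻¹`. -/
def nonlocalInverse {m : ℕ} (T : ℝ → E →L[ℝ] E) (c τ : Fin m → ℝ) : E →L[ℝ] E :=
  Ring.inverse (1 - ∑ k, c k • T (τ k))

/-- The Green operator `G(t, s)` of the nonlocal problem with nodes `τ k` and weights `c k`. -/
def green {m : ℕ} (T S : ℝ → E →L[ℝ] E) (c τ : Fin m → ℝ) (t s : ℝ) : E →L[ℝ] E :=
  (∑ k, (if s < τ k then c k else 0) • (T t * nonlocalInverse T c τ * S (τ k - s))) +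
    (if s < t then (1 : ℝ) else 0) • S (t - s)

/-- Lebesgue measure on `J = [0, a]`. -/
abbrev vol (a : ℝ) : Measure ℝ := volume.restrict (Icc 0 a)

/-- `x ∈ L²(J, E)` is a mild solution for the control `v ∈ L²(J, U)`: the integrals
`∫₀^{τ k} S(τ k - s) [B v(s) + f(s, x(s))] ds` that define the values at the nodes exist, and
`x(t) = ∫₀ᵃ G(t, s) [B v(s) + f(s, x(s))] ds` on `J`. -/
def IsMildSolution {m : ℕ} (a : ℝ) (T S : ℝ → E →L[ℝ] E) (c τ : Fin m → ℝ) (B : U →L[ℝ] E)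
    (f : ℝ → E → E) (v : Lp U 2 (vol a)) (x : Lp E 2 (vol a)) : Prop :=
  (∀ k, IntegrableOn (fun s => S (τ k - s) (B (v s) + f s (x s))) (Ioo 0 (τ k))) ∧
    ∀ᵐ t ∂(vol a), Integrable (fun s => green T S c τ t s (B (v s) + f s (x s))) (vol a) ∧
      x t = ∫ s, green T S c τ t s (B (v s) + f s (x s)) ∂(vol a)

/-- The Carathéodory condition on `J × E`. -/
def IsCaratheodory (a : ℝ) (f : ℝ → E → E) : Prop :=
  (∀ x : E, AEStronglyMeasurable (fun t => f t x) (vol a)) ∧ ∀ᵐ t ∂(vol a), Continuous (f t)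

/-- `g` is approximately lower semicontinuous on `J × Uad × E`: up to an arbitrarily small part
of `J` it is (jointly) lower semicontinuous on `K × Uad × E` for a compact `K ⊆ J`. -/
def ApproxLSC (a : ℝ) (Uad : Set U) (g : ℝ → U → E → ℝ) : Prop :=
  ∀ ε : ℝ≥0∞, 0 < ε → ∃ K : Set ℝ, IsCompact K ∧ K ⊆ Icc 0 a ∧ volume (Icc 0 a \ K) < ε ∧
    LowerSemicontinuousOn (fun p : ℝ × U × E => g p.1 p.2.1 p.2.2) (K ×ˢ Uad ×ˢ univ)

/-- `Uad` is compact in the weak topology of `U`. -/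
def IsWeaklyCompact (Uad : Set U) : Prop :=
  IsCompact (toWeakSpace ℝ U '' Uad)

/-- Lower semicontinuity on `Uad × E` for the weak topology on `Uad` and the norm topology
on `E`. -/
def WeakStrongLSC (Uad : Set U) (φ : U → E → ℝ) : Prop :=
  LowerSemicontinuousOn
    (fun p : WeakSpace ℝ U × E => φ ((toWeakSpace ℝ U).symm p.1) p.2)
    ((toWeakSpace ℝ U '' Uad) ×ˢ univ)

/-- The cost `∫₀ᵃ g(t, v(t), x(t)) dt ∈ [-∞, ∞]`, the integral of the positive part minus
the integral of the negative part. -/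
def cost (a : ℝ) (g : ℝ → U → E → ℝ) (v : Lp U 2 (vol a)) (x : Lp E 2 (vol a)) : EReal :=
  ((∫⁻ t, ENNReal.ofReal (g t (v t) (x t)) ∂(vol a) : ℝ≥0∞) : EReal) -
    ((∫⁻ t, ENNReal.ofReal (-g t (v t) (x t)) ∂(vol a) : ℝ≥0∞) : EReal)

/-- `(v, x)` is an admissible pair: `v(t) ∈ Uad` almost everywhere and `x` is a mild solution for
the control `v`. -/
def IsAdmissiblePair {m : ℕ} (a : ℝ) (T S : ℝ → E →L[ℝ] E) (c τ : Fin m → ℝ) (B : U →L[ℝ] E)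
    (f : ℝ → E → E) (Uad : Set U) (v : Lp U 2 (vol a)) (x : Lp E 2 (vol a)) : Prop :=
  (∀ᵐ t ∂(vol a), v t ∈ Uad) ∧ IsMildSolution a T S c τ B f v x

/-- An optimal pair is an admissible pair of least cost. -/
def IsOptimalPair {m : ℕ} (a : ℝ) (T S : ℝ → E →L[ℝ] E) (c τ : Fin m → ℝ) (B : U →L[ℝ] E)
    (f : ℝ → E → E) (Uad : Set U) (g : ℝ → U → E → ℝ)
    (v : Lp U 2 (vol a)) (x : Lp E 2 (vol a)) : Prop :=
  IsAdmissiblePair a T S c τ B f Uad v x ∧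
    ∀ (v' : Lp U 2 (vol a)) (x' : Lp E 2 (vol a)),
      IsAdmissiblePair a T S c τ B f Uad v' x' → cost a g v x ≤ cost a g v' x'

end FracControl

end

/-! ### Riemann-Liouville and Marchaud kernels. -/

noncomputable section

namespace FracControl

/-! The direct method applies once weakly convergent controls are shown to have strongly convergent
states. The analysis rests on one inequality, `RadialConvex.fractional_le`: if `w - z₀` is the
fractional integral of `q` and `φ` is convex, then `φ (w t) - φ z₀` is at most the fractional
integral of `⟪∇φ(w), q⟫`. It follows from convexity applied to the increments `w s - w (s - r)`,
integrated against the truncated Marchaud kernel, because the Marchaud difference operator turns the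
Riemann-Liouville kernel `k` into an approximate identity.

To use it for mild solutions, uniqueness of Laplace transforms gives Volterra equations smoothed by
a resolvent of `A`. With `J = λ (λ - A)⁻¹`, the function `J y` has fractional derivative `J η + A J
y`, coercivity controls the second term, and `λ → ∞` gives the energy inequality `step_energy` for
step forcing. The smoothed norm as `φ` gives `‖S t u‖ ≤ k t * ‖u‖` (`norm_resolvent_le`), which
controls all singular integrals, and then, by approximation, norm bounds for general forcing
(`energy_le`). The choice `φ = ‖·‖² / 2`, observed at times tending to infinity, gives strong
positivity `μ ‖K h‖² ≤ ⟪K h, h⟫` of convolution with `S` on `L²` (`convOp_positive`).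

For a fixed initial value the mild equation is a Hammerstein equation `x = q + K (F x)` with `-F`
monotone; it is solved by regularisation and Minty's theorem (`exists_hammerstein`). Values of
solutions depend nonexpansively on the initial value, and `T 0 = 1` forces `∑ |cₖ| < 1` on a
nontrivial space, so the nonlocal condition is a contraction. The values at the nodes make sense
because `k * k ≤ C k` on bounded intervals: finiteness of the fractional integral of `p` at a time
passes to a majorant of the whole forcing term at that time.

Compactness of the Green operators gives compactness of each `S r`, so bounded weakly null forcing
has a response tending to zero at every time (`tendsto_mildOp_zero`). Comparing two solutions after
subtracting this linear response (`norm_solVal_sub_sub_le`) gives almost everywhere convergence of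
the states.

Finally, a minimising sequence of controls has a weakly convergent subsequence. Near the limit state
the integrand has continuous affine minorants valid on all of `Uad`, by convexity and weak
compactness; Mazur's lemma and Fatou's lemma then give lower semicontinuity of the cost
(`lintegral_le_of_weak_limit`). -/

/-- The Riemann-Liouville kernel `t ^ (α - 1) / Γ(α)`, extended by zero to `t ≤ 0`. -/
def rlKer (α t : ℝ) : ℝ := if 0 < t then t ^ (α - 1) / Real.Gamma α else 0

/-- The truncated Marchaud kernel `r ^ (-1 - α)` on `(δ, ∞)`. -/
def marchaudKer (α δ r : ℝ) : ℝ := if δ < r then r ^ (-1 - α) else 0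

/-- The profile of the approximate identity that arises by applying the truncated Marchaud
derivative to the Riemann-Liouville kernel. -/
def idKer (α u : ℝ) : ℝ :=
  if 0 < u then (u ^ α - (max (u - 1) 0) ^ α) / (α * Real.Gamma α * u) else 0

section kernels

variable {α : ℝ}

theorem rlKer_of_pos {t : ℝ} (ht : 0 < t) : rlKer α t = t ^ (α - 1) / Real.Gamma α := if_pos ht

theorem rlKer_of_nonpos {t : ℝ} (ht : t ≤ 0) : rlKer α t = 0 := if_neg ht.not_gt

theorem rlKer_nonneg (hα : 0 < α) (t : ℝ) : 0 ≤ rlKer α t := by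
  unfold rlKer
  split_ifs with h
  · exact div_nonneg (Real.rpow_nonneg h.le _) (Real.Gamma_pos_of_pos hα).le
  · rfl

theorem rlKer_pos (hα : 0 < α) {t : ℝ} (ht : 0 < t) : 0 < rlKer α t := by
  rw [rlKer_of_pos ht]
  exact div_pos (Real.rpow_pos_of_pos ht _) (Real.Gamma_pos_of_pos hα)

theorem measurable_rlKer : Measurable (rlKer α) := by
  unfold rlKer
  exact Measurable.ite measurableSet_Ioi (by fun_prop) measurable_const

theorem rlKer_antitone (hα : 0 < α) (hα₁ : α < 1) {s t : ℝ} (hs : 0 < s) (hst : s ≤ t) :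
    rlKer α t ≤ rlKer α s := by
  rw [rlKer_of_pos hs, rlKer_of_pos (hs.trans_le hst)]
  have := (Real.Gamma_pos_of_pos hα).le
  gcongr ?_ / _
  exact Real.rpow_le_rpow_of_nonpos hs hst (by linarith)

theorem continuousOn_rlKer : ContinuousOn (rlKer α) (Ioi 0) := by
  have : ContinuousOn (fun t : ℝ => t ^ (α - 1) / Real.Gamma α) (Ioi 0) := by
    refine ContinuousOn.div_const (fun t ht => ?_) _
    exact (Real.continuousAt_rpow_const t _ (Or.inl (ne_of_gt ht))).continuousWithinAt
  exact this.congr fun t ht => rlKer_of_pos ht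

theorem integrableOn_rlKer (hα : 0 < α) (t : ℝ) : IntegrableOn (rlKer α) (Iio t) := by
  have h1 : IntegrableOn (rlKer α) (Iic 0) :=
    integrableOn_zero.congr_fun (fun s hs => (rlKer_of_nonpos hs).symm) measurableSet_Iic
  have h2 : IntegrableOn (rlKer α) (Ioo 0 (max t 1)) := by
    have : IntegrableOn (fun s : ℝ => s ^ (α - 1) / Real.Gamma α) (Ioo 0 (max t 1)) := by
      apply Integrable.div_const
      exact (intervalIntegral.integrableOn_Ioo_rpow_iff (by positivity)).2 (by linarith)
    exact this.congr_fun (fun s hs => (rlKer_of_pos hs.1).symm) measurableSet_Ioo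
  refine (h1.union h2).mono_set fun s hs => ?_
  rcases le_or_gt s 0 with h | h
  · exact Or.inl h
  · exact Or.inr ⟨h, lt_max_of_lt_left hs⟩

theorem integrableOn_rlKer_sub (hα : 0 < α) (t : ℝ) :
    IntegrableOn (fun s => rlKer α (t - s)) (Ioi 0) := by
  have := (integrableOn_rlKer hα t)
  rw [← integrable_indicator_iff measurableSet_Iio] at this
  have := this.comp_sub_left t
  rw [← integrable_indicator_iff measurableSet_Ioi]
  refine this.congr (ae_of_all _ fun s => ?_)
  simp [indicator, sub_lt_self_iff]

theorem marchaudKer_nonneg {δ : ℝ} (hδ : 0 < δ) (r : ℝ) : 0 ≤ marchaudKer α δ r := by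
  unfold marchaudKer
  split_ifs with h
  · exact Real.rpow_nonneg (hδ.trans h).le _
  · rfl

theorem marchaudKer_eq_indicator (δ : ℝ) :
    marchaudKer α δ = (Ioi δ).indicator fun r => r ^ (-1 - α) := by
  ext r; simp [marchaudKer, indicator]

theorem integrable_marchaudKer (hα : 0 < α) {δ : ℝ} (hδ : 0 < δ) :
    Integrable (marchaudKer α δ) := by
  rw [marchaudKer_eq_indicator, integrable_indicator_iff measurableSet_Ioi]
  exact integrableOn_Ioi_rpow_of_lt (by linarith) hδ

theorem integral_marchaudKer (hα : 0 < α) {δ : ℝ} (hδ : 0 < δ) :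
    ∫ r, marchaudKer α δ r = δ ^ (-α) / α := by
  rw [marchaudKer_eq_indicator, integral_indicator measurableSet_Ioi,
    integral_Ioi_rpow_of_lt (by linarith) hδ]
  rw [show -1 - α + 1 = -α by ring, neg_div_neg_eq]

/-- The Marchaud derivative of the Riemann-Liouville kernel, in closed form. -/
theorem marchaud_rlKer (hα : 0 < α) {δ x : ℝ} (hδ : 0 < δ) (hx : 0 < x) :
    (∫ r, marchaudKer α δ r) * rlKer α x - ∫ y, marchaudKer α δ (x - y) * rlKer α y =
      δ⁻¹ * idKer α (x / δ) := by
  have hΓ := Real.Gamma_pos_of_pos hα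
  have key : ∫ y, marchaudKer α δ (x - y) * rlKer α y =
      (max (x - δ) 0) ^ α / (α * Real.Gamma α * x * δ ^ α) := by
    have h0 : (fun y => marchaudKer α δ (x - y) * rlKer α y) =
        (Ioo 0 (x - δ)).indicator fun y => (x - y) ^ (-1 - α) * y ^ (α - 1) / Real.Gamma α := by
      ext y
      simp only [marchaudKer, rlKer, indicator, mem_Ioo]
      by_cases h1 : 0 < y <;> by_cases h2 : δ < x - y <;>
        simp [h1, h2, lt_sub_comm (a := y), mul_div_assoc]
    rw [h0, integral_indicator measurableSet_Ioo]
    rcases le_or_gt x δ with hle | hlt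
    · rw [Ioo_eq_empty (by linarith), max_eq_right (by linarith), Real.zero_rpow hα.ne']
      simp
    have hb : 0 < x - δ := by linarith
    rw [max_eq_left hb.le, ← integral_Ioc_eq_integral_Ioo, ← intervalIntegral.integral_of_le hb.le]
    -- The integrand is exact: `(y / (x - y)) ^ α` has derivative `α x (x - y) ^ (-1 - α) y ^ (α -
    -- 1)`.
    have hderiv : ∀ y ∈ Ioo 0 (x - δ), HasDerivAt
        (fun y => (y / (x - y)) ^ α / (α * x) / Real.Gamma α)
        ((x - y) ^ (-1 - α) * y ^ (α - 1) / Real.Gamma α) y := by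
      intro y hy
      have hxy : 0 < x - y := by linarith [hy.2]
      have h1 : HasDerivAt (fun y => y / (x - y)) (x / (x - y) ^ 2) y := by
        have := (hasDerivAt_id y).div ((hasDerivAt_id y).const_sub x) hxy.ne'
        refine this.congr_deriv ?_
        simp
      have h2 := ((h1.rpow_const (p := α) (Or.inl (div_pos hy.1 hxy).ne')).div_const
        (α * x)).div_const (Real.Gamma α)
      refine h2.congr_deriv ?_
      have e : (x - y) ^ (-1 - α) = ((x - y) * (x - y) ^ α)⁻¹ := by
        rw [Real.rpow_sub hxy, Real.rpow_neg_one, mul_inv, div_eq_mul_inv]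
      rw [e, Real.div_rpow hy.1.le hxy.le, Real.rpow_sub_one hxy.ne']
      field_simp
    have hcont : ContinuousOn (fun y => (y / (x - y)) ^ α / (α * x) / Real.Gamma α)
        (Icc 0 (x - δ)) := by
      refine (ContinuousOn.div_const (ContinuousOn.div_const (ContinuousOn.rpow_const ?_ ?_) _) _)
      · exact continuousOn_id.div (by fun_prop) fun y hy => by
          have := hy.2
          simp only [ne_eq]; linarith
      · exact fun _ _ => Or.inr hα.le
    -- A nonnegative derivative of a continuous function is integrable, so the singularity at `0`
    -- needs no separate estimate.
    have hint := intervalIntegral.integrableOn_deriv_of_nonneg hcont hderiv (by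
      intro y hy
      have hxy : 0 < x - y := by linarith [hy.2]
      exact div_nonneg (mul_nonneg (Real.rpow_nonneg hxy.le _) (Real.rpow_nonneg hy.1.le _)) hΓ.le)
    rw [intervalIntegral.integral_eq_sub_of_hasDerivAt_of_le hb.le hcont hderiv
      ((intervalIntegrable_iff_integrableOn_Ioc_of_le hb.le).2 hint)]
    rw [zero_div, Real.zero_rpow hα.ne', sub_sub_cancel, Real.div_rpow hb.le hδ.le]
    field_simp
    simp
  rw [key, integral_marchaudKer hα hδ, rlKer_of_pos hx, idKer, if_pos (div_pos hx hδ),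
    Real.div_rpow hx.le hδ.le, show max (x / δ - 1) 0 = max (x - δ) 0 / δ by
      rw [← max_div_div_right hδ.le, sub_div, div_self hδ.ne', zero_div],
    Real.div_rpow (le_max_right _ _) hδ.le, Real.rpow_neg hδ.le, Real.rpow_sub_one hx.ne']
  field_simp

theorem idKer_nonneg (hα : 0 < α) (u : ℝ) : 0 ≤ idKer α u := by
  unfold idKer
  split_ifs with h
  · have hΓ := Real.Gamma_pos_of_pos hα
    refine div_nonneg (sub_nonneg.2 (Real.rpow_le_rpow (le_max_right _ _) ?_ hα.le)) (by positivity)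
    exact max_le (by linarith) h.le
  · rfl

theorem measurable_idKer (hα : 0 < α) : Measurable (idKer α) := by
  unfold idKer
  refine Measurable.ite measurableSet_Ioi ?_ measurable_const
  have : Continuous fun x : ℝ => x ^ α := Real.continuous_rpow_const hα.le
  have h2 : Measurable fun u : ℝ => (max (u - 1) 0) ^ α :=
    (this.comp (by fun_prop : Continuous fun u : ℝ => max (u - 1) 0)).measurable
  exact (this.measurable.sub h2).div (by fun_prop)

/-- Near `0` the profile is of size `u ^ (α - 1)`; for large `u` the cancellation `u ^ α - (u - 1) ^
α ≤ u ^ (α - 1)` leaves the decay `u ^ (α - 2)`, integrable because `α < 1`. -/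
theorem integrable_idKer (hα : 0 < α) (hα₁ : α < 1) : Integrable (idKer α) := by
  have hΓ := Real.Gamma_pos_of_pos hα
  have h1 : IntegrableOn (idKer α) (Iic 0) :=
    integrableOn_zero.congr_fun
      (fun s hs => by rw [idKer, if_neg (not_lt.2 hs)]) measurableSet_Iic
  have h2 : IntegrableOn (idKer α) (Ioo 0 2) := by
    refine Integrable.mono' (((intervalIntegral.integrableOn_Ioo_rpow_iff (s := α - 1)
      two_pos).2 (by linarith)).div_const (α * Real.Gamma α))
      (measurable_idKer hα).aestronglyMeasurable ?_
    filter_upwards [ae_restrict_mem measurableSet_Ioo] with u hu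
    rw [Real.norm_of_nonneg (idKer_nonneg hα u), idKer, if_pos hu.1, Real.rpow_sub_one hu.1.ne',
      div_div, mul_comm u]
    have h0 := hu.1
    have := Real.rpow_nonneg (le_max_right (u - 1) 0) α
    refine div_le_div_of_nonneg_right ?_ (by positivity)
    linarith
  have h3 : IntegrableOn (idKer α) (Ioi 1) := by
    refine Integrable.mono' ((integrableOn_Ioi_rpow_of_lt (a := α - 2) (by linarith)
      one_pos).div_const (α * Real.Gamma α)) (measurable_idKer hα).aestronglyMeasurable ?_
    filter_upwards [ae_restrict_mem measurableSet_Ioi] with u hu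
    have hu1 : 1 < u := hu
    have hu0 : 0 < u := one_pos.trans hu1
    rw [Real.norm_of_nonneg (idKer_nonneg hα u), idKer, if_pos hu0, max_eq_left (by linarith)]
    have e : u ^ (α - 2) = u ^ α / u / u := by
      rw [Real.rpow_sub hu0, div_div, ← pow_two, Real.rpow_two]
    have hge : u ^ α - u ^ α / u ≤ (u - 1) ^ α := by
      have h4 : (u - 1) ^ α = u ^ α * (1 - 1 / u) ^ α := by
        rw [← Real.mul_rpow hu0.le]
        · congr 1; field_simp
        · rw [sub_nonneg, div_le_one hu0]; exact hu1.le
      have h5 : 1 - 1 / u ≤ (1 - 1 / u) ^ α := by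
        have h6 : 0 < 1 - 1 / u := by rw [sub_pos, div_lt_one hu0]; exact hu1
        conv_lhs => rw [← Real.rpow_one (1 - 1 / u)]
        exact Real.rpow_le_rpow_of_exponent_ge h6 (by simp [hu0.le]) hα₁.le
      rw [h4]
      have := mul_le_mul_of_nonneg_left h5 (Real.rpow_nonneg hu0.le α)
      calc _ = u ^ α * (1 - 1 / u) := by ring
        _ ≤ _ := this
    rw [e, div_div _ u (α * _), mul_comm u]
    refine div_le_div_of_nonneg_right ?_ (by positivity)
    linarith
  rw [← integrableOn_univ]
  refine ((h1.union h2).union h3).mono_set fun u _ => ?_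
  rcases le_or_gt u 0 with h | h
  · exact Or.inl (Or.inl h)
  · rcases lt_or_ge u 2 with h' | h'
    · exact Or.inl (Or.inr ⟨h, h'⟩)
    · exact Or.inr (show 1 < u by linarith)

/-- Only positivity of the mass matters: it appears as a common factor in the limiting inequality
and is cancelled. -/
theorem integral_idKer_pos (hα : 0 < α) (hα₁ : α < 1) : 0 < ∫ u, idKer α u := by
  rw [integral_pos_iff_support_of_nonneg (idKer_nonneg hα) (integrable_idKer hα hα₁)]
  have hΓ := Real.Gamma_pos_of_pos hα
  have : Ioo (0 : ℝ) 1 ⊆ Function.support (idKer α) := by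
    intro u hu
    have : max (u - 1) 0 = 0 := max_eq_right (by linarith [hu.2])
    rw [Function.mem_support, idKer, if_pos hu.1, this, Real.zero_rpow hα.ne', sub_zero]
    have := Real.rpow_pos_of_pos hu.1 α
    have := hu.1
    positivity
  exact lt_of_lt_of_le (by simp) (measure_mono this)

end kernels

/-! ### Approximate identity and associativity of convolution. -/

section identity

variable {α : ℝ} {F : Type*} [NormedAddCommGroup F] [NormedSpace ℝ F] [CompleteSpace F]

theorem idKer_conv_eq {δ : ℝ} (hδ : 0 < δ) (y : ℝ → F) (t : ℝ) :
    ∫ r, (δ⁻¹ * idKer α ((t - r) / δ)) • y r = ∫ u, idKer α u • y (t - δ * u) := by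
  have h1 := integral_sub_left_eq_self (fun r => (δ⁻¹ * idKer α ((t - r) / δ)) • y r)
    (volume : Measure ℝ) t
  have h2 := Measure.integral_comp_mul_left (fun r => (δ⁻¹ * idKer α (r / δ)) • y (t - r)) δ
  rw [← h1]
  simp only [sub_sub_cancel]
  rw [abs_of_pos (inv_pos.2 hδ)] at h2
  have h3 : ∫ r, (δ⁻¹ * idKer α (r / δ)) • y (t - r) =
      δ • ∫ x, (δ⁻¹ * idKer α (δ * x / δ)) • y (t - δ * x) := by
    rw [h2, smul_smul, mul_inv_cancel₀ hδ.ne', one_smul]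
  rw [h3, ← integral_smul]
  congr 1 with x
  rw [smul_smul, ← mul_assoc, mul_inv_cancel₀ hδ.ne', one_mul, mul_div_cancel_left₀ _ hδ.ne']

theorem idKer_conv_norm_le (hα : 0 < α) (hα₁ : α < 1) {δ : ℝ} (hδ : 0 < δ) {y : ℝ → F} {C : ℝ}
    (hC : ∀ r, ‖y r‖ ≤ C) (t : ℝ) :
    ‖∫ r, (δ⁻¹ * idKer α ((t - r) / δ)) • y r‖ ≤ (∫ u, idKer α u) * C := by
  rw [idKer_conv_eq hδ, ← integral_mul_const]
  refine norm_integral_le_of_norm_le ((integrable_idKer hα hα₁).mul_const C) (ae_of_all _ fun u => ?_)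
  rw [norm_smul, Real.norm_of_nonneg (idKer_nonneg hα u)]
  exact mul_le_mul_of_nonneg_left (hC _) (idKer_nonneg hα u)

/-- After rescaling, the kernel no longer depends on `d n` and dominated convergence applies.
Convergence is claimed at continuity points only, which is why forcing terms are later required to
be continuous almost everywhere. -/
theorem tendsto_idKer_conv (hα : 0 < α) (hα₁ : α < 1) {y : ℝ → F} (hy : AEStronglyMeasurable y)
    {C : ℝ} (hC : ∀ r, ‖y r‖ ≤ C) {t : ℝ} (hc : ContinuousAt y t) {d : ℕ → ℝ}
    (hd : ∀ n, 0 < d n) (hd0 : Tendsto d atTop (𝓝 0)) :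
    Tendsto (fun n => ∫ r, ((d n)⁻¹ * idKer α ((t - r) / d n)) • y r) atTop
      (𝓝 ((∫ u, idKer α u) • y t)) := by
  simp only [idKer_conv_eq (hd _)]
  rw [← integral_smul_const]
  refine tendsto_integral_of_dominated_convergence (fun u => idKer α u * C) (fun n => ?_)
    ((integrable_idKer hα hα₁).mul_const C) (fun n => ae_of_all _ fun u => ?_)
    (ae_of_all _ fun u => ?_)
  · refine (measurable_idKer hα).aestronglyMeasurable.smul ?_
    have hq : Measure.QuasiMeasurePreserving (fun u : ℝ => t - d n * u) volume volume := by
      have h1 : Measure.QuasiMeasurePreserving (fun u : ℝ => d n * u) volume volume := by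
        refine ⟨by fun_prop, ?_⟩
        rw [Real.map_volume_mul_left (hd n).ne']
        exact Measure.smul_absolutelyContinuous
      exact (volume.measurePreserving_sub_left t).quasiMeasurePreserving.comp h1
    exact hy.comp_quasiMeasurePreserving hq
  · rw [norm_smul, Real.norm_of_nonneg (idKer_nonneg hα u)]
    exact mul_le_mul_of_nonneg_left (hC _) (idKer_nonneg hα u)
  · refine Tendsto.const_smul (hc.tendsto.comp ?_) _
    have := (hd0.mul_const u).const_sub t
    simpa using this

/-- Associativity of convolution, for integrable kernels and a bounded function. -/
theorem conv_assoc_of_bounded {a b : ℝ → ℝ} (ha : Integrable a) (hb : Integrable b)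
    {q : ℝ → F} (hq : AEStronglyMeasurable q) {C : ℝ} (hC : ∀ r, ‖q r‖ ≤ C) (t : ℝ) :
    ∫ s, a (t - s) • ∫ r, b (s - r) • q r = ∫ r, (∫ y, a (t - r - y) * b y) • q r := by
  have hint : Integrable (fun p : ℝ × ℝ => a (t - p.2) * b (p.2 - p.1)) (volume.prod volume) := by
    have := Integrable.convolution_integrand (ContinuousLinearMap.mul ℝ ℝ) (ha.comp_sub_left t)
      (f := fun y => a (t - y)) (g := fun x => b (-x)) hb.comp_neg
    refine this.congr (ae_of_all _ fun p => ?_)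
    simp
  have hint2 : Integrable (fun p : ℝ × ℝ => (a (t - p.2) * b (p.2 - p.1)) • q p.1)
      (volume.prod volume) := by
    exact hint.smul_bdd C (hq.comp_fst) (ae_of_all _ fun p => hC p.1)
  calc ∫ s, a (t - s) • ∫ r, b (s - r) • q r
      = ∫ s, ∫ r, (a (t - s) * b (s - r)) • q r := by
        congr 1 with s
        rw [← integral_smul]
        simp only [smul_smul]
    _ = ∫ r, ∫ s, (a (t - s) * b (s - r)) • q r :=
        (integral_integral_swap (f := fun r s => (a (t - s) * b (s - r)) • q r) hint2).symm
    _ = _ := by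
        congr 1 with r
        rw [integral_smul_const, ← integral_sub_right_eq_self (fun y => a (t - r - y) * b y) r]
        congr 2 with s
        ring_nf

end identity

end FracControl

end

noncomputable section

namespace FracControl

section identity

variable {α : ℝ} {F : Type*} [NormedAddCommGroup F] [NormedSpace ℝ F] [CompleteSpace F]

/-- The kernel is not integrable at infinity; cutting it at a time beyond the range of interest
makes all convolutions below convolutions with integrable kernels. -/
theorem integrable_rlKer_indicator (hα : 0 < α) (T : ℝ) :
    Integrable ((Iio T).indicator (rlKer α)) :=
  (integrable_indicator_iff measurableSet_Iio).2 (integrableOn_rlKer hα T)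

/-- The truncated Marchaud derivative of a fractional integral is an approximate identity. -/
theorem marchaud_conv (hα : 0 < α) {δ T t : ℝ} (hδ : 0 < δ) (htT : t < T)
    {y : ℝ → F} (hy : AEStronglyMeasurable y) {C : ℝ} (hC : ∀ r, ‖y r‖ ≤ C)
    (hy0 : ∀ r ≤ 0, y r = 0) :
    (∫ r, marchaudKer α δ r) • (∫ s, (Iio T).indicator (rlKer α) (t - s) • y s) -
      ∫ r, (∫ x, marchaudKer α δ (t - r - x) * (Iio T).indicator (rlKer α) x) • y r =
      ∫ r, (δ⁻¹ * idKer α ((t - r) / δ)) • y r := by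
  have hk := integrable_marchaudKer hα hδ
  have hκ := integrable_rlKer_indicator hα T
  have h1 : Integrable fun s => (Iio T).indicator (rlKer α) (t - s) • y s :=
    (hκ.comp_sub_left t).smul_bdd C hy (ae_of_all _ hC)
  have h2 : Integrable fun r =>
      (∫ x, marchaudKer α δ (t - r - x) * (Iio T).indicator (rlKer α) x) • y r := by
    have := hκ.integrable_convolution (ContinuousLinearMap.mul ℝ ℝ) hk
    have h3 : Integrable fun r =>
        ∫ x, marchaudKer α δ (t - r - x) * (Iio T).indicator (rlKer α) x := by
      refine (this.comp_sub_left t).congr (ae_of_all _ fun r => ?_)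
      simp only [convolution_def, ContinuousLinearMap.mul_apply']
      exact integral_congr_ae (ae_of_all _ fun x => mul_comm _ _)
    exact h3.smul_bdd C hy (ae_of_all _ hC)
  have h1' : Integrable fun s => (∫ r, marchaudKer α δ r) •
      (Iio T).indicator (rlKer α) (t - s) • y s := h1.smul _
  rw [← integral_smul, ← integral_sub h1' h2]
  refine integral_congr_ae (ae_of_all _ fun r => ?_)
  simp only [smul_smul, ← sub_smul]
  rcases le_or_gt r 0 with hr | hr
  · simp [hy0 r hr]
  congr 1
  rcases le_or_gt t r with htr | htr
  · have e1 : (Iio T).indicator (rlKer α) (t - r) = 0 := by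
      rw [indicator_apply, rlKer_of_nonpos (by linarith), ite_self]
    have e2 : ∀ x, marchaudKer α δ (t - r - x) * (Iio T).indicator (rlKer α) x = 0 := by
      intro x
      rcases le_or_gt x 0 with hx | hx
      · rw [indicator_apply, rlKer_of_nonpos hx, ite_self, mul_zero]
      · rw [marchaudKer, if_neg (by linarith), zero_mul]
    have e3 : idKer α ((t - r) / δ) = 0 := by
      rw [idKer, if_neg (not_lt.2 (div_nonpos_of_nonpos_of_nonneg (by linarith) hδ.le))]
    simp [e1, e2, e3]
  -- The cut at `T` is invisible: `0 < r` gives `t - r < T`, and for `T ≤ x` the Marchaud kernel is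
  -- evaluated at a negative argument.
  · rw [← marchaud_rlKer hα hδ (by linarith : 0 < t - r)]
    congr 2
    · rw [indicator_of_mem]; exact show t - r < T by linarith
    · congr 1 with x
      rcases lt_or_ge x T with hx | hx
      · rw [indicator_of_mem (show x ∈ Iio T from hx)]
      · rw [marchaudKer, if_neg (by linarith), zero_mul, zero_mul]

end identity

/-! ### Radial convex functions and the fractional chain rule inequality. -/

section convexity

variable {E : Type*} [NormedAddCommGroup E] [InnerProductSpace ℝ E]

/-- A convex function `φ` with radial gradient `θ x • x`, where `0 ≤ θ ≤ C`. -/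
structure RadialConvex (φ θ : E → ℝ) (C : ℝ) : Prop where
  continuous_fun : Continuous φ
  continuous_grad : Continuous θ
  nonneg : ∀ x, 0 ≤ θ x
  le : ∀ x, θ x ≤ C
  sub_le : ∀ x y, φ x - φ y ≤ θ x * ⟪x, x - y⟫

theorem radialConvex_sq : RadialConvex (fun x : E => ‖x‖ ^ 2 / 2) (fun _ => 1) 1 where
  continuous_fun := by fun_prop
  continuous_grad := continuous_const
  nonneg _ := zero_le_one
  le _ := le_rfl
  sub_le x y := by
    rw [inner_sub_right, real_inner_self_eq_norm_sq]
    have := real_inner_le_norm x y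
    nlinarith [sq_nonneg (‖x‖ - ‖y‖)]

/-- The smoothed norm `√(ε² + ‖x‖²)`. -/
def smoothNorm (ε : ℝ) (x : E) : ℝ := √(ε ^ 2 + ‖x‖ ^ 2)

theorem smoothNorm_pos {ε : ℝ} (hε : 0 < ε) (x : E) : 0 < smoothNorm ε x :=
  Real.sqrt_pos.2 (by positivity)

theorem le_smoothNorm (ε : ℝ) (x : E) : ε ≤ smoothNorm ε x :=
  Real.le_sqrt_of_sq_le (by nlinarith [sq_nonneg ‖x‖])

theorem norm_le_smoothNorm (ε : ℝ) (x : E) : ‖x‖ ≤ smoothNorm ε x :=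
  Real.le_sqrt_of_sq_le (by nlinarith [sq_nonneg ε])

theorem smoothNorm_le {ε : ℝ} (hε : 0 < ε) (x : E) : smoothNorm ε x ≤ ε + ‖x‖ := by
  refine Real.sqrt_le_iff.2 ⟨by positivity, ?_⟩
  nlinarith [norm_nonneg x]

/-- Smoothing removes the singularity of the norm at `0` while the gradient `x / √(ε² + ‖x‖²)` stays
in the unit ball. The convexity inequality is Cauchy-Schwarz for the vectors `(ε, x)` and `(ε, y)`.
-/
theorem radialConvex_smoothNorm {ε : ℝ} (hε : 0 < ε) :
    RadialConvex (smoothNorm ε : E → ℝ) (fun x => (smoothNorm ε x)⁻¹) ε⁻¹ where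
  continuous_fun := by unfold smoothNorm; fun_prop
  continuous_grad := by
    refine Continuous.inv₀ (by unfold smoothNorm; fun_prop) fun x => (smoothNorm_pos hε x).ne'
  nonneg x := (inv_pos.2 (smoothNorm_pos hε x)).le
  le x := inv_anti₀ hε (le_smoothNorm ε x)
  sub_le x y := by
    have hx := smoothNorm_pos hε x
    have hy := smoothNorm_pos hε y
    rw [inv_mul_eq_div, le_div_iff₀ hx, inner_sub_right, real_inner_self_eq_norm_sq]
    have h1 : smoothNorm ε x ^ 2 = ε ^ 2 + ‖x‖ ^ 2 := Real.sq_sqrt (by positivity)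
    have h2 : smoothNorm ε y ^ 2 = ε ^ 2 + ‖y‖ ^ 2 := Real.sq_sqrt (by positivity)
    have h3 := real_inner_le_norm x y
    have h4 : ε ^ 2 + ‖x‖ * ‖y‖ ≤ smoothNorm ε y * smoothNorm ε x := by
      refine le_of_sq_le_sq ?_ (by positivity)
      rw [mul_pow, h1, h2]
      nlinarith [sq_nonneg (‖x‖ - ‖y‖), mul_nonneg (sq_nonneg ε) (sq_nonneg (‖x‖ - ‖y‖))]
    nlinarith

variable [CompleteSpace E]

/-- The fractional chain rule inequality: if `w - z₀` is the fractional integral of `q`, then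
`φ (w t) - φ z₀` is at most the fractional integral of `⟪∇φ(w), q⟫`. -/
theorem RadialConvex.fractional_le {α : ℝ} (hα : 0 < α) (hα₁ : α < 1) {φ θ : E → ℝ} {C₀ : ℝ}
    (h : RadialConvex φ θ C₀) {T t C : ℝ} (ht : t ∈ Ioo 0 T) {q w : ℝ → E} {z₀ : E}
    (hq : AEStronglyMeasurable q (volume.restrict (Ioo 0 T)))
    (hC : ∀ s ∈ Ioo 0 T, ‖q s‖ ≤ C)
    (hqc : ∀ᵐ s ∂volume.restrict (Ioo 0 T), ContinuousAt q s)
    (hw : ContinuousOn w (Icc 0 T))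
    (hwq : ∀ᵐ s ∂volume.restrict (Ioo 0 T),
      w s = z₀ + ∫ r in Ioi 0, rlKer α (s - r) • q r) :
    φ (w t) ≤ φ z₀ + ∫ s in Ioi 0, rlKer α (t - s) * (θ (w s) * ⟪w s, q s⟫) := by
  have hT : 0 < T := ht.1.trans ht.2
  have hC0 : 0 ≤ C := (norm_nonneg _).trans (hC t ht)
  set κ := (Iio T).indicator (rlKer α) with hκdef
  have hκ : Integrable κ := integrable_rlKer_indicator hα T
  have hκ0 : ∀ s, 0 ≤ κ s := fun s => indicator_nonneg (fun s _ => rlKer_nonneg hα s) s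
  have hκneg : ∀ s ≤ 0, κ s = 0 := fun s hs => by
    rw [hκdef, indicator_apply, rlKer_of_nonpos hs, ite_self]
  set q' := (Ioo 0 T).indicator q with hq'def
  have hq' : AEStronglyMeasurable q' :=
    (aestronglyMeasurable_indicator_iff measurableSet_Ioo).2 hq
  have hq'C : ∀ s, ‖q' s‖ ≤ C := by
    intro s
    rw [hq'def, indicator_apply]
    split_ifs with hs
    · exact hC s hs
    · simpa using hC0
  have hq'0 : ∀ r ≤ 0, q' r = 0 := fun r hr => indicator_of_notMem (fun h' => hr.not_gt h'.1) _
  -- Extending `y` and `v` by zero amounts to giving `w` the constant value `z₀` at nonpositive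
  -- times.
  set y := (Ioo 0 T).indicator (fun s => w s - z₀) with hydef
  have hy : AEStronglyMeasurable y := by
    refine (aestronglyMeasurable_indicator_iff measurableSet_Ioo).2 ?_
    exact ((hw.mono Ioo_subset_Icc_self).sub continuousOn_const).aestronglyMeasurable
      measurableSet_Ioo
  obtain ⟨B₁, hB₁⟩ := isCompact_Icc.exists_bound_of_continuousOn (hw.sub continuousOn_const)
    (f := fun s => w s - z₀)
  have hyB : ∀ s, ‖y s‖ ≤ |B₁| := by
    intro s
    rw [hydef, indicator_apply]
    split_ifs with hs
    · exact (hB₁ s (Ioo_subset_Icc_self hs)).trans (le_abs_self _)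
    · simp
  have hφw : ContinuousOn (fun s => φ (w s)) (Icc 0 T) := h.continuous_fun.comp_continuousOn hw
  have hθw : ContinuousOn (fun s => θ (w s)) (Icc 0 T) := h.continuous_grad.comp_continuousOn hw
  set v := (Ioo 0 T).indicator (fun s => φ (w s) - φ z₀) with hvdef
  have hv : AEStronglyMeasurable v := by
    refine (aestronglyMeasurable_indicator_iff measurableSet_Ioo).2 ?_
    exact ((hφw.mono Ioo_subset_Icc_self).sub continuousOn_const).aestronglyMeasurable
      measurableSet_Ioo
  obtain ⟨B₂, hB₂⟩ := isCompact_Icc.exists_bound_of_continuousOn (hφw.sub continuousOn_const)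
    (f := fun s => φ (w s) - φ z₀)
  have hvB : ∀ s, ‖v s‖ ≤ |B₂| := by
    intro s
    rw [hvdef, indicator_apply]
    split_ifs with hs
    · exact (hB₂ s (Ioo_subset_Icc_self hs)).trans (le_abs_self _)
    · simp
  have hv0 : ∀ r ≤ 0, v r = 0 := fun r hr => indicator_of_notMem (fun h' => hr.not_gt h'.1) _
  have hy0 : ∀ r ≤ 0, y r = 0 := fun r hr => indicator_of_notMem (fun h' => hr.not_gt h'.1) _
  have hvc : ContinuousAt v t := by
    have h1 : ContinuousAt (fun s => φ (w s) - φ z₀) t :=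
      (hφw.continuousAt (Icc_mem_nhds ht.1 ht.2)).sub continuousAt_const
    refine h1.congr ?_
    filter_upwards [Ioo_mem_nhds ht.1 ht.2] with s hs
    rw [hvdef, indicator_of_mem hs]
  obtain ⟨B₃, hB₃⟩ := isCompact_Icc.exists_bound_of_continuousOn (hθw.smul hw)
    (f := fun s => θ (w s) • w s)
  have hyconv : ∀ᵐ s, s < T → y s = ∫ r, κ (s - r) • q' r := by
    have := (ae_restrict_iff' measurableSet_Ioo).1 hwq
    filter_upwards [this] with s hs hsT
    rcases le_or_gt s 0 with h0 | h0
    · rw [hy0 s h0, eq_comm]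
      refine integral_eq_zero_of_ae (ae_of_all _ fun r => ?_)
      rcases le_or_gt r 0 with hr | hr
      · simp [hq'0 r hr]
      · simp [hκneg (s - r) (by linarith)]
    · rw [hydef, indicator_of_mem (show s ∈ Ioo 0 T from ⟨h0, hsT⟩), hs ⟨h0, hsT⟩, add_sub_cancel_left,
        ← integral_indicator measurableSet_Ioi]
      refine integral_congr_ae (ae_of_all _ fun r => ?_)
      rcases le_or_gt r 0 with hr | hr
      · rw [indicator_of_notMem (by simpa using hr)]
        simp [hq'0 r hr]
      · rw [indicator_of_mem (by simpa using hr)]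
        rcases le_or_gt s r with hsr | hsr
        · simp [hκneg (s - r) (by linarith), rlKer_of_nonpos (by linarith : s - r ≤ 0)]
        · simp only [hκdef, hq'def]
          rw [indicator_of_mem (show s - r ∈ Iio T from by simp only [mem_Iio]; linarith),
            indicator_of_mem (show r ∈ Ioo 0 T from ⟨hr, by linarith⟩)]
  -- A mollification of `q`, up to the factor `∫ idKer`; it equals the truncated Marchaud derivative
  -- of `y` almost everywhere on `(0, T)`, as `e1` in the next block shows.
  set G : ℝ → ℝ → E := fun δ s => ∫ r, (δ⁻¹ * idKer α ((s - r) / δ)) • q' r with hGdef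
  have hGm : ∀ δ, 0 < δ → AEStronglyMeasurable (G δ) := by
    intro δ hδ
    have h1 : Integrable fun x => δ⁻¹ * idKer α (x / δ) :=
      ((integrable_idKer hα hα₁).comp_div hδ.ne').const_mul _
    have h2 : Integrable q' := by
      rw [hq'def, integrable_indicator_iff measurableSet_Ioo]
      exact IntegrableOn.of_bound (by simp) hq C
        ((ae_restrict_iff' measurableSet_Ioo).2 (ae_of_all _ hC))
    have := (h2.integrable_convolution (ContinuousLinearMap.lsmul ℝ ℝ).flip h1).aestronglyMeasurable
    refine this.congr (ae_of_all _ fun s => ?_)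
    simp [convolution_def, hGdef]
  have hGB : ∀ δ, 0 < δ → ∀ s, ‖G δ s‖ ≤ (∫ u, idKer α u) * C := fun δ hδ s =>
    idKer_conv_norm_le hα hα₁ hδ hq'C s
  have hcomp : ∀ s, Measure.QuasiMeasurePreserving (fun r : ℝ => s - r) volume volume := fun s =>
    (volume.measurePreserving_sub_left s).quasiMeasurePreserving
  -- Convexity bounds each increment of `φ ∘ w` by the gradient paired with the increment of `w`;
  -- the nonnegative Marchaud kernel integrates these bounds.
  have hstep : ∀ δ, 0 < δ → ∀ᵐ s, s ∈ Ioo 0 T →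
      ∫ r, marchaudKer α δ r * (v s - v (s - r)) ≤ θ (w s) * ⟪w s, G δ s⟫ := by
    intro δ hδ
    have hk := integrable_marchaudKer hα hδ
    have hk0 := marchaudKer_nonneg (α := α) hδ
    filter_upwards [hyconv] with s hys hs
    have i2 : Integrable fun r => marchaudKer α δ r • y (s - r) :=
      hk.smul_bdd |B₁| (hy.comp_quasiMeasurePreserving (hcomp s)) (ae_of_all _ fun r => hyB _)
    have i3 : Integrable fun r => marchaudKer α δ r • (y s - y (s - r)) := by
      simp only [smul_sub]
      exact (hk.smul_const _).sub i2
    have i4 : Integrable fun r => marchaudKer α δ r * (v s - v (s - r)) := by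
      simp only [mul_sub]
      exact (hk.mul_const _).sub
        (hk.mul_bdd (hv.comp_quasiMeasurePreserving (hcomp s)) (ae_of_all _ fun r => hvB _))
    have e1 : G δ s = ∫ r, marchaudKer α δ r • (y s - y (s - r)) := by
      have e2 : ∫ r, marchaudKer α δ r • (y s - y (s - r)) =
          (∫ r, marchaudKer α δ r) • y s - ∫ r, marchaudKer α δ r • y (s - r) := by
        rw [← integral_smul_const, ← integral_sub (hk.smul_const _) i2]
        simp only [smul_sub]
      have e3 : ∫ r, marchaudKer α δ r • y (s - r) =
          ∫ σ, marchaudKer α δ (s - σ) • ∫ r, κ (σ - r) • q' r := by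
        rw [← integral_sub_left_eq_self _ volume s]
        simp only [sub_sub_cancel]
        refine integral_congr_ae ?_
        filter_upwards [hyconv] with σ hσ
        rcases lt_or_ge σ T with h1 | h1
        · rw [hσ h1]
        · simp only [marchaudKer]
          rw [if_neg (by linarith [hs.2]), zero_smul, zero_smul]
      rw [e2, e3, hys hs.2, conv_assoc_of_bounded hk hκ hq' hq'C,
        marchaud_conv hα hδ hs.2 hq' hq'C hq'0]
    rw [e1, ← integral_inner i3, ← integral_const_mul]
    refine integral_mono i4 ((i3.const_inner _).const_mul _) fun r => ?_
    simp only [inner_smul_right]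
    rw [mul_left_comm]
    by_cases hr : δ < r
    · refine mul_le_mul_of_nonneg_left ?_ (hk0 r)
      simp only [hvdef, hydef]
      rw [indicator_of_mem hs, indicator_of_mem hs]
      by_cases hsr : s - r ∈ Ioo 0 T
      · rw [indicator_of_mem hsr, indicator_of_mem hsr, sub_sub_sub_cancel_right,
          sub_sub_sub_cancel_right]
        exact h.sub_le _ _
      -- Here `s - r ≤ 0`, so convexity is used between `w s` and `z₀`.
      · rw [indicator_of_notMem hsr, indicator_of_notMem hsr, sub_zero, sub_zero]
        exact h.sub_le _ _
    · simp [marchaudKer, hr]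
  have hM := integral_idKer_pos hα hα₁
  set M := ∫ u, idKer α u with hMdef
  set R : (ℝ → E) → ℝ → ℝ := fun g s =>
    κ (t - s) * (Ioo 0 T).indicator (fun s => θ (w s) * ⟪w s, g s⟫) s with hR
  have hRbound : ∀ (g : ℝ → E) s, ‖g s‖ ≤ M * C → ‖R g s‖ ≤ κ (t - s) * (|B₃| * (M * C)) := by
    intro g s hg
    rw [hR, norm_mul, Real.norm_of_nonneg (hκ0 _)]
    refine mul_le_mul_of_nonneg_left ?_ (hκ0 _)
    rw [indicator_apply]
    split_ifs with hs
    · rw [← real_inner_smul_left]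
      refine (norm_inner_le_norm _ _).trans ?_
      exact mul_le_mul ((hB₃ s (Ioo_subset_Icc_self hs)).trans (le_abs_self _)) hg
        (norm_nonneg _) (abs_nonneg _)
    · simp only [norm_zero]; positivity
  have hRm : ∀ g : ℝ → E, AEStronglyMeasurable g → AEStronglyMeasurable (R g) := by
    intro g hg
    refine (hκ.aestronglyMeasurable.comp_quasiMeasurePreserving (hcomp t)).mul ?_
    refine (aestronglyMeasurable_indicator_iff measurableSet_Ioo).2 ?_
    exact ((hθw.mono Ioo_subset_Icc_self).aestronglyMeasurable measurableSet_Ioo).mul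
      (((hw.mono Ioo_subset_Icc_self).aestronglyMeasurable measurableSet_Ioo).inner hg.restrict)
  have hdom : Integrable fun s => κ (t - s) * (|B₃| * (M * C)) := (hκ.comp_sub_left t).mul_const _
  -- Convolving `hstep` with the fractional kernel undoes the Marchaud derivative on the left:
  -- associativity of convolution turns it into a mollification of `v`.
  have hmain : ∀ δ, 0 < δ →
      ∫ r, (δ⁻¹ * idKer α ((t - r) / δ)) • v r ≤ ∫ s, R (G δ) s := by
    intro δ hδ
    have hk := integrable_marchaudKer hα hδ
    have i1 : Integrable fun s => κ (t - s) * v s :=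
      (hκ.comp_sub_left t).mul_bdd hv (ae_of_all _ hvB)
    have hkv : ∀ s, Integrable fun r => marchaudKer α δ r * v (s - r) := fun s =>
      hk.mul_bdd (hv.comp_quasiMeasurePreserving (hcomp s)) (ae_of_all _ fun r => hvB _)
    have hvi : Integrable v := by
      rw [hvdef, integrable_indicator_iff measurableSet_Ioo]
      refine IntegrableOn.of_bound (by simp) ?_ |B₂| ?_
      · exact (aestronglyMeasurable_indicator_iff measurableSet_Ioo).1 hv
      · refine (ae_restrict_iff' measurableSet_Ioo).2 (ae_of_all _ fun s hs => ?_)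
        simpa [hvdef, hs] using hvB s
    have hconvm : AEStronglyMeasurable fun s => ∫ σ, marchaudKer α δ (s - σ) * v σ := by
      have := (hvi.integrable_convolution (ContinuousLinearMap.mul ℝ ℝ) hk).aestronglyMeasurable
      refine this.congr (ae_of_all _ fun s => ?_)
      simp [convolution_def, mul_comm]
    have hconvB : ∀ s, ‖∫ σ, marchaudKer α δ (s - σ) * v σ‖ ≤
        (∫ r, marchaudKer α δ r) * |B₂| := by
      intro s
      rw [← integral_sub_left_eq_self _ volume s, ← integral_mul_const]
      refine norm_integral_le_of_norm_le (hk.mul_const _) (ae_of_all _ fun r => ?_)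
      simp only [sub_sub_cancel]
      rw [norm_mul, Real.norm_of_nonneg (marchaudKer_nonneg hδ r)]
      exact mul_le_mul_of_nonneg_left (hvB _) (marchaudKer_nonneg hδ r)
    have i5 : Integrable fun s => κ (t - s) * ∫ σ, marchaudKer α δ (s - σ) * v σ :=
      (hκ.comp_sub_left t).mul_bdd hconvm (ae_of_all _ hconvB)
    have e0 : ∀ s, ∫ r, marchaudKer α δ r * (v s - v (s - r)) =
        (∫ r, marchaudKer α δ r) * v s - ∫ σ, marchaudKer α δ (s - σ) * v σ := by
      intro s
      simp only [mul_sub]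
      rw [integral_sub (hk.mul_const _) (hkv s), integral_mul_const]
      congr 1
      rw [← integral_sub_left_eq_self (fun σ => marchaudKer α δ (s - σ) * v σ) volume s]
      simp only [sub_sub_cancel]
    have i6 : Integrable fun s => κ (t - s) * ∫ r, marchaudKer α δ r * (v s - v (s - r)) := by
      simp only [e0]
      simp only [mul_sub]
      refine Integrable.sub ?_ i5
      simpa only [mul_left_comm] using i1.const_mul (∫ r, marchaudKer α δ r)
    have e1 : ∫ r, (δ⁻¹ * idKer α ((t - r) / δ)) • v r =
        ∫ s, κ (t - s) * ∫ r, marchaudKer α δ r * (v s - v (s - r)) := by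
      rw [← marchaud_conv hα hδ ht.2 hv hvB hv0]
      simp only [e0]
      simp only [mul_sub, smul_eq_mul]
      have i7 : Integrable fun s => κ (t - s) * ((∫ r, marchaudKer α δ r) * v s) := by
        simpa only [mul_left_comm] using i1.const_mul (∫ r, marchaudKer α δ r)
      rw [integral_sub i7 i5]
      congr 1
      · rw [← integral_const_mul]
        simp only [mul_left_comm]
        rfl
      · have := conv_assoc_of_bounded hκ hk hv hvB t
        simp only [smul_eq_mul] at this
        rw [this]
        congr 1 with r
        congr 1
        rw [← integral_sub_left_eq_self _ volume (t - r)]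
        simp only [sub_sub_cancel, mul_comm]
        rfl
    rw [e1]
    have hRi : Integrable (R (G δ)) := hdom.mono' (hRm _ (hGm δ hδ))
      (ae_of_all _ fun s => hRbound _ s (hGB δ hδ s))
    refine integral_mono_ae i6 hRi ?_
    filter_upwards [hstep δ hδ] with s hs
    simp only [hR]
    by_cases hsT : s ∈ Ioo 0 T
    · rw [indicator_of_mem hsT]
      exact mul_le_mul_of_nonneg_left (hs hsT) (hκ0 _)
    · rw [indicator_of_notMem hsT, mul_zero]
      rcases le_or_gt s 0 with h0 | h0
      · refine (mul_eq_zero_of_right _ (integral_eq_zero_of_ae (ae_of_all _ fun r => ?_))).le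
        simp only [Pi.zero_apply, mul_eq_zero]
        by_cases hr : δ < r
        · right
          rw [hv0 s h0, hv0 (s - r) (by linarith), sub_zero]
        · left; simp [marchaudKer, hr]
      · have : T ≤ s := by by_contra h'; exact hsT ⟨h0, not_le.1 h'⟩
        rw [hκneg _ (by linarith [ht.2]), zero_mul]
  have hd : ∀ n : ℕ, 0 < 1 / ((n : ℝ) + 1) := fun n => by positivity
  have hd0 := tendsto_one_div_add_atTop_nhds_zero_nat (𝕜 := ℝ)
  have lim1 := tendsto_idKer_conv hα hα₁ hv hvB hvc hd hd0
  have lim2 : Tendsto (fun n : ℕ => ∫ s, R (G (1 / ((n : ℝ) + 1))) s) atTop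
      (𝓝 (∫ s, R (fun s => M • q' s) s)) := by
    refine tendsto_integral_of_dominated_convergence _ (fun n => hRm _ (hGm _ (hd n))) hdom
      (fun n => ae_of_all _ fun s => hRbound _ s (hGB _ (hd n) s)) ?_
    filter_upwards [(ae_restrict_iff' measurableSet_Ioo).1 hqc] with s hs
    simp only [hR]
    by_cases hsT : s ∈ Ioo 0 T
    · simp only [indicator_of_mem hsT]
      refine Tendsto.const_mul _ (Tendsto.const_mul _ (Tendsto.inner tendsto_const_nhds ?_))
      refine tendsto_idKer_conv hα hα₁ hq' hq'C ?_ hd hd0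
      refine (hs hsT).congr ?_
      filter_upwards [Ioo_mem_nhds hsT.1 hsT.2] with r hr
      rw [hq'def, indicator_of_mem hr]
    · simp only [indicator_of_notMem hsT]
      exact tendsto_const_nhds
  have hfin := le_of_tendsto_of_tendsto' lim1 lim2 fun n => hmain _ (hd n)
  have e1 : v t = φ (w t) - φ z₀ := by rw [hvdef, indicator_of_mem ht]
  have e2 : ∫ s, R (fun s => M • q' s) s =
      M * ∫ s in Ioi 0, rlKer α (t - s) * (θ (w s) * ⟪w s, q s⟫) := by
    rw [← integral_indicator measurableSet_Ioi, ← integral_const_mul]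
    refine integral_congr_ae (ae_of_all _ fun s => ?_)
    simp only [hR]
    rcases le_or_gt s 0 with h0 | h0
    · rw [indicator_of_notMem (fun h' => h0.not_gt h'.1), indicator_of_notMem (by simpa using h0)]
      simp
    rw [indicator_of_mem (show s ∈ Ioi 0 from h0)]
    rcases le_or_gt t s with hts | hts
    · rw [hκneg _ (by linarith), rlKer_of_nonpos (by linarith)]; simp
    · have hsT : s ∈ Ioo 0 T := ⟨h0, hts.trans ht.2⟩
      rw [indicator_of_mem hsT, inner_smul_right, hq'def, indicator_of_mem hsT, hκdef,
        indicator_of_mem (show t - s ∈ Iio T from by simp only [mem_Iio]; linarith [ht.2])]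
      ring
  rw [e1, e2, smul_eq_mul] at hfin
  linarith [le_of_mul_le_mul_left hfin hM]

end convexity

end FracControl

end

noncomputable section

namespace FracControl

/-! ### Laplace transforms on the half-line. -/

section laplace

variable {F : Type*} [NormedAddCommGroup F] [NormedSpace ℝ F] [CompleteSpace F]

/-- A function on `(0, ∞)` whose Laplace transform vanishes on a half-line is zero. -/
theorem ae_eq_zero_of_laplace_eq_zero {f : ℝ → F} {ω : ℝ}
    (hf : ∀ ν, ω < ν → IntegrableOn (fun t => Real.exp (-(ν * t)) • f t) (Ioi 0))
    (h0 : ∀ ν, ω < ν → ∫ t in Ioi (0 : ℝ), Real.exp (-(ν * t)) • f t = 0) :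
    ∀ᵐ t ∂volume.restrict (Ioi (0 : ℝ)), f t = 0 := by
  -- The weight makes `G` integrable, and the hypothesis at `ν = ω + 1 + n` says that `G` is
  -- orthogonal to `(e ^ (-t)) ^ n`. Weierstrass' theorem extends this to all continuous functions
  -- of `e ^ (-t)`.
  set G : ℝ → F := fun t => Real.exp (-((ω + 1) * t)) • f t with hG
  have hGi : IntegrableOn G (Ioi 0) := hf _ (by linarith)
  have hbdd : ∀ {ψ : ℝ → ℝ} {C : ℝ}, ContinuousOn ψ (Icc 0 1) → (∀ x ∈ Icc (0 : ℝ) 1, ‖ψ x‖ ≤ C) →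
      IntegrableOn (fun t => ψ (Real.exp (-t)) • G t) (Ioi 0) := by
    intro ψ C hψ hC
    refine hGi.bdd_smul (C := C) ?_ ?_
    · refine ContinuousOn.aestronglyMeasurable ?_ measurableSet_Ioi
      refine hψ.comp (by fun_prop) fun t ht => ⟨(Real.exp_pos _).le, ?_⟩
      rw [Real.exp_le_one_iff]
      exact neg_nonpos.2 (le_of_lt ht)
    · filter_upwards [ae_restrict_mem measurableSet_Ioi] with t ht
      refine hC _ ⟨(Real.exp_pos _).le, ?_⟩
      rw [Real.exp_le_one_iff]
      exact neg_nonpos.2 (le_of_lt ht)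
  have hcompact : ∀ {ψ : ℝ → ℝ}, ContinuousOn ψ (Icc 0 1) →
      IntegrableOn (fun t => ψ (Real.exp (-t)) • G t) (Ioi 0) := by
    intro ψ hψ
    obtain ⟨C, hC⟩ := isCompact_Icc.exists_bound_of_continuousOn hψ
    exact hbdd hψ hC
  have hpoly : ∀ P : Polynomial ℝ, ∫ t in Ioi (0 : ℝ), P.eval (Real.exp (-t)) • G t = 0 := by
    intro P
    induction P using Polynomial.induction_on' with
    | add p q hp hq =>
      simp only [Polynomial.eval_add, add_smul]
      rw [integral_add (hcompact p.continuous.continuousOn) (hcompact q.continuous.continuousOn),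
        hp, hq, add_zero]
    | monomial n c =>
      simp only [Polynomial.eval_monomial, hG]
      have := h0 (ω + 1 + n) (by have := n.cast_nonneg (α := ℝ); linarith)
      rw [← smul_zero (A := F) c, ← this, ← integral_smul]
      refine integral_congr_ae (ae_of_all _ fun t => ?_)
      simp only [smul_smul]
      rw [mul_assoc, ← Real.exp_nat_mul, ← Real.exp_add]
      ring_nf
  have hcont : ∀ {ψ : ℝ → ℝ}, ContinuousOn ψ (Icc 0 1) →
      ∫ t in Ioi (0 : ℝ), ψ (Real.exp (-t)) • G t = 0 := by
    intro ψ hψ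
    by_contra hne
    set N := ∫ t in Ioi (0 : ℝ), ‖G t‖
    have hN : 0 ≤ N := integral_nonneg fun _ => norm_nonneg _
    have hpos : 0 < ‖∫ t in Ioi (0 : ℝ), ψ (Real.exp (-t)) • G t‖ := norm_pos_iff.2 hne
    set ε := ‖∫ t in Ioi (0 : ℝ), ψ (Real.exp (-t)) • G t‖ / (N + 1) with hε
    have hε0 : 0 < ε := by positivity
    obtain ⟨P, hP⟩ := exists_polynomial_near_of_continuousOn 0 1 ψ hψ ε hε0
    have h1 : ∫ t in Ioi (0 : ℝ), ψ (Real.exp (-t)) • G t =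
        ∫ t in Ioi (0 : ℝ), (ψ (Real.exp (-t)) - P.eval (Real.exp (-t))) • G t := by
      simp only [sub_smul]
      rw [integral_sub (hcompact hψ) (hcompact P.continuous.continuousOn), hpoly, sub_zero]
    have h2 : ‖∫ t in Ioi (0 : ℝ), ψ (Real.exp (-t)) • G t‖ ≤ ε * N := by
      rw [h1, ← integral_const_mul]
      refine norm_integral_le_of_norm_le (hGi.norm.const_mul _) ?_
      filter_upwards [ae_restrict_mem measurableSet_Ioi] with t ht
      rw [norm_smul]
      refine mul_le_mul_of_nonneg_right ?_ (norm_nonneg _)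
      rw [norm_sub_rev]
      refine (hP _ ⟨(Real.exp_pos _).le, ?_⟩).le
      rw [Real.exp_le_one_iff]
      exact neg_nonpos.2 (le_of_lt ht)
    have h3 : ε * (N + 1) = ‖∫ t in Ioi (0 : ℝ), ψ (Real.exp (-t)) • G t‖ := by
      rw [hε]; field_simp
    nlinarith
  have hG0 : ∀ᵐ t, t ∈ Ioi (0 : ℝ) → G t = 0 := by
    refine isOpen_Ioi.ae_eq_zero_of_integral_contDiff_smul_eq_zero hGi.locallyIntegrableOn ?_
    intro g hg hgc hgs
    obtain ⟨M, hM⟩ := hgc.isBounded.subset_closedBall 0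
    have hg0 : g 0 = 0 := by
      by_contra h
      exact lt_irrefl (0 : ℝ) (hgs (subset_tsupport g h))
    have hgM : ∀ x, M < x → g x = 0 := by
      intro x hx
      by_contra h
      have := hM (subset_tsupport g h)
      rw [mem_closedBall_zero_iff, Real.norm_eq_abs] at this
      linarith [le_abs_self x]
    -- A test function supported in `(0, ∞)` is a continuous function of `e ^ (-t)`: near `x = 0` it
    -- vanishes by compactness of the support, and at `x = 0` the convention `Real.log 0 = 0` gives
    -- `g 0 = 0`.
    have hψ : Continuous fun x : ℝ => g (-Real.log x) := by
      rw [continuous_iff_continuousAt]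
      intro x
      rcases eq_or_ne x 0 with rfl | hx
      · have : (fun x : ℝ => g (-Real.log x)) =ᶠ[𝓝 0] fun _ => 0 := by
          filter_upwards [Metric.ball_mem_nhds (0 : ℝ) (Real.exp_pos (-M))] with x hx
          rcases eq_or_ne x 0 with rfl | hx0
          · simpa using hg0
          · refine hgM _ ?_
            rw [lt_neg, ← Real.log_abs]
            rw [mem_ball_zero_iff, Real.norm_eq_abs] at hx
            exact (Real.log_lt_iff_lt_exp (abs_pos.2 hx0)).2 hx
        exact continuousAt_const.congr this.symm
      · exact (hg.continuous.continuousAt).comp (f := fun x : ℝ => -Real.log x)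
          (Real.continuousAt_log hx).neg
    have := hcont hψ.continuousOn
    simp only [Real.log_exp, neg_neg] at this
    rw [← setIntegral_eq_integral_of_forall_compl_eq_zero (s := Ioi 0), this]
    intro t ht
    have : g t = 0 := by
      by_contra h
      exact ht (hgs (subset_tsupport g h))
    rw [this, zero_smul]
  filter_upwards [(ae_restrict_iff' measurableSet_Ioi).2 hG0] with t ht
  exact (smul_eq_zero.1 ht).resolve_left (Real.exp_pos _).ne'

/-- The Laplace transform of a convolution on the half-line. -/
theorem laplace_conv {a : ℝ → ℝ} {k : ℝ → F} {ν : ℝ} (ha0 : ∀ t ≤ 0, a t = 0)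
    (ha : IntegrableOn (fun t => Real.exp (-(ν * t)) • a t) (Ioi 0))
    (hk : IntegrableOn (fun t => Real.exp (-(ν * t)) • k t) (Ioi 0)) :
    IntegrableOn (fun t => Real.exp (-(ν * t)) • ∫ s in Ioi 0, a (t - s) • k s) (Ioi 0) ∧
      ∫ t in Ioi 0, Real.exp (-(ν * t)) • ∫ s in Ioi 0, a (t - s) • k s =
        (∫ t in Ioi 0, Real.exp (-(ν * t)) • a t) • ∫ t in Ioi 0, Real.exp (-(ν * t)) • k t := by
  have key : ∀ x ∈ Ioi (0 : ℝ), ∫ t in (0 : ℝ)..x, (ContinuousLinearMap.lsmul ℝ ℝ).flip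
      (Real.exp (-(ν * t)) • k t) (Real.exp (-(ν * (x - t))) • a (x - t)) =
      Real.exp (-(ν * x)) • ∫ s in Ioi 0, a (x - s) • k s := by
    intro x hx
    rw [← integral_smul, intervalIntegral.integral_of_le (le_of_lt hx), eq_comm]
    have hsub : Ioc 0 x ⊆ Ioi 0 := fun s hs => hs.1
    rw [setIntegral_eq_of_subset_of_forall_sdiff_eq_zero measurableSet_Ioi hsub]
    · refine setIntegral_congr_fun measurableSet_Ioc fun s hs => ?_
      simp only [ContinuousLinearMap.flip_apply, ContinuousLinearMap.lsmul_apply, smul_smul,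
        smul_eq_mul]
      congr 1
      rw [mul_right_comm, ← Real.exp_add]
      ring_nf
    · intro s hs
      have : x - s ≤ 0 := by
        by_contra h
        exact hs.2 ⟨hs.1, by linarith⟩
      rw [ha0 _ this, zero_smul, smul_zero]
  constructor
  · have := (integrable_posConvolution hk ha (ContinuousLinearMap.lsmul ℝ ℝ).flip).integrableOn
      (s := Ioi 0)
    refine this.congr_fun (fun x hx => ?_) measurableSet_Ioi
    rw [posConvolution, indicator_of_mem hx, key x hx]
  · have := integral_posConvolution hk ha (ContinuousLinearMap.lsmul ℝ ℝ).flip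
    rw [setIntegral_congr_fun measurableSet_Ioi fun x hx => key x hx] at this
    rw [this]
    rfl

theorem laplace_rlKer {α ν : ℝ} (hα : 0 < α) (hν : 0 < ν) :
    IntegrableOn (fun t => Real.exp (-(ν * t)) • rlKer α t) (Ioi 0) ∧
      ∫ t in Ioi (0 : ℝ), Real.exp (-(ν * t)) • rlKer α t = (ν ^ α)⁻¹ := by
  have hΓ := Real.Gamma_pos_of_pos hα
  have h1 : ∫ t in Ioi (0 : ℝ), Real.exp (-(ν * t)) • rlKer α t = (ν ^ α)⁻¹ := by
    have := Real.integral_rpow_mul_exp_neg_mul_Ioi hα hν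
    have h2 : ∫ t in Ioi (0 : ℝ), Real.exp (-(ν * t)) • rlKer α t =
        ∫ t in Ioi (0 : ℝ), (t ^ (α - 1) * Real.exp (-(ν * t))) / Real.Gamma α := by
      refine setIntegral_congr_fun measurableSet_Ioi fun t ht => ?_
      simp only [rlKer_of_pos ht, smul_eq_mul]
      ring
    rw [h2, integral_div, this, one_div, Real.inv_rpow hν.le]
    field_simp
  refine ⟨?_, h1⟩
  -- The integral of a non-integrable function is zero by convention, so a nonzero value certifies
  -- integrability.
  refine Integrable.of_integral_ne_zero ?_
  rw [h1]
  have := Real.rpow_pos_of_pos hν α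
  positivity

end laplace

/-! ### Resolvents of an operator `A` with `-A` coercive. -/

section resolvent

variable {E : Type*} [NormedAddCommGroup E] [InnerProductSpace ℝ E]
  {A : E →ₗ.[ℝ] E} {lam lam' : ℝ} {R R' : E →L[ℝ] E}

/-- Apply `R'` to `(lam' - A) R u = u + (lam' - lam) R u`. -/
theorem IsResolventAt.resolvent_identity (h : IsResolventAt A lam R) (h' : IsResolventAt A lam' R')
    (u : E) : R u = R' u + (lam' - lam) • R' (R u) := by
  obtain ⟨hm, hu⟩ := h.1 u
  have := h'.2 ⟨R u, hm⟩
  have e : lam' • R u - A ⟨R u, hm⟩ = u + (lam' - lam) • R u := by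
    have hAu : A ⟨R u, hm⟩ = lam • R u - u := by rw [eq_sub_iff_add_eq', ← eq_sub_iff_add_eq, hu]
    rw [hAu, sub_smul]
    abel
  rw [e, map_add, map_smul] at this
  exact this.symm

theorem IsResolventAt.comm (h : IsResolventAt A lam R) (h' : IsResolventAt A lam' R') (u : E) :
    R (R' u) = R' (R u) := by
  have h1 := h.resolvent_identity h' u
  have h2 := h'.resolvent_identity h u
  rcases eq_or_ne lam lam' with rfl | hne
  · have hR : ∀ u, R u = R' u := fun u => by simpa using h.resolvent_identity h' u
    rw [hR, hR]
  · have h3 : (lam' - lam) • (R' (R u) - R (R' u)) = 0 := by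
      have h4 : (lam' - lam) • R' (R u) = R u - R' u := by
        conv_rhs => rw [h1]
        abel
      have h5 : (lam' - lam) • R (R' u) = R u - R' u := by
        have : (lam - lam') • R (R' u) = R' u - R u := by
          rw [eq_sub_iff_add_eq, add_comm]; exact h2.symm
        rw [← neg_sub lam lam', neg_smul, this, neg_sub]
      rw [smul_sub, h4, h5, sub_self]
    have := (smul_eq_zero.1 h3).resolve_left (sub_ne_zero.2 hne.symm)
    exact (sub_eq_zero.1 this).symm

variable {μ : ℝ} (hA : ∀ x : A.domain, μ * ‖(x : E)‖ ^ 2 ≤ ⟪-(A x), (x : E)⟫)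

include hA

/-- Pair `u = lam R u - A R u` with `R u`; the term with `A` is nonnegative by coercivity. -/
theorem IsResolventAt.norm_smul_le (h : IsResolventAt A lam R) (hμ : 0 < μ) (hl : 0 < lam)
    (u : E) : ‖lam • R u‖ ≤ ‖u‖ := by
  obtain ⟨hm, hu⟩ := h.1 u
  have h1 := hA ⟨R u, hm⟩
  have h2 : ⟪u, R u⟫ = lam * ‖R u‖ ^ 2 + ⟪-(A ⟨R u, hm⟩), R u⟫ := by
    conv_lhs => rw [← hu]
    rw [hu, ← real_inner_self_eq_norm_sq, ← real_inner_smul_left, ← inner_add_left,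
      ← sub_eq_add_neg, hu]
  have h3 := real_inner_le_norm u (R u)
  have h4 : lam * ‖R u‖ ^ 2 ≤ ‖u‖ * ‖R u‖ := by
    have : 0 ≤ μ * ‖R u‖ ^ 2 := by positivity
    simp only at h1
    linarith
  rw [norm_smul, Real.norm_of_nonneg hl.le]
  rcases (norm_nonneg (R u)).eq_or_lt with h5 | h5
  · rw [← h5, mul_zero]; exact norm_nonneg _
  · nlinarith

/-- A vector `y` orthogonal to the domain is orthogonal to `R y`, and the pairing of `y` with `R y`
is at least `(lam + μ) ‖R y‖²`; hence `R y = 0` and `y = 0`. -/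
theorem IsResolventAt.dense_domain [CompleteSpace E] (h : IsResolventAt A lam R) (hμ : 0 < μ)
    (hl : 0 < lam) : Dense (A.domain : Set E) := by
  rw [Submodule.dense_iff_topologicalClosure_eq_top, Submodule.topologicalClosure_eq_top_iff,
    Submodule.eq_bot_iff]
  intro y hy
  obtain ⟨hm, hu⟩ := h.1 y
  have h1 := hA ⟨R y, hm⟩
  have h2 : ⟪R y, y⟫ = 0 := hy _ hm
  have h3 : ⟪y, R y⟫ = lam * ‖R y‖ ^ 2 + ⟪-(A ⟨R y, hm⟩), R y⟫ := by
    conv_lhs => rw [← hu]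
    rw [hu, ← real_inner_self_eq_norm_sq, ← real_inner_smul_left, ← inner_add_left,
      ← sub_eq_add_neg, hu]
  rw [real_inner_comm, h2] at h3
  simp only at h1
  have h4 : (lam + μ) * ‖R y‖ ^ 2 ≤ 0 := by linarith
  have h5 : R y = 0 := by
    have : ‖R y‖ ^ 2 ≤ 0 := by
      by_contra hc
      push Not at hc
      nlinarith
    have := pow_eq_zero_iff (two_ne_zero) |>.1 (le_antisymm this (sq_nonneg _))
    exact norm_eq_zero.1 this
  have h6 : A ⟨R y, hm⟩ = 0 := by
    have : (⟨R y, hm⟩ : A.domain) = 0 := Subtype.ext h5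
    rw [this, LinearPMap.map_zero]
  rw [← hu, h6, h5]
  simp

/-- The scaled resolvents `λ (λ - A)⁻¹` converge strongly to the identity as `λ → ∞`. -/
theorem tendsto_smul_resolvent [CompleteSpace E] (hμ : 0 < μ) {l : ℕ → ℝ} (hl : ∀ n, 0 < l n)
    (hlt : Tendsto l atTop atTop) {Rn : ℕ → E →L[ℝ] E} (hR : ∀ n, IsResolventAt A (l n) (Rn n))
    (u : E) : Tendsto (fun n => l n • Rn n u) atTop (𝓝 u) := by
  have hd := (hR 0).dense_domain hA hμ (hl 0)
  rw [Metric.tendsto_atTop]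
  intro ε hε
  obtain ⟨x, hx, hxu⟩ := Metric.mem_closure_iff.1 (hd u) (ε / 3) (by positivity)
  have h1 : Tendsto (fun n => (l n)⁻¹ * ‖A ⟨x, hx⟩‖) atTop (𝓝 0) := by
    simpa using hlt.inv_tendsto_atTop.mul_const ‖A ⟨x, hx⟩‖
  obtain ⟨N, hN⟩ := (h1.eventually_lt_const (show 0 < ε / 3 by positivity)).exists_forall_of_atTop
  refine ⟨N, fun n hn => ?_⟩
  have h2 : l n • Rn n x - x = Rn n (A ⟨x, hx⟩) := by
    have := (hR n).2 ⟨x, hx⟩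
    simp only [map_sub, map_smul] at this
    rw [sub_eq_iff_eq_add, ← sub_eq_iff_eq_add']
    exact this
  have h3 : ‖Rn n (A ⟨x, hx⟩)‖ ≤ (l n)⁻¹ * ‖A ⟨x, hx⟩‖ := by
    have := (hR n).norm_smul_le hA hμ (hl n) (A ⟨x, hx⟩)
    rw [norm_smul, Real.norm_of_nonneg (hl n).le] at this
    rwa [le_inv_mul_iff₀ (hl n)]
  have h4 := (hR n).norm_smul_le hA hμ (hl n) (u - x)
  have h5 : l n • Rn n u - u = l n • Rn n (u - x) + (l n • Rn n x - x) + (x - u) := by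
    rw [map_sub, smul_sub]; abel
  rw [dist_eq_norm, h5]
  rw [dist_eq_norm] at hxu
  have h6 := norm_add₃_le (a := l n • Rn n (u - x)) (b := l n • Rn n x - x) (c := x - u)
  rw [h2] at h6 ⊢
  rw [norm_sub_rev x u] at h6
  linarith [hN n hn]

end resolvent

end FracControl

end

/-! ### Volterra equations of the two families, smoothed by resolvents. -/

noncomputable section

namespace FracControl

section halfline

variable {α : ℝ} {F : Type*} [NormedAddCommGroup F] [NormedSpace ℝ F]

theorem setIntegral_rlKer (t : ℝ) (f : ℝ → F) :
    ∫ s in Ioi 0, rlKer α (t - s) • f s = ∫ s in Ioo 0 t, rlKer α (t - s) • f s := by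
  refine setIntegral_eq_of_subset_of_forall_sdiff_eq_zero measurableSet_Ioi Ioo_subset_Ioi_self ?_
  intro s hs
  rw [rlKer_of_nonpos, zero_smul]
  by_contra h
  exact hs.2 ⟨hs.1, by linarith⟩

theorem integrableOn_rlKer_smul_iff (t : ℝ) (f : ℝ → F) :
    IntegrableOn (fun s => rlKer α (t - s) • f s) (Ioi 0) ↔
      IntegrableOn (fun s => rlKer α (t - s) • f s) (Ioo 0 t) := by
  refine ⟨fun h => h.mono_set Ioo_subset_Ioi_self, fun h => ?_⟩
  have h2 : IntegrableOn (fun s => rlKer α (t - s) • f s) (Ici t) := by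
    refine integrableOn_zero.congr_fun (fun s hs => ?_) measurableSet_Ici
    rw [rlKer_of_nonpos (sub_nonpos.2 hs), zero_smul]
  refine (h.union h2).mono_set fun s hs => ?_
  rcases lt_or_ge s t with h' | h'
  · exact Or.inl ⟨hs, h'⟩
  · exact Or.inr h'

theorem integrableOn_rlKer_smul_of_bounded (hα : 0 < α) {t C : ℝ} {f : ℝ → F}
    (hf : AEStronglyMeasurable f (volume.restrict (Ioo 0 t))) (hC : ∀ s ∈ Ioo 0 t, ‖f s‖ ≤ C) :
    IntegrableOn (fun s => rlKer α (t - s) • f s) (Ioi 0) := by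
  rw [integrableOn_rlKer_smul_iff]
  have := (integrableOn_rlKer_sub hα t).mono_set (Ioo_subset_Ioi_self : Ioo 0 t ⊆ Ioi 0)
  exact Integrable.smul_bdd (C := C) this hf
    ((ae_restrict_iff' measurableSet_Ioo).2 (ae_of_all _ hC))

theorem tendsto_integral_rlKer (hα : 0 < α) {t C : ℝ} {f : ℕ → ℝ → F} {g : ℝ → F}
    (hf : ∀ n, AEStronglyMeasurable (f n) (volume.restrict (Ioo 0 t)))
    (hC : ∀ n, ∀ s ∈ Ioo 0 t, ‖f n s‖ ≤ C)
    (hfg : ∀ s ∈ Ioo 0 t, Tendsto (fun n => f n s) atTop (𝓝 (g s))) :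
    Tendsto (fun n => ∫ s in Ioi 0, rlKer α (t - s) • f n s) atTop
      (𝓝 (∫ s in Ioi 0, rlKer α (t - s) • g s)) := by
  simp only [setIntegral_rlKer]
  have hi := (integrableOn_rlKer_sub hα t).mono_set (Ioo_subset_Ioi_self : Ioo 0 t ⊆ Ioi 0)
  refine tendsto_integral_of_dominated_convergence (fun s => rlKer α (t - s) * C) (fun n => ?_)
    (hi.mul_const C) (fun n => ?_) ?_
  · exact hi.aestronglyMeasurable.smul (hf n)
  · refine (ae_restrict_iff' measurableSet_Ioo).2 (ae_of_all _ fun s hs => ?_)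
    rw [norm_smul, Real.norm_of_nonneg (rlKer_nonneg hα _)]
    exact mul_le_mul_of_nonneg_left (hC n s hs) (rlKer_nonneg hα _)
  · exact (ae_restrict_iff' measurableSet_Ioo).2
      (ae_of_all _ fun s hs => (hfg s hs).const_smul _)

end halfline

/-- Solution operators and resolvent families generated by an operator `A` such that `-A` is
coercive with constant `μ`. -/
structure CoerciveFamily {E : Type*} [NormedAddCommGroup E] [InnerProductSpace ℝ E]
    (α : ℝ) (A : E →ₗ.[ℝ] E) (T S : ℝ → E →L[ℝ] E) (μ : ℝ) : Prop where
  pos : 0 < α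
  lt_one : α < 1
  solution : IsSolutionOperator α A T
  resolvent : IsResolventFamily α A S
  mu_pos : 0 < μ
  coercive : ∀ x : A.domain, μ * ‖(x : E)‖ ^ 2 ≤ ⟪-(A x), (x : E)⟫

section family

variable {E : Type*} [NormedAddCommGroup E] [InnerProductSpace ℝ E]
  {α μ : ℝ} {A : E →ₗ.[ℝ] E} {T S : ℝ → E →L[ℝ] E}

/-- The primitive `∫₀ᵗ S(r) u dr`, which vanishes for `t ≤ 0`. -/
def primOp (S : ℝ → E →L[ℝ] E) (u : E) (t : ℝ) : E := ∫ r in Ioc 0 t, S r u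

theorem primOp_of_nonpos (u : E) {t : ℝ} (ht : t ≤ 0) : primOp S u t = 0 := by
  rw [primOp, Ioc_eq_empty (not_lt.2 ht)]; simp

namespace CoerciveFamily

variable (H : CoerciveFamily α A T S μ)
include H

/-- The family may be singular at `0`. Integrability there is read off from its Laplace transform at
`ω + 1`, by undoing a weight that is bounded on bounded intervals. -/
theorem integrableOn_apply (u : E) (b : ℝ) : IntegrableOn (fun r => S r u) (Ioc 0 b) := by
  obtain ⟨ω, hω, h⟩ := H.resolvent.2
  obtain ⟨R, -, hR⟩ := h (ω + 1) (by linarith)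
  have h1 := ((hR u).1).mono_set (Ioc_subset_Ioi_self : Ioc 0 b ⊆ Ioi 0)
  have h2 : IntegrableOn (fun r => Real.exp ((ω + 1) * r) • Real.exp (-((ω + 1) * r)) • S r u)
      (Ioc 0 b) := by
    refine Integrable.bdd_smul (C := Real.exp ((ω + 1) * b)) h1 ?_ ?_
    · exact Continuous.aestronglyMeasurable (by fun_prop)
    · filter_upwards [ae_restrict_mem measurableSet_Ioc] with r hr
      rw [Real.norm_of_nonneg (Real.exp_pos _).le, Real.exp_le_exp]
      exact mul_le_mul_of_nonneg_left hr.2 (by linarith)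
  refine h2.congr_fun (fun r _ => ?_) measurableSet_Ioc
  simp only [smul_smul, ← Real.exp_add, add_neg_cancel, Real.exp_zero, one_smul]

theorem continuous_primOp (u : E) : Continuous (primOp S u) := by
  have h1 : ∀ a b : ℝ, IntervalIntegrable ((Ioi (0 : ℝ)).indicator fun r => S r u) volume a b := by
    intro a b
    rw [intervalIntegrable_iff]
    refine (integrableOn_indicator_iff measurableSet_Ioi).2 ?_
    exact (H.integrableOn_apply u (max a b)).mono_set fun x hx => ⟨hx.1, hx.2.2⟩
  have h2 : primOp S u = fun t => ∫ r in (0 : ℝ)..t, (Ioi (0 : ℝ)).indicator (fun r => S r u) r := by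
    ext t
    rcases le_or_gt t 0 with ht | ht
    · rw [primOp_of_nonpos u ht, intervalIntegral.integral_of_ge ht,
        setIntegral_indicator measurableSet_Ioi]
      have : Ioc t 0 ∩ Ioi (0 : ℝ) = ∅ := by
        ext x; simp only [mem_inter_iff, mem_Ioc, mem_Ioi, mem_empty_iff_false, iff_false]
        rintro ⟨⟨_, h1⟩, h2⟩
        exact absurd h2 (not_lt.2 h1)
      simp [this]
    · rw [primOp, intervalIntegral.integral_of_le ht.le, setIntegral_indicator measurableSet_Ioi]
      congr 2
      ext x; simp only [mem_inter_iff, mem_Ioc, mem_Ioi]; tauto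
  rw [h2]
  exact intervalIntegral.continuous_primitive h1 0

variable [CompleteSpace E]

theorem exists_resolvents : ∃ (l : ℕ → ℝ) (Rn : ℕ → E →L[ℝ] E), (∀ n, 0 < l n) ∧
    Tendsto l atTop atTop ∧ ∀ n, IsResolventAt A (l n) (Rn n) := by
  obtain ⟨ω, hω, h⟩ := H.resolvent.2
  choose R hR using fun n : ℕ => h (ω + n + 1) (by have := n.cast_nonneg (α := ℝ); linarith)
  refine ⟨fun n => (ω + n + 1) ^ α, R, fun n => Real.rpow_pos_of_pos (by positivity) _, ?_,
    fun n => (hR n).1⟩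
  refine (tendsto_rpow_atTop H.pos).comp ?_
  refine tendsto_atTop_add_const_right _ _ ?_
  exact tendsto_atTop_add_const_left _ _ tendsto_natCast_atTop_atTop

/-- The Volterra equation of the integrated resolvent family, smoothed by a resolvent of `A`. -/
theorem resolvent_primOp {lam : ℝ} {R : E →L[ℝ] E} (hR : IsResolventAt A lam R) (u : E) :
    ∀ᵐ t, R (primOp S u t) = ∫ r, rlKer α (t - r) •
      ((if 0 < r then R u else 0) + (lam • R (primOp S u r) - primOp S u r)) := by
  set k : ℝ → E := fun r => R u + (lam • R (primOp S u r) - primOp S u r) with hk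
  have hconv : ∀ t, ∫ r, rlKer α (t - r) •
      ((if 0 < r then R u else 0) + (lam • R (primOp S u r) - primOp S u r)) =
      ∫ r in Ioi 0, rlKer α (t - r) • k r := by
    intro t
    rw [← integral_indicator measurableSet_Ioi]
    refine integral_congr_ae (ae_of_all _ fun r => ?_)
    by_cases hr : 0 < r
    · simp [hr, hk]
    · simp [hr, primOp_of_nonpos u (not_lt.1 hr)]
  -- `rlKer 1` is the indicator function of `(0, ∞)`, so the primitive is a convolution and
  -- `laplace_conv` gives its transform.
  have hV : ∀ t ∈ Ioi (0 : ℝ), ∫ s in Ioi 0, rlKer 1 (t - s) • S s u = primOp S u t := by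
    intro t ht
    rw [setIntegral_rlKer, primOp, integral_Ioc_eq_integral_Ioo]
    refine setIntegral_congr_fun measurableSet_Ioo fun s hs => ?_
    rw [rlKer_of_pos (by linarith [hs.2])]
    simp
  obtain ⟨ω, hω, h⟩ := H.resolvent.2
  -- After Laplace transformation the claim is `ν⁻¹ R Rν u = ν ^ (-α) ν⁻¹ (R u + lam R Rν u - Rν
  -- u)`, which is the resolvent identity for `ν ^ α` and `lam`.
  have hmain : ∀ ν, ω < ν →
      IntegrableOn (fun t => Real.exp (-(ν * t)) •
        (R (primOp S u t) - ∫ r in Ioi 0, rlKer α (t - r) • k r)) (Ioi 0) ∧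
      ∫ t in Ioi 0, Real.exp (-(ν * t)) •
        (R (primOp S u t) - ∫ r in Ioi 0, rlKer α (t - r) • k r) = 0 := by
    intro ν hν
    have hν0 : 0 < ν := hω.trans_lt hν
    obtain ⟨Rν, hRν, hRν'⟩ := h ν hν
    obtain ⟨hSi, hSe⟩ := hRν' u
    obtain ⟨hone, hone'⟩ := laplace_rlKer one_pos hν0
    have hVl := laplace_conv (fun t ht => rlKer_of_nonpos ht) hone hSi
    rw [hone', ← hSe, Real.rpow_one] at hVl
    have hVi : IntegrableOn (fun t => Real.exp (-(ν * t)) • primOp S u t) (Ioi 0) :=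
      hVl.1.congr_fun (fun t ht => by simp only [hV t ht]) measurableSet_Ioi
    have hVe : ∫ t in Ioi 0, Real.exp (-(ν * t)) • primOp S u t = ν⁻¹ • Rν u := by
      rw [← hVl.2]
      exact setIntegral_congr_fun measurableSet_Ioi fun t ht => by simp only [hV t ht]
    have hRi : IntegrableOn (fun t => Real.exp (-(ν * t)) • R (primOp S u t)) (Ioi 0) := by
      exact (R.integrable_comp hVi).congr (ae_of_all _ fun t => by simp)
    have hRe : ∫ t in Ioi 0, Real.exp (-(ν * t)) • R (primOp S u t) = ν⁻¹ • R (Rν u) := by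
      have := R.integral_comp_comm hVi
      simp only [map_smul] at this
      rw [this, hVe, map_smul]
    have hone2 : IntegrableOn (fun t => Real.exp (-(ν * t)) • R u) (Ioi 0) := by
      refine IntegrableOn.congr_fun (hone.smul_const (R u)) (fun t ht => ?_) measurableSet_Ioi
      rw [rlKer_of_pos ht]
      simp
    have hone2' : ∫ t in Ioi 0, Real.exp (-(ν * t)) • R u = ν⁻¹ • R u := by
      rw [← Real.rpow_one ν, ← hone', ← integral_smul_const, Real.rpow_one]
      refine setIntegral_congr_fun measurableSet_Ioi fun t ht => ?_
      rw [rlKer_of_pos ht]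
      simp
    have hki : IntegrableOn (fun t => Real.exp (-(ν * t)) • k t) (Ioi 0) := by
      refine (hone2.add ((hRi.smul lam).sub hVi)).congr (ae_of_all _ fun t => ?_)
      simp [hk, smul_add, smul_sub, smul_comm lam]
    have hRi' : IntegrableOn (fun t => lam • Real.exp (-(ν * t)) • R (primOp S u t)) (Ioi 0) :=
      hRi.smul lam
    have hRV : IntegrableOn (fun t => lam • Real.exp (-(ν * t)) • R (primOp S u t) -
        Real.exp (-(ν * t)) • primOp S u t) (Ioi 0) := hRi'.sub hVi
    have hke : ∫ t in Ioi 0, Real.exp (-(ν * t)) • k t =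
        ν⁻¹ • R u + (lam • ν⁻¹ • R (Rν u) - ν⁻¹ • Rν u) := by
      rw [← hone2', ← hRe, ← hVe, ← integral_smul, ← integral_sub hRi' hVi,
        ← integral_add hone2 hRV]
      refine integral_congr_ae (ae_of_all _ fun t => ?_)
      simp [hk, smul_add, smul_sub, smul_comm lam]
    obtain ⟨hker, hker'⟩ := laplace_rlKer H.pos hν0
    have hkl := laplace_conv (fun t ht => rlKer_of_nonpos ht) hker hki
    simp only [smul_sub (Real.exp _)]
    refine ⟨hRi.sub hkl.1, ?_⟩
    rw [integral_sub hRi hkl.1, hRe, hkl.2, hker', hke]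
    have hid := hRν.resolvent_identity hR u
    have hνα : ν ^ α ≠ 0 := (Real.rpow_pos_of_pos hν0 α).ne'
    have e1 : R u + (lam • R (Rν u) - Rν u) = ν ^ α • R (Rν u) := by
      rw [sub_smul] at hid
      have e2 : R u + (lam • R (Rν u) - Rν u) - ν ^ α • R (Rν u) =
          (R u + (lam • R (Rν u) - ν ^ α • R (Rν u))) - Rν u := by abel
      rw [← sub_eq_zero, e2, ← hid, sub_self]
    rw [smul_comm lam, ← smul_sub, ← smul_add, e1, smul_comm ν⁻¹, inv_smul_smul₀ hνα, sub_self]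
  have hz := ae_eq_zero_of_laplace_eq_zero (fun ν hν => (hmain ν hν).1) (fun ν hν => (hmain ν hν).2)
  filter_upwards [(ae_restrict_iff' measurableSet_Ioi).1 hz] with t ht
  rw [hconv]
  rcases le_or_gt t 0 with ht0 | ht0
  · rw [primOp_of_nonpos u ht0, map_zero, setIntegral_rlKer, Ioo_eq_empty (not_lt.2 ht0)]
    simp
  · exact sub_eq_zero.1 (ht ht0)

omit [CompleteSpace E] in
-- Commutation of `T t` with `A` on the domain, rewritten for the bounded operator `R`.
theorem resolvent_solution_comm {lam : ℝ} {R : E →L[ℝ] E} (hR : IsResolventAt A lam R) (z : E)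
    {t : ℝ} (ht : 0 ≤ t) : R (T t z) = T t (R z) := by
  obtain ⟨hm, hz⟩ := hR.1 z
  obtain ⟨hm2, h2⟩ := H.solution.comm t ht ⟨R z, hm⟩
  have h3 := hR.2 ⟨T t (R z), hm2⟩
  simp only at h2 h3
  rw [h2, ← map_smul, ← map_sub, hz] at h3
  exact h3

/-- The Volterra equation of the solution operator, smoothed by a resolvent of `A`. -/
theorem resolvent_solution {lam : ℝ} {R : E →L[ℝ] E} (hR : IsResolventAt A lam R) (z : E)
    {t : ℝ} (ht : 0 < t) : R (T t z) = R z + ∫ r in Ioi 0, rlKer α (t - r) •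
      (lam • R (T r z) - T r z) := by
  obtain ⟨hm, hz⟩ := hR.1 z
  rw [H.resolvent_solution_comm hR z ht.le, H.solution.integral_eq t ht.le ⟨R z, hm⟩,
    setIntegral_rlKer, intervalIntegral.integral_of_le ht.le, integral_Ioc_eq_integral_Ioo,
    ← integral_smul]
  congr 1
  refine setIntegral_congr_fun measurableSet_Ioo fun s hs => ?_
  have hA : A ⟨R z, hm⟩ = lam • R z - z := by
    rw [eq_sub_iff_add_eq', ← eq_sub_iff_add_eq, hz]
  rw [rlKer_of_pos (by linarith [hs.2]), hA, H.resolvent_solution_comm hR z hs.1.le, map_sub,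
    map_smul, smul_smul]
  congr 1
  ring

end CoerciveFamily

end family

end FracControl

end

/-! ### Step forcing and the energy inequality. -/

noncomputable section

namespace FracControl

section steps

variable {E : Type*} [NormedAddCommGroup E] [InnerProductSpace ℝ E]
  {α μ : ℝ} {A : E →ₗ.[ℝ] E} {T S : ℝ → E →L[ℝ] E} {ι : Type*}

/-- The step function with jumps `u i` at `c i`. -/
def stepFun (I : Finset ι) (c : ι → ℝ) (u : ι → E) (s : ℝ) : E :=
  ∑ i ∈ I, if c i < s then u i else 0

/-- The mild solution with initial value `z₀` for a step function. -/
def stepSol (T S : ℝ → E →L[ℝ] E) (z₀ : E) (I : Finset ι) (c : ι → ℝ) (u : ι → E) (t : ℝ) : E :=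
  T t z₀ + ∑ i ∈ I, primOp S (u i) (t - c i)

theorem stronglyMeasurable_stepFun (I : Finset ι) (c : ι → ℝ) (u : ι → E) :
    StronglyMeasurable (stepFun I c u) := by
  unfold stepFun
  refine Finset.stronglyMeasurable_fun_sum I fun i _ => ?_
  exact StronglyMeasurable.ite measurableSet_Ioi stronglyMeasurable_const stronglyMeasurable_const

theorem norm_stepFun_le (I : Finset ι) (c : ι → ℝ) (u : ι → E) (s : ℝ) :
    ‖stepFun I c u s‖ ≤ ∑ i ∈ I, ‖u i‖ := by
  refine (norm_sum_le _ _).trans (Finset.sum_le_sum fun i _ => ?_)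
  split_ifs <;> simp

theorem continuousAt_stepFun (I : Finset ι) (c : ι → ℝ) (u : ι → E) :
    ∀ᵐ s, ContinuousAt (stepFun I c u) s := by
  have h1 : ∀ᵐ s, ∀ i ∈ I, s ≠ c i := by
    rw [eventually_all_finset]
    exact fun i _ => Measure.ae_ne volume (c i)
  filter_upwards [h1] with s hs
  unfold stepFun
  refine tendsto_finsetSum _ fun i hi => ?_
  rcases (hs i hi).lt_or_gt with h | h
  · refine Tendsto.congr' ?_ tendsto_const_nhds
    filter_upwards [Iio_mem_nhds h] with r hr
    rw [if_neg (not_lt.2 h.le), if_neg (not_lt.2 (le_of_lt hr))]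
  · refine Tendsto.congr' ?_ tendsto_const_nhds
    filter_upwards [Ioi_mem_nhds h] with r hr
    rw [if_pos h, if_pos (show c i < r from hr)]

namespace CoerciveFamily

variable (H : CoerciveFamily α A T S μ)
include H

theorem continuousOn_stepSol (z₀ : E) (I : Finset ι) (c : ι → ℝ) (u : ι → E) :
    ContinuousOn (stepSol T S z₀ I c u) (Ici 0) := by
  unfold stepSol
  refine (H.solution.strongly_continuous z₀).add ?_
  refine continuousOn_finsetSum _ fun i _ => Continuous.continuousOn ?_
  exact (H.continuous_primOp (u i)).comp (by fun_prop)

theorem integrableOn_rlKer_continuous {f : ℝ → E} (hf : ContinuousOn f (Ici 0)) (t : ℝ) :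
    IntegrableOn (fun s => rlKer α (t - s) • f s) (Ioi 0) := by
  have h1 : ContinuousOn f (Icc 0 t) := hf.mono Icc_subset_Ici_self
  obtain ⟨C, hC⟩ := isCompact_Icc.exists_bound_of_continuousOn h1
  exact integrableOn_rlKer_smul_of_bounded H.pos
    ((h1.mono Ioo_subset_Icc_self).aestronglyMeasurable measurableSet_Ioo)
    fun s hs => hC s (Ioo_subset_Icc_self hs)

variable [CompleteSpace E]

/-- The translate of `resolvent_primOp` by `c`; the integrand vanishes for `r ≤ c`, so for `0 ≤ c`
the integral may be taken over positive times. -/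
theorem resolvent_primOp_shift {lam : ℝ} {R : E →L[ℝ] E} (hR : IsResolventAt A lam R) (u : E)
    {c : ℝ} (hc : 0 ≤ c) :
    ∀ᵐ t, R (primOp S u (t - c)) = ∫ r in Ioi 0, rlKer α (t - r) •
      ((if c < r then R u else 0) +
        (lam • R (primOp S u (r - c)) - primOp S u (r - c))) := by
  have h1 := (measurePreserving_sub_right volume c).quasiMeasurePreserving.ae
    (H.resolvent_primOp hR u)
  filter_upwards [h1] with t ht
  rw [ht, ← integral_sub_right_eq_self _ c, setIntegral_eq_integral_of_forall_compl_eq_zero]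
  · refine integral_congr_ae (ae_of_all _ fun r => ?_)
    simp only [sub_pos]
    rw [sub_sub_sub_cancel_right]
  · intro r hr
    have hr' : r ≤ c := (not_lt.1 hr).trans hc
    rw [if_neg (not_lt.2 hr'), primOp_of_nonpos u (sub_nonpos.2 hr')]
    simp

/-- Superposition of the equations for the initial value and for each jump. Since `A R = lam R - I`,
it says that `R y` has fractional derivative `R η + A R y`, the form that
`RadialConvex.fractional_le` requires. -/
theorem resolvent_stepSol {lam : ℝ} {R : E →L[ℝ] E} (hR : IsResolventAt A lam R) (z₀ : E)
    (I : Finset ι) (c : ι → ℝ) (hc : ∀ i ∈ I, 0 ≤ c i) (u : ι → E) :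
    ∀ᵐ t, 0 < t → R (stepSol T S z₀ I c u t) = R z₀ + ∫ r in Ioi 0, rlKer α (t - r) •
      (R (stepFun I c u r) +
        (lam • R (stepSol T S z₀ I c u r) - stepSol T S z₀ I c u r)) := by
  have h1 : ∀ᵐ t, ∀ i ∈ I, R (primOp S (u i) (t - c i)) = ∫ r in Ioi 0, rlKer α (t - r) •
      ((if c i < r then R (u i) else 0) +
        (lam • R (primOp S (u i) (r - c i)) - primOp S (u i) (r - c i))) := by
    rw [eventually_all_finset]
    exact fun i hi => H.resolvent_primOp_shift hR (u i) (hc i hi)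
  filter_upwards [h1] with t ht htpos
  have hV : ∀ i, Continuous fun r => primOp S (u i) (r - c i) := fun i =>
    (H.continuous_primOp (u i)).comp (by fun_prop)
  have i0 := H.integrableOn_rlKer_continuous (f := fun r => lam • R (T r z₀) - T r z₀)
    (((R.continuous.comp_continuousOn (H.solution.strongly_continuous z₀)).const_smul lam).sub
      (H.solution.strongly_continuous z₀)) t
  have i1 : ∀ i ∈ I, IntegrableOn (fun r => rlKer α (t - r) •
      ((if c i < r then R (u i) else 0) +
        (lam • R (primOp S (u i) (r - c i)) - primOp S (u i) (r - c i)))) (Ioi 0) := by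
    intro i _
    simp only [smul_add (rlKer α _)]
    refine Integrable.add ?_ ?_
    · refine integrableOn_rlKer_smul_of_bounded H.pos (C := ‖R (u i)‖) ?_ fun s _ => ?_
      · exact (StronglyMeasurable.ite measurableSet_Ioi stronglyMeasurable_const
          stronglyMeasurable_const).aestronglyMeasurable
      · split_ifs <;> simp
    · exact H.integrableOn_rlKer_continuous (Continuous.continuousOn
        (((R.continuous.comp (hV i)).const_smul lam).sub (hV i))) t
  have e1 : ∀ r, rlKer α (t - r) • (R (stepFun I c u r) +
      (lam • R (stepSol T S z₀ I c u r) - stepSol T S z₀ I c u r)) =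
      rlKer α (t - r) • (lam • R (T r z₀) - T r z₀) + ∑ i ∈ I, rlKer α (t - r) •
      ((if c i < r then R (u i) else 0) +
        (lam • R (primOp S (u i) (r - c i)) - primOp S (u i) (r - c i))) := by
    intro r
    rw [← Finset.smul_sum, ← smul_add]
    congr 1
    rw [Finset.sum_add_distrib, Finset.sum_sub_distrib, ← Finset.smul_sum, stepFun, stepSol,
      map_add, map_sum, map_sum]
    have : ∀ i ∈ I, R (if c i < r then u i else 0) = if c i < r then R (u i) else 0 := by
      intro i _
      split_ifs <;> simp
    rw [Finset.sum_congr rfl this, smul_add]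
    abel
  simp only [e1]
  rw [integral_add i0 (integrable_finsetSum _ i1), integral_finsetSum _ i1, ← add_assoc,
    ← H.resolvent_solution hR z₀ htpos, stepSol, map_add, map_sum]
  congr 1
  exact Finset.sum_congr rfl ht

/-- The energy inequality for step functions. -/
theorem step_energy {φ θ : E → ℝ} {C₀ : ℝ} (hφ : RadialConvex φ θ C₀) (z₀ : E)
    (I : Finset ι) (c : ι → ℝ) (hc : ∀ i ∈ I, 0 ≤ c i) (u : ι → E) {t : ℝ} (ht : 0 < t) :
    φ (stepSol T S z₀ I c u t) + μ * ∫ s in Ioi 0, rlKer α (t - s) •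
        (θ (stepSol T S z₀ I c u s) * ‖stepSol T S z₀ I c u s‖ ^ 2) ≤
      φ z₀ + ∫ s in Ioi 0, rlKer α (t - s) •
        (θ (stepSol T S z₀ I c u s) * ⟪stepSol T S z₀ I c u s, stepFun I c u s⟫) := by
  set y := stepSol T S z₀ I c u with hy
  set η := stepFun I c u with hη
  have hyc : ContinuousOn y (Ici 0) := H.continuousOn_stepSol z₀ I c u
  have hα := H.pos
  obtain ⟨l, Rn, hl, hlt, hRn⟩ := H.exists_resolvents
  -- These regularisations are contractions into the domain of `A` and converge strongly to the
  -- identity.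
  set J : ℕ → E → E := fun n x => l n • Rn n x with hJ
  have hJn : ∀ n x, ‖J n x‖ ≤ ‖x‖ := fun n x =>
    (hRn n).norm_smul_le H.coercive H.mu_pos (hl n) x
  have hJc : ∀ n, Continuous (J n) := fun n => (Rn n).continuous.const_smul (l n)
  have hJt : ∀ x, Tendsto (fun n => J n x) atTop (𝓝 x) := fun x =>
    tendsto_smul_resolvent H.coercive H.mu_pos hl hlt hRn x
  have hyb : ContinuousOn y (Icc 0 (t + 1)) := hyc.mono Icc_subset_Ici_self
  obtain ⟨Y, hY⟩ := isCompact_Icc.exists_bound_of_continuousOn hyb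
  set N := ∑ i ∈ I, ‖u i‖ with hN
  have hηN : ∀ s, ‖η s‖ ≤ N := norm_stepFun_le I c u
  have hN0 : 0 ≤ N := (norm_nonneg _).trans (hηN 0)
  have hY0 : 0 ≤ Y := (norm_nonneg _).trans (hY t ⟨ht.le, by linarith⟩)
  have hC0 : 0 ≤ C₀ := (hφ.nonneg 0).trans (hφ.le 0)
  have hηm : AEStronglyMeasurable η := (stronglyMeasurable_stepFun I c u).aestronglyMeasurable
  have hsub : Ioo 0 t ⊆ Ici (0 : ℝ) := fun s hs => hs.1.le
  have hJyc : ∀ n, ContinuousOn (fun s => J n (y s)) (Ici 0) := fun n =>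
    (hJc n).comp_continuousOn hyc
  have hJym : ∀ n, AEStronglyMeasurable (fun s => J n (y s)) (volume.restrict (Ioo 0 t)) :=
    fun n => ((hJyc n).mono hsub).aestronglyMeasurable measurableSet_Ioo
  have hθm : ∀ n, AEStronglyMeasurable (fun s => θ (J n (y s))) (volume.restrict (Ioo 0 t)) :=
    fun n => ((hφ.continuous_grad.comp_continuousOn (hJyc n)).mono hsub).aestronglyMeasurable
      measurableSet_Ioo
  have hJηm : ∀ n, AEStronglyMeasurable (fun s => J n (η s)) (volume.restrict (Ioo 0 t)) :=
    fun n => ((hJc n).comp_aestronglyMeasurable hηm).restrict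
  have m1 : ∀ n, AEStronglyMeasurable (fun s => θ (J n (y s)) * ‖J n (y s)‖ ^ 2)
      (volume.restrict (Ioo 0 t)) := fun n => (hθm n).mul ((hJym n).norm.pow 2)
  have m2 : ∀ n, AEStronglyMeasurable (fun s => θ (J n (y s)) * ⟪J n (y s), J n (η s)⟫)
      (volume.restrict (Ioo 0 t)) := fun n => (hθm n).mul ((hJym n).inner (hJηm n))
  have hJy : ∀ n, ∀ s ∈ Ioo 0 t, ‖J n (y s)‖ ≤ Y := fun n s hs =>
    (hJn n _).trans (hY s ⟨hs.1.le, by linarith [hs.2]⟩)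
  have b1 : ∀ n, ∀ s ∈ Ioo 0 t, ‖θ (J n (y s)) * ‖J n (y s)‖ ^ 2‖ ≤ C₀ * Y ^ 2 := by
    intro n s hs
    rw [norm_mul, Real.norm_of_nonneg (hφ.nonneg _), norm_pow, norm_norm]
    exact mul_le_mul (hφ.le _) (pow_le_pow_left₀ (norm_nonneg _) (hJy n s hs) 2) (by positivity) hC0
  have b2 : ∀ n, ∀ s ∈ Ioo 0 t, ‖θ (J n (y s)) * ⟪J n (y s), J n (η s)⟫‖ ≤ C₀ * (Y * N) := by
    intro n s hs
    rw [norm_mul, Real.norm_of_nonneg (hφ.nonneg _)]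
    refine mul_le_mul (hφ.le _) ((norm_inner_le_norm _ _).trans ?_) (norm_nonneg _) hC0
    exact mul_le_mul (hJy n s hs) ((hJn n _).trans (hηN s)) (norm_nonneg _) hY0
  have hstep : ∀ n, φ (J n (y t)) + μ * ∫ s in Ioi 0, rlKer α (t - s) •
        (θ (J n (y s)) * ‖J n (y s)‖ ^ 2) ≤
      φ (J n z₀) + ∫ s in Ioi 0, rlKer α (t - s) •
        (θ (J n (y s)) * ⟪J n (y s), J n (η s)⟫) := by
    intro n
    -- The second summand is `A (J n (y r))`, so `q` is the fractional derivative of `J n ∘ y` and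
    -- coercivity applies to it. The horizon `t + 1` below only makes `t` an interior point.
    set q : ℝ → E := fun r => J n (η r) + l n • (J n (y r) - y r) with hq
    have hmain := hφ.fractional_le hα H.lt_one (T := t + 1) (t := t) (q := q)
      (w := fun s => J n (y s)) (z₀ := J n z₀) (C := N + l n * (Y + Y)) ⟨ht, by linarith⟩
      (by
        refine ((hJc n).comp_aestronglyMeasurable hηm).restrict.add (AEStronglyMeasurable.const_smul
          (((hJyc n).sub hyc).mono (fun s hs => hs.1.le) |>.aestronglyMeasurable
            measurableSet_Ioo) _))
      (by
        intro s hs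
        have hs' : s ∈ Icc 0 (t + 1) := Ioo_subset_Icc_self hs
        refine (norm_add_le _ _).trans (add_le_add ((hJn n _).trans (hηN s)) ?_)
        rw [norm_smul, Real.norm_of_nonneg (hl n).le]
        refine mul_le_mul_of_nonneg_left ((norm_sub_le _ _).trans ?_) (hl n).le
        exact add_le_add ((hJn n _).trans (hY s hs')) (hY s hs'))
      (by
        refine (ae_restrict_iff' measurableSet_Ioo).2 ?_
        filter_upwards [continuousAt_stepFun I c u] with s hs hs'
        refine ((hJc n).continuousAt.comp hs).add (ContinuousAt.const_smul ?_ _)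
        exact (((hJyc n).sub hyc).continuousAt (Ici_mem_nhds hs'.1)))
      ((hJyc n).mono Icc_subset_Ici_self)
      (by
        refine (ae_restrict_iff' measurableSet_Ioo).2 ?_
        filter_upwards [H.resolvent_stepSol (hRn n) z₀ I c hc u] with s hs hs'
        simp only [hJ, hq]
        rw [hs hs'.1, smul_add, ← integral_smul]
        congr 1
        refine integral_congr_ae (ae_of_all _ fun r => ?_)
        simp only
        rw [smul_comm (l n), smul_add])
    have hle : ∫ s in Ioi 0, rlKer α (t - s) * (θ (J n (y s)) * ⟪J n (y s), q s⟫) ≤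
        ∫ s in Ioi 0, (rlKer α (t - s) • (θ (J n (y s)) * ⟪J n (y s), J n (η s)⟫) -
          μ * rlKer α (t - s) • (θ (J n (y s)) * ‖J n (y s)‖ ^ 2)) := by
      have j1 := integrableOn_rlKer_smul_of_bounded hα (m1 n) (b1 n)
      have j2 := integrableOn_rlKer_smul_of_bounded hα (m2 n) (b2 n)
      have hpt : ∀ s, ⟪J n (y s), q s⟫ ≤ ⟪J n (y s), J n (η s)⟫ - μ * ‖J n (y s)‖ ^ 2 := by
        intro s
        obtain ⟨hm, hz⟩ := (hRn n).1 (y s)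
        have h1 := H.coercive ⟨l n • Rn n (y s), A.domain.smul_mem _ hm⟩
        have h2 : A ⟨l n • Rn n (y s), A.domain.smul_mem _ hm⟩ =
            l n • (J n (y s) - y s) := by
          have : (⟨l n • Rn n (y s), A.domain.smul_mem _ hm⟩ : A.domain) =
            l n • ⟨Rn n (y s), hm⟩ := rfl
          rw [this, LinearPMap.map_smul]
          congr 1
          rw [eq_sub_iff_add_eq', ← eq_sub_iff_add_eq, hz]
        rw [h2] at h1
        simp only [hq, inner_add_right]
        rw [inner_neg_left, real_inner_comm] at h1
        have h3 : μ * ‖J n (y s)‖ ^ 2 ≤ -⟪J n (y s), l n • (J n (y s) - y s)⟫ := h1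
        linarith
      refine integral_mono_ae ?_ (j2.sub (j1.const_mul μ)) (ae_of_all _ fun s => ?_)
      · have : IntegrableOn (fun s => rlKer α (t - s) • (θ (J n (y s)) * ⟪J n (y s), q s⟫))
            (Ioi 0) := by
          refine integrableOn_rlKer_smul_of_bounded hα (C := C₀ * (Y * (N + l n * (Y + Y)))) ?_ ?_
          · refine (hθm n).mul ((hJym n).inner ((hJηm n).add ?_))
            exact AEStronglyMeasurable.const_smul ((((hJyc n).sub hyc).mono
              hsub).aestronglyMeasurable measurableSet_Ioo) _
          · intro s hs
            rw [norm_mul, Real.norm_of_nonneg (hφ.nonneg _)]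
            refine mul_le_mul (hφ.le _) ((norm_inner_le_norm _ _).trans ?_) (norm_nonneg _) hC0
            refine mul_le_mul (hJy n s hs) ?_ (norm_nonneg _) hY0
            refine (norm_add_le _ _).trans (add_le_add ((hJn n _).trans (hηN s)) ?_)
            rw [norm_smul, Real.norm_of_nonneg (hl n).le]
            refine mul_le_mul_of_nonneg_left ((norm_sub_le _ _).trans ?_) (hl n).le
            exact add_le_add (hJy n s hs) (hY s ⟨hs.1.le, by linarith [hs.2]⟩)
        exact this
      · have h1 := mul_le_mul_of_nonneg_left (hpt s) (hφ.nonneg (J n (y s)))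
        have h2 := mul_le_mul_of_nonneg_left h1 (rlKer_nonneg hα (t - s))
        refine h2.trans_eq ?_
        simp only [smul_eq_mul]
        ring
    rw [integral_sub (integrableOn_rlKer_smul_of_bounded hα (m2 n) (b2 n))
      ((integrableOn_rlKer_smul_of_bounded hα (m1 n) (b1 n)).const_mul μ),
      integral_const_mul] at hle
    linarith
  have hlim : ∀ s, Tendsto (fun n => θ (J n (y s))) atTop (𝓝 (θ (y s))) := fun s =>
    (hφ.continuous_grad.tendsto _).comp (hJt _)
  refine le_of_tendsto_of_tendsto' (Tendsto.add ((hφ.continuous_fun.tendsto _).comp (hJt _))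
    (Tendsto.const_mul μ (tendsto_integral_rlKer hα m1 b1 fun s _ => ?_)))
    (Tendsto.add ((hφ.continuous_fun.tendsto _).comp (hJt _))
    (tendsto_integral_rlKer hα m2 b2 fun s _ => ?_)) hstep
  · exact (hlim s).mul ((hJt _).norm.pow 2)
  · exact (hlim s).mul ((hJt _).inner (hJt _))

end CoerciveFamily

end steps

end FracControl

end

/-! ### The pointwise bound of the resolvent family and the mild formula. -/

noncomputable section

namespace FracControl

variable {E : Type*} [NormedAddCommGroup E] [InnerProductSpace ℝ E]
  {α μ : ℝ} {A : E →ₗ.[ℝ] E} {T S : ℝ → E →L[ℝ] E} {ι : Type*}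

/-- The convolution `∫₀ᵗ S(t - s) h(s) ds`. -/
def mildOp (S : ℝ → E →L[ℝ] E) (h : ℝ → E) (t : ℝ) : E := ∫ s in Ioo 0 t, S (t - s) (h s)

/-- The operator `S r` for `r > 0`, and zero otherwise. -/
def posOp (S : ℝ → E →L[ℝ] E) (r : ℝ) : E →L[ℝ] E := if 0 < r then S r else 0

theorem smoothGrad_mul_inner_le {ε : ℝ} (hε : 0 < ε) (y h : E) :
    |(smoothNorm ε y)⁻¹ * ⟪y, h⟫| ≤ ‖h‖ := by
  have h0 := smoothNorm_pos hε y
  rw [abs_mul, abs_of_pos (inv_pos.2 h0), inv_mul_le_iff₀ h0]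
  refine (abs_real_inner_le_norm y h).trans ?_
  exact mul_le_mul_of_nonneg_right (norm_le_smoothNorm ε y) (norm_nonneg _)

namespace CoerciveFamily

variable (H : CoerciveFamily α A T S μ)
include H

theorem hasDerivAt_primOp [CompleteSpace E] (u : E) {t : ℝ} (ht : 0 < t) :
    HasDerivAt (primOp S u) (S t u) t := by
  have hc : ContinuousOn (fun r => S r u) (Ioi 0) := H.resolvent.1 u
  have h1 : HasDerivAt (fun s => ∫ r in (0 : ℝ)..s, S r u) (S t u) t := by
    refine intervalIntegral.integral_hasDerivAt_right ?_ ?_ (hc.continuousAt (Ioi_mem_nhds ht))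
    · exact (intervalIntegrable_iff_integrableOn_Ioc_of_le ht.le).2 (H.integrableOn_apply u t)
    · exact hc.stronglyMeasurableAtFilter isOpen_Ioi t ht
  refine h1.congr_of_eventuallyEq ?_
  filter_upwards [Ioi_mem_nhds ht] with s hs
  rw [primOp, intervalIntegral.integral_of_le (le_of_lt hs)]

variable [CompleteSpace E]

/-- The energy inequality for the smoothed norm: the dissipation is dropped, the gradient has norm
at most one, and `ε → 0`. -/
theorem norm_stepSol_le (z₀ : E) (I : Finset ι) (c : ι → ℝ) (hc : ∀ i ∈ I, 0 ≤ c i) (u : ι → E)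
    {t : ℝ} (ht : 0 < t) :
    ‖stepSol T S z₀ I c u t‖ ≤ ‖z₀‖ + ∫ s in Ioi 0, rlKer α (t - s) • ‖stepFun I c u s‖ := by
  refine le_of_forall_pos_le_add fun ε hε => ?_
  have h1 := H.step_energy (radialConvex_smoothNorm hε) z₀ I c hc u ht
  have h2 : 0 ≤ ∫ s in Ioi 0, rlKer α (t - s) •
      ((smoothNorm ε (stepSol T S z₀ I c u s))⁻¹ * ‖stepSol T S z₀ I c u s‖ ^ 2) :=
    integral_nonneg fun s => mul_nonneg (rlKer_nonneg H.pos _)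
      (mul_nonneg (inv_pos.2 (smoothNorm_pos hε _)).le (sq_nonneg _))
  have h3 : ∫ s in Ioi 0, rlKer α (t - s) • ((smoothNorm ε (stepSol T S z₀ I c u s))⁻¹ *
      ⟪stepSol T S z₀ I c u s, stepFun I c u s⟫) ≤
      ∫ s in Ioi 0, rlKer α (t - s) • ‖stepFun I c u s‖ := by
    refine (Real.le_norm_self _).trans (norm_integral_le_of_norm_le ?_ (ae_of_all _ fun s => ?_))
    · exact integrableOn_rlKer_smul_of_bounded H.pos (C := ∑ i ∈ I, ‖u i‖)
        (stronglyMeasurable_stepFun I c u).norm.aestronglyMeasurable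
        (fun s _ => by rw [norm_norm]; exact norm_stepFun_le I c u s)
    · rw [norm_smul, Real.norm_of_nonneg (rlKer_nonneg H.pos _)]
      exact mul_le_mul_of_nonneg_left (smoothGrad_mul_inner_le hε _ _) (rlKer_nonneg H.pos _)
  have h4 := smoothNorm_le hε z₀
  have h5 := norm_le_smoothNorm ε (stepSol T S z₀ I c u t)
  have h6 := mul_nonneg H.mu_pos.le h2
  linarith

/-- Test `norm_stepSol_le` with the constant pulse `u` on `(0, δ]`. The solution at `t` is the
increment of the primitive of `S · u` over `[t - δ, t]`, bounded by `δ k(t - δ) ‖u‖`; divide by `δ`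
and let `δ → 0`. -/
theorem norm_resolvent_le (u : E) {t : ℝ} (ht : 0 < t) : ‖S t u‖ ≤ rlKer α t * ‖u‖ := by
  have hα := H.pos
  have hbound : ∀ δ ∈ Ioo 0 t,
      ‖primOp S u t - primOp S u (t - δ)‖ ≤ δ * rlKer α (t - δ) * ‖u‖ := by
    intro δ hδ
    have h1 := H.norm_stepSol_le 0 (Finset.univ : Finset (Fin 2)) ![0, δ]
      (by intro i _; fin_cases i <;> simp [hδ.1.le]) ![u, -u] ht
    have h2 : stepSol T S 0 (Finset.univ : Finset (Fin 2)) ![0, δ] ![u, -u] t =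
        primOp S u t - primOp S u (t - δ) := by
      simp [stepSol, primOp, integral_neg, sub_eq_add_neg]
    rw [h2, norm_zero, zero_add] at h1
    refine h1.trans ?_
    have h3 : ∀ s ∈ Ioi (0 : ℝ), rlKer α (t - s) •
        ‖stepFun (Finset.univ : Finset (Fin 2)) ![0, δ] ![u, -u] s‖ =
        (Ioc 0 δ).indicator (fun s => rlKer α (t - s) * ‖u‖) s := by
      intro s hs
      have hs' : 0 < s := hs
      by_cases h : δ < s
      · simp [stepFun, hs', h, Fin.sum_univ_two]
      · simp [stepFun, hs', h, not_lt.1 h, Fin.sum_univ_two]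
    rw [setIntegral_congr_fun measurableSet_Ioi h3, setIntegral_indicator measurableSet_Ioc,
      inter_eq_right.2 (Ioc_subset_Ioi_self : Ioc 0 δ ⊆ Ioi 0)]
    have h4 : ∫ s in Ioc 0 δ, rlKer α (t - δ) * ‖u‖ = δ * rlKer α (t - δ) * ‖u‖ := by
      rw [setIntegral_const]
      simp [hδ.1.le, mul_assoc]
    rw [← h4]
    refine setIntegral_mono_on ?_ ?_ measurableSet_Ioc fun s hs => ?_
    · exact ((integrableOn_rlKer_sub hα t).mono_set Ioc_subset_Ioi_self).mul_const _
    · exact integrableOn_const (by simp)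
    · refine mul_le_mul_of_nonneg_right ?_ (norm_nonneg _)
      exact rlKer_antitone hα H.lt_one (by linarith [hδ.2]) (by linarith [hs.2])
  set d : ℕ → ℝ := fun n => t / (n + 2) with hd
  have hd0 : ∀ n, d n ∈ Ioo 0 t := by
    intro n
    have : (0 : ℝ) < n + 2 := by positivity
    refine ⟨by positivity, (div_lt_iff₀ this).2 ?_⟩
    nlinarith [n.cast_nonneg (α := ℝ)]
  have hdt : Tendsto d atTop (𝓝 0) := by
    refine Tendsto.div_atTop tendsto_const_nhds ?_
    exact tendsto_atTop_add_const_right _ _ tendsto_natCast_atTop_atTop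
  have hsub : Tendsto (fun n => t - d n) atTop (𝓝 t) := by simpa using hdt.const_sub t
  have hslope := (hasDerivAt_iff_tendsto_slope.1 (H.hasDerivAt_primOp u ht)).comp
    (tendsto_nhdsWithin_iff.2 ⟨hsub, Eventually.of_forall fun n => by
      simpa using (hd0 n).1.ne'⟩)
  have hker : Tendsto (fun n => rlKer α (t - d n) * ‖u‖) atTop (𝓝 (rlKer α t * ‖u‖)) :=
    Tendsto.mul_const _
      ((continuousOn_rlKer.continuousAt (Ioi_mem_nhds ht)).tendsto.comp hsub)
  refine le_of_tendsto_of_tendsto' hslope.norm hker fun n => ?_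
  have h1 := hbound _ (hd0 n)
  have h2 := (hd0 n).1
  simp only [Function.comp, slope_def_module]
  rw [norm_smul, sub_sub_cancel_left, norm_inv, norm_neg, Real.norm_of_nonneg h2.le, norm_sub_rev,
    inv_mul_le_iff₀ h2, ← mul_assoc]
  exact h1

omit [CompleteSpace E] in
-- Nothing is known about continuity of `S` at `0`, so the function is a pointwise limit of the
-- versions stopped at `1 / (n + 1)`, continuous on the half-line.
theorem stronglyMeasurable_posOp_const (u : E) : StronglyMeasurable fun r => posOp S r u := by
  have h1 : ∀ n : ℕ, StronglyMeasurable
      ((Ioi (0 : ℝ)).indicator fun r => S (max r (1 / ((n : ℝ) + 1))) u) := by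
    intro n
    refine StronglyMeasurable.indicator (Continuous.stronglyMeasurable ?_) measurableSet_Ioi
    refine (H.resolvent.1 u).comp_continuous (by fun_prop) fun r => ?_
    exact lt_max_of_lt_right (show (0 : ℝ) < 1 / ((n : ℝ) + 1) by positivity)
  refine stronglyMeasurable_of_tendsto atTop h1 ?_
  rw [tendsto_pi_nhds]
  intro r
  by_cases hr : 0 < r
  · refine tendsto_const_nhds.congr' ?_
    have := tendsto_one_div_add_atTop_nhds_zero_nat (𝕜 := ℝ)
    filter_upwards [this.eventually_lt_const hr] with n hn
    rw [indicator_of_mem (show r ∈ Ioi 0 from hr), posOp, if_pos hr, max_eq_left hn.le]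
  · refine tendsto_const_nhds.congr fun n => ?_
    rw [indicator_of_notMem (by simpa using hr), posOp, if_neg hr]
    rfl

omit [CompleteSpace E] in
-- Strong continuity gives no measurability in operator norm, so joint measurability is obtained by
-- approximating the argument `g` by simple functions.
theorem stronglyMeasurable_posOp {X : Type*} [MeasurableSpace X] {ρ : X → ℝ} (hρ : Measurable ρ)
    {g : X → E} (hg : StronglyMeasurable g) :
    StronglyMeasurable fun x => posOp S (ρ x) (g x) := by
  have hs : ∀ f : SimpleFunc X E, StronglyMeasurable fun x => posOp S (ρ x) (f x) := by
    intro f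
    induction f using SimpleFunc.induction with
    | const c hs =>
      have := ((H.stronglyMeasurable_posOp_const c).comp_measurable hρ).indicator hs
      convert this using 2 with x
      classical
      simp only [SimpleFunc.coe_piecewise, piecewise, indicator]
      split_ifs <;> simp
    | add _ hf hg =>
      simpa using! hf.add hg
  refine stronglyMeasurable_of_tendsto atTop (fun n => hs (hg.approx n)) ?_
  rw [tendsto_pi_nhds]
  intro x
  exact ((posOp S (ρ x)).continuous.tendsto _).comp (hg.tendsto_approx x)

omit [CompleteSpace E] in
theorem aestronglyMeasurable_posOp {X : Type*} [MeasurableSpace X] {m : Measure X} {ρ : X → ℝ}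
    (hρ : Measurable ρ) {g : X → E} (hg : AEStronglyMeasurable g m) :
    AEStronglyMeasurable (fun x => posOp S (ρ x) (g x)) m := by
  refine ⟨_, H.stronglyMeasurable_posOp hρ hg.stronglyMeasurable_mk, ?_⟩
  filter_upwards [hg.ae_eq_mk] with x hx
  rw [hx]

omit [CompleteSpace E] in
theorem aestronglyMeasurable_mild {t : ℝ} {h : ℝ → E}
    (hh : AEStronglyMeasurable h (volume.restrict (Ioo 0 t))) :
    AEStronglyMeasurable (fun s => S (t - s) (h s)) (volume.restrict (Ioo 0 t)) := by
  refine (H.aestronglyMeasurable_posOp (by fun_prop : Measurable fun s : ℝ => t - s) hh).congr ?_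
  filter_upwards [ae_restrict_mem measurableSet_Ioo] with s hs
  rw [posOp, if_pos (by linarith [hs.2])]

theorem integrableOn_mild {t : ℝ} {h : ℝ → E}
    (hh : AEStronglyMeasurable h (volume.restrict (Ioo 0 t)))
    (hi : IntegrableOn (fun s => rlKer α (t - s) * ‖h s‖) (Ioo 0 t)) :
    IntegrableOn (fun s => S (t - s) (h s)) (Ioo 0 t) := by
  refine hi.mono' (H.aestronglyMeasurable_mild hh) ?_
  filter_upwards [ae_restrict_mem measurableSet_Ioo] with s hs
  exact H.norm_resolvent_le _ (by linarith [hs.2])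

theorem integrableOn_rlKer_norm_stepFun (I : Finset ι) (c : ι → ℝ) (u : ι → E) (t : ℝ) :
    IntegrableOn (fun s => rlKer α (t - s) * ‖stepFun I c u s‖) (Ioo 0 t) := by
  have := integrableOn_rlKer_smul_of_bounded H.pos (t := t) (f := fun s => ‖stepFun I c u s‖)
    (C := ∑ i ∈ I, ‖u i‖)
    (stronglyMeasurable_stepFun I c u).norm.aestronglyMeasurable
    (fun s _ => by rw [norm_norm]; exact norm_stepFun_le I c u s)
  exact this.mono_set Ioo_subset_Ioi_self

/-- Identifies the superposition of primitives with the variation-of-constants formula, so that the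
estimates for steps become estimates for mild solutions. -/
theorem stepSol_eq (z₀ : E) (I : Finset ι) (c : ι → ℝ) (hc : ∀ i ∈ I, 0 ≤ c i) (u : ι → E)
    (t : ℝ) : stepSol T S z₀ I c u t = T t z₀ + mildOp S (stepFun I c u) t := by
  rw [stepSol, mildOp]
  congr 1
  have h0 : ∀ i, (fun s => S (t - s) (if c i < s then u i else 0)) =
      fun s => S (t - s) (stepFun {i} c u s) := by
    intro i; ext s; simp [stepFun]
  have hi : ∀ i ∈ I, IntegrableOn (fun s => S (t - s) (if c i < s then u i else 0)) (Ioo 0 t) := by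
    intro i _
    rw [h0]
    exact H.integrableOn_mild (stronglyMeasurable_stepFun _ c u).aestronglyMeasurable
      (H.integrableOn_rlKer_norm_stepFun _ c u t)
  simp only [stepFun, map_sum]
  rw [integral_finsetSum _ hi]
  refine Finset.sum_congr rfl fun i hiI => ?_
  have e1 : ∫ s in Ioo 0 t, S (t - s) (if c i < s then u i else 0) =
      ∫ s, (Ioo 0 (t - c i)).indicator (fun r => S r (u i)) (t - s) := by
    rw [← integral_indicator measurableSet_Ioo]
    refine integral_congr_ae (ae_of_all _ fun s => ?_)
    have := hc i hiI
    simp only [indicator, mem_Ioo]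
    by_cases h1 : c i < s
    · by_cases h2 : s < t
      · rw [if_pos (show 0 < s ∧ s < t from ⟨by linarith, h2⟩), if_pos h1,
          if_pos (show 0 < t - s ∧ t - s < t - c i from ⟨by linarith, by linarith⟩)]
      · rw [if_neg (fun h : 0 < s ∧ s < t => h2 h.2),
          if_neg (fun h : 0 < t - s ∧ t - s < t - c i => h2 (by linarith [h.1]))]
    · rw [if_neg (fun h : 0 < t - s ∧ t - s < t - c i => h1 (by linarith [h.2])), if_neg h1]
      simp
  rw [e1, integral_sub_left_eq_self _ volume t, integral_indicator measurableSet_Ioo, primOp,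
    integral_Ioc_eq_integral_Ioo]

end CoerciveFamily

/-- Young's inequality for the Riemann-Liouville kernel, in `L¹`. -/
theorem lintegral_rlKer_conv_le (t : ℝ) {e : ℝ → ℝ≥0∞}
    (he : AEMeasurable e (volume.restrict (Ioo 0 t))) :
    ∫⁻ s in Ioo 0 t, ∫⁻ r in Ioo 0 s, ENNReal.ofReal (rlKer α (s - r)) * e r ≤
      (∫⁻ s in Ioo 0 t, ENNReal.ofReal (rlKer α s)) * ∫⁻ s in Ioo 0 t, e s := by
  set k : ℝ → ℝ≥0∞ := (Ioo 0 t).indicator fun s => ENNReal.ofReal (rlKer α s) with hk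
  set e' : ℝ → ℝ≥0∞ := (Ioo 0 t).indicator e with he'
  have hkm : Measurable k := (measurable_rlKer.ennreal_ofReal).indicator measurableSet_Ioo
  have hem : AEMeasurable e' := (aemeasurable_indicator_iff measurableSet_Ioo).2 he
  have h1 : ∀ s ∈ Ioo 0 t, ∫⁻ r in Ioo 0 s, ENNReal.ofReal (rlKer α (s - r)) * e r ≤
      ∫⁻ r, k (s - r) * e' r := by
    intro s hs
    rw [← lintegral_indicator measurableSet_Ioo]
    refine lintegral_mono fun r => ?_
    by_cases hr : r ∈ Ioo 0 s
    · rw [indicator_of_mem hr, hk, he', indicator_of_mem (show s - r ∈ Ioo 0 t from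
        ⟨by linarith [hr.2], by linarith [hr.1, hs.2]⟩),
        indicator_of_mem (show r ∈ Ioo 0 t from ⟨hr.1, hr.2.trans hs.2⟩)]
    · rw [indicator_of_notMem hr]; exact zero_le
  calc _ ≤ ∫⁻ s in Ioo 0 t, ∫⁻ r, k (s - r) * e' r := setLIntegral_mono' measurableSet_Ioo h1
    _ ≤ ∫⁻ s, ∫⁻ r, k (s - r) * e' r := setLIntegral_le_lintegral _ _
    _ = ∫⁻ r, ∫⁻ s, k (s - r) * e' r := by
        refine lintegral_lintegral_swap (f := fun s r => k (s - r) * e' r) ?_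
        exact (hkm.comp (by fun_prop : Measurable fun p : ℝ × ℝ => p.1 - p.2)).aemeasurable.mul
          hem.comp_snd
    _ = ∫⁻ r, (∫⁻ s, k s) * e' r := by
        refine lintegral_congr fun r => ?_
        have hm : Measurable fun s => k (s - r) := hkm.comp (by fun_prop)
        rw [lintegral_mul_const _ hm, lintegral_sub_right_eq_self k r]
    _ = (∫⁻ s, k s) * ∫⁻ r, e' r := lintegral_const_mul'' _ hem
    _ = _ := by
        rw [hk, he', lintegral_indicator measurableSet_Ioo, lintegral_indicator measurableSet_Ioo]

end FracControl

end

/-! ### From step forcing to general forcing. -/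

noncomputable section

namespace FracControl

variable {E : Type*} [NormedAddCommGroup E] [InnerProductSpace ℝ E]
  {α μ : ℝ} {A : E →ₗ.[ℝ] E} {T S : ℝ → E →L[ℝ] E} {ι : Type*}

/-- Step functions are dense in `Lᵖ` of a finite measure on a bounded interval. -/
theorem exists_stepFun_approx {ν : Measure ℝ} [IsFiniteMeasure ν] {b : ℝ} (hb : 0 < b)
    (hν : ∀ᵐ s ∂ν, s ∈ Ioo 0 b) {p : ℝ≥0∞} (hp : p ≠ ∞) (hp1 : 1 ≤ p) {g : ℝ → E}
    (hg : MemLp g p ν) {ε : ℝ≥0∞} (hε : ε ≠ 0) :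
    ∃ (I : Finset (ℕ × Bool)) (c : ℕ × Bool → ℝ) (u : ℕ × Bool → E), (∀ i ∈ I, 0 ≤ c i) ∧
      (∀ s, b < s → stepFun I c u s = 0) ∧
      eLpNorm (fun s => g s - stepFun I c u s) p ν ≤ ε := by
  have hε2 : ε / 2 ≠ 0 := (ENNReal.half_pos hε).ne'
  obtain ⟨g', -, hgg', hg'c, hg'p⟩ := hg.exists_hasCompactSupport_eLpNorm_sub_le hp hε2
  obtain ⟨C, hC0, hC⟩ := ENNReal.exists_nnreal_pos_mul_lt
    (a := ν univ ^ p.toReal⁻¹) (ENNReal.rpow_ne_top_of_nonneg (by positivity) (by simp)) hε2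
  have huc := isCompact_Icc.uniformContinuousOn_of_continuous
    (hg'c.continuousOn (s := Icc 0 b))
  obtain ⟨δ, hδ, hδC⟩ := Metric.uniformContinuousOn_iff.1 huc C (by exact_mod_cast hC0)
  obtain ⟨n, hn⟩ := exists_nat_gt (b / δ)
  have hn0 : (0 : ℝ) < n := (div_pos hb hδ).trans hn
  have hbn : b / n < δ := by rwa [div_lt_comm₀ hn0 hδ]
  -- Each cell contributes two jumps: up at its left end (`false`) and down at its right end
  -- (`true`). All contributions therefore cancel beyond `b`.
  set c : ℕ × Bool → ℝ := fun i => if i.2 then (i.1 + 1) * (b / n) else i.1 * (b / n) with hc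
  set u : ℕ × Bool → E := fun i =>
    if i.2 then -g' (i.1 * (b / n)) else g' (i.1 * (b / n)) with hu
  have hbn0 : 0 < b / n := by positivity
  have hval : ∀ s, stepFun (Finset.range n ×ˢ Finset.univ) c u s = ∑ k ∈ Finset.range n,
      if (k : ℝ) * (b / n) < s ∧ s ≤ (k + 1) * (b / n) then g' (k * (b / n)) else 0 := by
    intro s
    rw [stepFun, Finset.sum_product]
    refine Finset.sum_congr rfl fun k _ => ?_
    simp only [Fintype.univ_bool, Finset.mem_singleton, Bool.true_eq_false, not_false_eq_true,
      Finset.sum_insert, Finset.sum_singleton, hc, hu, if_true, Bool.false_eq_true, if_false]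
    by_cases h1 : (k : ℝ) * (b / n) < s <;> by_cases h2 : (k + 1 : ℝ) * (b / n) < s
    · simp [h1, h2]
    · simp [h1, h2, not_lt.1 h2]
    · exact absurd (lt_trans (by nlinarith) h2) h1
    · simp [h1, h2]
  refine ⟨Finset.range n ×ˢ Finset.univ, c, u, ?_, ?_, ?_⟩
  · intro i _
    simp only [hc]
    split_ifs <;> positivity
  · intro s hs
    rw [hval]
    refine Finset.sum_eq_zero fun k hk => if_neg ?_
    rintro ⟨-, h⟩
    have h1 : ((k : ℝ) + 1) ≤ n := by exact_mod_cast Finset.mem_range.1 hk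
    have h2 : ((k : ℝ) + 1) * (b / n) ≤ n * (b / n) := mul_le_mul_of_nonneg_right h1 hbn0.le
    rw [mul_div_cancel₀ _ hn0.ne'] at h2
    linarith
  · have hclose : ∀ᵐ s ∂ν, ‖g' s - stepFun (Finset.range n ×ˢ Finset.univ) c u s‖ ≤ C := by
      filter_upwards [hν] with s hs
      have hx0 : 0 < s / (b / n) := div_pos hs.1 hbn0
      -- Cells are open on the left and closed on the right, so the index of the cell of `s` is the
      -- ceiling minus one.
      have hk1 : 1 ≤ ⌈s / (b / n)⌉₊ := Nat.one_le_iff_ne_zero.2 (Nat.ceil_pos.2 hx0).ne'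
      obtain ⟨k, hk⟩ : ∃ k, ⌈s / (b / n)⌉₊ = k + 1 := ⟨_, (Nat.sub_add_cancel hk1).symm⟩
      have h1 : (k : ℝ) * (b / n) < s := by
        rw [← lt_div_iff₀ hbn0]
        exact Nat.lt_ceil.1 (by omega)
      have h2 : s ≤ (k + 1) * (b / n) := by
        rw [← div_le_iff₀ hbn0]
        have := Nat.le_ceil (s / (b / n))
        rw [hk] at this
        exact_mod_cast this
      have hkn : k < n := by
        have h3 : (k : ℝ) * (b / n) < n * (b / n) := by
          rw [mul_div_cancel₀ _ hn0.ne']; exact h1.trans hs.2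
        exact_mod_cast lt_of_mul_lt_mul_right h3 hbn0.le
      rw [hval, Finset.sum_eq_single k, if_pos ⟨h1, h2⟩]
      · rw [← dist_eq_norm]
        refine (hδC s (Ioo_subset_Icc_self hs) _ ⟨by positivity, (h1.trans hs.2).le⟩ ?_).le
        rw [Real.dist_eq, abs_of_pos (by linarith)]
        linarith
      · intro j _ hjk
        refine if_neg ?_
        rintro ⟨h3, h4⟩
        have h5 : (j : ℝ) < k + 1 := lt_of_mul_lt_mul_right (h3.trans_le h2) hbn0.le
        have h6 : (k : ℝ) < j + 1 := lt_of_mul_lt_mul_right (h1.trans_le h4) hbn0.le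
        have h5' : j < k + 1 := by exact_mod_cast h5
        have h6' : k < j + 1 := by exact_mod_cast h6
        omega
      · intro h; exact absurd (Finset.mem_range.2 hkn) h
    have h2 := eLpNorm_le_of_ae_bound (p := p) hclose
    have hm : AEStronglyMeasurable (stepFun (Finset.range n ×ˢ Finset.univ) c u) ν :=
      (stronglyMeasurable_stepFun _ c u).aestronglyMeasurable
    have e : (fun s => g s - stepFun (Finset.range n ×ˢ Finset.univ) c u s) =
        (g - g') + fun s => g' s - stepFun (Finset.range n ×ˢ Finset.univ) c u s := by
      ext s; simp
    rw [e, ← ENNReal.add_halves ε]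
    refine (eLpNorm_add_le (hg.1.sub hg'p.1) (hg'p.1.sub hm) hp1).trans (add_le_add hgg' ?_)
    refine h2.trans ?_
    rw [mul_comm] at hC
    simpa using hC.le

theorem aemeasurable_rlConv (t : ℝ) {e : ℝ → ℝ≥0∞}
    (he : AEMeasurable e (volume.restrict (Ioo 0 t))) :
    AEMeasurable (fun s => ∫⁻ r in Ioo 0 s, ENNReal.ofReal (rlKer α (s - r)) * e r)
      (volume.restrict (Ioo 0 t)) := by
  set e' : ℝ → ℝ≥0∞ := (Ioo 0 t).indicator e with he'
  have hem : AEMeasurable e' := (aemeasurable_indicator_iff measurableSet_Ioo).2 he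
  have h1 : AEMeasurable (fun s => ∫⁻ r, ENNReal.ofReal (rlKer α (s - r)) * e' r) volume := by
    refine AEMeasurable.lintegral_prod_right'
      (f := fun p : ℝ × ℝ => ENNReal.ofReal (rlKer α (p.1 - p.2)) * e' p.2) ?_
    exact (measurable_rlKer.comp
      (by fun_prop : Measurable fun p : ℝ × ℝ => p.1 - p.2)).ennreal_ofReal.aemeasurable.mul
      hem.comp_snd
  refine h1.restrict.congr ?_
  filter_upwards [ae_restrict_mem measurableSet_Ioo] with s hs
  rw [← lintegral_indicator measurableSet_Ioo]
  refine lintegral_congr fun r => ?_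
  by_cases hr : r ∈ Ioo 0 s
  · rw [indicator_of_mem hr, he', indicator_of_mem (show r ∈ Ioo 0 t from ⟨hr.1, hr.2.trans hs.2⟩)]
  · rw [indicator_of_notMem hr, he']
    by_cases h0 : 0 < r
    · rw [rlKer_of_nonpos (sub_nonpos.2 (not_lt.1 fun h => hr ⟨h0, h⟩))]; simp
    · rw [indicator_of_notMem (fun h => h0 h.1), mul_zero]

theorem lintegral_rlKer_lt_top (hα : 0 < α) (t : ℝ) :
    ∫⁻ s in Ioo 0 t, ENNReal.ofReal (rlKer α s) < ∞ := by
  have := ((integrableOn_rlKer hα t).mono_set (Ioo_subset_Iio_self : Ioo 0 t ⊆ _)).lintegral_lt_top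
  exact this

theorem ae_rlConv_lt_top (hα : 0 < α) (t : ℝ) {e : ℝ → ℝ≥0∞}
    (he : AEMeasurable e (volume.restrict (Ioo 0 t))) (hfin : ∫⁻ s in Ioo 0 t, e s ≠ ∞) :
    ∀ᵐ s ∂volume.restrict (Ioo 0 t),
      ∫⁻ r in Ioo 0 s, ENNReal.ofReal (rlKer α (s - r)) * e r < ∞ := by
  refine ae_lt_top' (aemeasurable_rlConv t he) ?_
  exact ((lintegral_rlKer_conv_le t he).trans_lt
    (ENNReal.mul_lt_top (lintegral_rlKer_lt_top hα t) hfin.lt_top)).ne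

/-- Summable `L¹` norms make the fractional integral of the sum finite almost everywhere, so the
fractional integrals of the terms are summable there and tend to zero. -/
theorem ae_tendsto_rlConv (hα : 0 < α) (t : ℝ) {e : ℕ → ℝ → ℝ≥0∞}
    (he : ∀ n, AEMeasurable (e n) (volume.restrict (Ioo 0 t)))
    (hfin : ∑' n, ∫⁻ s in Ioo 0 t, e n s ≠ ∞) :
    ∀ᵐ s ∂volume.restrict (Ioo 0 t),
      Tendsto (fun n => ∫⁻ r in Ioo 0 s, ENNReal.ofReal (rlKer α (s - r)) * e n r) atTop (𝓝 0) := by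
  have h1 : AEMeasurable (fun s => ∑' n, e n s) (volume.restrict (Ioo 0 t)) :=
    AEMeasurable.tsum he
  have h2 : ∫⁻ s in Ioo 0 t, ∑' n, e n s ≠ ∞ := by rwa [lintegral_tsum he]
  filter_upwards [ae_rlConv_lt_top hα t h1 h2, ae_restrict_mem measurableSet_Ioo] with s hs hst
  refine ENNReal.tendsto_atTop_zero_of_tsum_ne_top ?_
  rw [← lintegral_tsum]
  · simp only [ENNReal.tsum_mul_left]
    exact hs.ne
  · intro n
    refine ((measurable_rlKer.comp (by fun_prop : Measurable fun r : ℝ => s - r)).ennreal_ofReal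
      ).aemeasurable.mul ((he n).mono_measure (Measure.restrict_mono ?_ le_rfl))
    exact Ioo_subset_Ioo_right hst.2.le

theorem integrableOn_rlKer_mul_norm_iff (hα : 0 < α) {t : ℝ} {h : ℝ → E}
    (hh : AEStronglyMeasurable h (volume.restrict (Ioo 0 t))) :
    IntegrableOn (fun s => rlKer α (t - s) * ‖h s‖) (Ioo 0 t) ↔
      ∫⁻ s in Ioo 0 t, ENNReal.ofReal (rlKer α (t - s)) * ‖h s‖ₑ < ∞ := by
  have hm : AEStronglyMeasurable (fun s => rlKer α (t - s) * ‖h s‖) (volume.restrict (Ioo 0 t)) :=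
    (measurable_rlKer.comp (by fun_prop : Measurable fun r : ℝ => t - r)).aestronglyMeasurable.mul
      hh.norm
  rw [IntegrableOn, Integrable, and_iff_right hm, HasFiniteIntegral]
  congr! 2
  ext s
  rw [← ofReal_norm, norm_mul, norm_norm, Real.norm_of_nonneg (rlKer_nonneg hα _),
    ENNReal.ofReal_mul (rlKer_nonneg hα _), ofReal_norm]

theorem ae_integrableOn_rlKer_mul_norm (hα : 0 < α) {t : ℝ} {h : ℝ → E}
    (hh : IntegrableOn h (Ioo 0 t)) :
    ∀ᵐ s ∂volume.restrict (Ioo 0 t),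
      IntegrableOn (fun r => rlKer α (s - r) * ‖h r‖) (Ioo 0 s) := by
  filter_upwards [ae_rlConv_lt_top hα t hh.aestronglyMeasurable.enorm hh.2.ne,
    ae_restrict_mem measurableSet_Ioo] with s hs hst
  rw [integrableOn_rlKer_mul_norm_iff hα (hh.aestronglyMeasurable.mono_measure
    (Measure.restrict_mono (Ioo_subset_Ioo_right hst.2.le) le_rfl))]
  exact hs

namespace CoerciveFamily

variable (H : CoerciveFamily α A T S μ) [CompleteSpace E]
include H

theorem enorm_mildOp_sub_le {t : ℝ} {h h' : ℝ → E}
    (hh : AEStronglyMeasurable h (volume.restrict (Ioo 0 t)))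
    (hi : IntegrableOn (fun s => rlKer α (t - s) * ‖h s‖) (Ioo 0 t))
    (hh' : AEStronglyMeasurable h' (volume.restrict (Ioo 0 t)))
    (hi' : IntegrableOn (fun s => rlKer α (t - s) * ‖h' s‖) (Ioo 0 t)) :
    ‖mildOp S h t - mildOp S h' t‖ₑ ≤
      ∫⁻ s in Ioo 0 t, ENNReal.ofReal (rlKer α (t - s)) * ‖h s - h' s‖ₑ := by
  rw [mildOp, mildOp, ← integral_sub (H.integrableOn_mild hh hi) (H.integrableOn_mild hh' hi')]
  refine (enorm_integral_le_lintegral_enorm _).trans (setLIntegral_mono' measurableSet_Ioo ?_)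
  intro s hs
  rw [← map_sub, ← ofReal_norm, ← ofReal_norm,
    ← ENNReal.ofReal_mul (rlKer_nonneg H.pos _)]
  exact ENNReal.ofReal_le_ofReal (H.norm_resolvent_le _ (by linarith [hs.2]))

/-- The energy inequality for the smoothed norm and a general forcing term. -/
theorem energy_le {ε : ℝ} (hε : 0 < ε) (z₀ : E) {t : ℝ} (ht : 0 < t) {η : ℝ → E}
    (hη : AEStronglyMeasurable η (volume.restrict (Ioo 0 t)))
    (hi : IntegrableOn (fun s => rlKer α (t - s) * ‖η s‖) (Ioo 0 t)) :
    smoothNorm ε (T t z₀ + mildOp S η t) ≤ smoothNorm ε z₀ + ∫ s in Ioo 0 t, rlKer α (t - s) *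
      ((smoothNorm ε (T s z₀ + mildOp S η s))⁻¹ * ⟪T s z₀ + mildOp S η s, η s⟫) := by
  have hα := H.pos
  set κ : ℝ → ℝ≥0∞ := fun s => ENNReal.ofReal (rlKer α (t - s)) with hκ
  have hκm : Measurable κ :=
    (measurable_rlKer.comp (by fun_prop : Measurable fun r : ℝ => t - r)).ennreal_ofReal
  have hκfin : ∫⁻ s in Ioo 0 t, κ s ≠ ∞ :=
    ((integrableOn_rlKer_sub hα t).mono_set
      (Ioo_subset_Ioi_self : Ioo 0 t ⊆ Ioi 0)).lintegral_lt_top.ne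
  -- Approximation in `L¹` for the weight `k(t - ·)` makes the approximate solutions converge at
  -- this particular time `t`.
  set ν := (volume.restrict (Ioo 0 t)).withDensity κ with hν
  have : IsFiniteMeasure ν := isFiniteMeasure_withDensity hκfin
  have hνint : ∀ {f : ℝ → E}, eLpNorm f 1 ν = ∫⁻ s in Ioo 0 t, κ s * ‖f s‖ₑ := by
    intro f
    rw [eLpNorm_one_eq_lintegral_enorm, hν,
      lintegral_withDensity_eq_lintegral_mul_non_measurable _ hκm
        (ae_of_all _ fun s => ENNReal.ofReal_lt_top)]
    rfl
  have hηp : MemLp η 1 ν := by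
    refine ⟨hη.mono_ac (withDensity_absolutelyContinuous _ _), ?_⟩
    rw [hνint]
    exact (integrableOn_rlKer_mul_norm_iff hα hη).1 hi
  have hae : ∀ᵐ s ∂ν, s ∈ Ioo 0 t :=
    (withDensity_absolutelyContinuous _ _).ae_le (ae_restrict_mem measurableSet_Ioo)
  choose I c u hc _hz hap using fun n : ℕ => exists_stepFun_approx ht hae ENNReal.one_ne_top le_rfl
    hηp (ε := (2⁻¹ : ℝ≥0∞) ^ n) (pow_ne_zero _ (by simp))
  set f : ℕ → ℝ → E := fun n => stepFun (I n) (c n) (u n) with hf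
  have hfm : ∀ n, StronglyMeasurable (f n) := fun n => stronglyMeasurable_stepFun _ _ _
  have hfi : ∀ n s, IntegrableOn (fun r => rlKer α (s - r) * ‖f n r‖) (Ioo 0 s) := fun n s =>
    H.integrableOn_rlKer_norm_stepFun _ _ _ s
  set d : ℕ → ℝ → ℝ≥0∞ := fun n s => ‖η s - f n s‖ₑ with hd
  have hdm : ∀ n, AEMeasurable (d n) (volume.restrict (Ioo 0 t)) := fun n =>
    (hη.sub (hfm n).aestronglyMeasurable).enorm
  have hdt : ∀ n, ∫⁻ s in Ioo 0 t, κ s * d n s ≤ 2⁻¹ ^ n := by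
    intro n
    rw [← hνint]
    exact hap n
  have hpow : Tendsto (fun n : ℕ => (2⁻¹ : ℝ≥0∞) ^ n) atTop (𝓝 0) :=
    ENNReal.tendsto_pow_atTop_nhds_zero_of_lt_one (by simp)
  have hκt : ENNReal.ofReal (rlKer α t) ≠ 0 := by
    simpa using rlKer_pos hα ht
  -- As `k(t - s) ≥ k(t) > 0`, the errors are also summable in unweighted `L¹`, which gives
  -- convergence of the approximate solutions at almost every earlier time.
  have hd1 : ∀ n, ∫⁻ s in Ioo 0 t, d n s ≤ (ENNReal.ofReal (rlKer α t))⁻¹ * 2⁻¹ ^ n := by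
    intro n
    rw [← ENNReal.div_eq_inv_mul, ENNReal.le_div_iff_mul_le (Or.inl hκt)
      (Or.inl ENNReal.ofReal_ne_top), mul_comm]
    refine le_trans ?_ (hdt n)
    rw [← lintegral_const_mul'' _ (hdm n)]
    refine setLIntegral_mono' measurableSet_Ioo fun s hs => ?_
    gcongr
    exact ENNReal.ofReal_le_ofReal
      (rlKer_antitone hα H.lt_one (by linarith [hs.2]) (by linarith [hs.1]))
  have hsum : ∑' n, ∫⁻ s in Ioo 0 t, d n s ≠ ∞ := by
    refine ne_top_of_le_ne_top ?_ (ENNReal.tsum_le_tsum hd1)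
    rw [ENNReal.tsum_mul_left, ENNReal.tsum_geometric]
    refine ENNReal.mul_ne_top (ENNReal.inv_ne_top.2 hκt) ?_
    simp
  set y : ℝ → E := fun s => T s z₀ + mildOp S η s with hy
  set yn : ℕ → ℝ → E := fun n s => stepSol T S z₀ (I n) (c n) (u n) s with hyn
  have hyn' : ∀ n s, yn n s = T s z₀ + mildOp S (f n) s := fun n s =>
    H.stepSol_eq z₀ _ _ (hc n) _ s
  have hconv : ∀ s ≤ t, IntegrableOn (fun r => rlKer α (s - r) * ‖η r‖) (Ioo 0 s) →
      Tendsto (fun n => ∫⁻ r in Ioo 0 s, ENNReal.ofReal (rlKer α (s - r)) * d n r) atTop (𝓝 0) →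
      Tendsto (fun n => yn n s) atTop (𝓝 (y s)) := by
    intro s hst hηs hlim
    rw [tendsto_iff_edist_tendsto_0]
    refine tendsto_of_tendsto_of_tendsto_of_le_of_le tendsto_const_nhds hlim
      (fun n => zero_le) fun n => ?_
    rw [edist_comm, edist_eq_enorm_sub, hyn', hy]
    simp only [add_sub_add_left_eq_sub]
    exact H.enorm_mildOp_sub_le (hη.mono_measure
      (Measure.restrict_mono (Ioo_subset_Ioo_right hst) le_rfl)) hηs
      (hfm n).aestronglyMeasurable (hfi n s)
  have hηi : IntegrableOn η (Ioo 0 t) := by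
    have h1 : IntegrableOn (fun s => rlKer α t * ‖η s‖) (Ioo 0 t) := by
      refine hi.mono' (hη.norm.const_mul _) ?_
      filter_upwards [ae_restrict_mem measurableSet_Ioo] with s hs
      rw [norm_mul, norm_norm, Real.norm_of_nonneg (rlKer_nonneg hα _)]
      exact mul_le_mul_of_nonneg_right
        (rlKer_antitone hα H.lt_one (by linarith [hs.2]) (by linarith [hs.1])) (norm_nonneg _)
    have h2 : IntegrableOn (fun s => ‖η s‖) (Ioo 0 t) := by
      refine (h1.const_mul (rlKer α t)⁻¹).congr (ae_of_all _ fun s => ?_)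
      have := (rlKer_pos hα ht).ne'
      simp only
      rw [inv_mul_cancel_left₀ this]
    exact (integrable_norm_iff hη).1 h2
  have hlim_t : Tendsto (fun n => yn n t) atTop (𝓝 (y t)) :=
    hconv t le_rfl hi (tendsto_of_tendsto_of_tendsto_of_le_of_le tendsto_const_nhds hpow
      (fun n => zero_le) hdt)
  have hlim_ae : ∀ᵐ s ∂volume.restrict (Ioo 0 t), Tendsto (fun n => yn n s) atTop (𝓝 (y s)) := by
    filter_upwards [ae_tendsto_rlConv hα t hdm hsum, ae_integrableOn_rlKer_mul_norm hα hηi,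
      ae_restrict_mem measurableSet_Ioo] with s hs hs2 hst
    exact hconv s hst.2.le hs2 hs
  have hker0 : ∀ s, 0 ≤ rlKer α (t - s) := fun s => rlKer_nonneg hα _
  have hsub : Ioo 0 t ⊆ Ici (0 : ℝ) := fun s hs => hs.1.le
  have hynm : ∀ n, AEStronglyMeasurable (yn n) (volume.restrict (Ioo 0 t)) := fun n =>
    ((H.continuousOn_stepSol z₀ _ _ _).mono hsub).aestronglyMeasurable measurableSet_Ioo
  have hφ := radialConvex_smoothNorm (E := E) hε
  have hκm' : AEStronglyMeasurable (fun s => rlKer α (t - s)) (volume.restrict (Ioo 0 t)) :=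
    (measurable_rlKer.comp (by fun_prop : Measurable fun r : ℝ => t - r)).aestronglyMeasurable
  have hFm : ∀ (n : ℕ) (h : ℝ → E), AEStronglyMeasurable h (volume.restrict (Ioo 0 t)) →
      AEStronglyMeasurable (fun s => rlKer α (t - s) * ((smoothNorm ε (yn n s))⁻¹ *
        ⟪yn n s, h s⟫)) (volume.restrict (Ioo 0 t)) := fun n h hh =>
    hκm'.mul ((hφ.continuous_grad.comp_aestronglyMeasurable (hynm n)).mul ((hynm n).inner hh))
  have hFb : ∀ (n : ℕ) (h : ℝ → E) s, ‖rlKer α (t - s) * ((smoothNorm ε (yn n s))⁻¹ *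
      ⟪yn n s, h s⟫)‖ ≤ rlKer α (t - s) * ‖h s‖ := by
    intro n h s
    rw [norm_mul, Real.norm_of_nonneg (hker0 s)]
    exact mul_le_mul_of_nonneg_left (smoothGrad_mul_inner_le hε _ _) (hker0 s)
  have hdi : ∀ n, IntegrableOn (fun s => rlKer α (t - s) * ‖f n s - η s‖) (Ioo 0 t) := by
    intro n
    refine (integrableOn_rlKer_mul_norm_iff hα ((hfm n).aestronglyMeasurable.sub hη)).2 ?_
    refine lt_of_le_of_lt ?_ ((hdt n).trans_lt (ENNReal.pow_lt_top (by simp)))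
    refine le_of_eq (lintegral_congr fun s => ?_)
    simp only [hd, hκ, Pi.sub_apply]
    rw [← edist_eq_enorm_sub, edist_comm, edist_eq_enorm_sub]
  have hlimint : Tendsto (fun n => ∫ s in Ioo 0 t, rlKer α (t - s) *
      ((smoothNorm ε (yn n s))⁻¹ * ⟪yn n s, f n s⟫)) atTop
      (𝓝 (∫ s in Ioo 0 t, rlKer α (t - s) * ((smoothNorm ε (y s))⁻¹ * ⟪y s, η s⟫))) := by
    -- The gradient of the smoothed norm has norm at most one, so replacing `f n` by `η` costs at
    -- most the weighted `L¹` error; the remaining integrals are dominated by `k(t - s) ‖η s‖`.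
    have hsplit : ∀ n, ∫ s in Ioo 0 t, rlKer α (t - s) *
        ((smoothNorm ε (yn n s))⁻¹ * ⟪yn n s, f n s⟫) =
        (∫ s in Ioo 0 t, rlKer α (t - s) * ((smoothNorm ε (yn n s))⁻¹ * ⟪yn n s, η s⟫)) +
        ∫ s in Ioo 0 t, rlKer α (t - s) *
          ((smoothNorm ε (yn n s))⁻¹ * ⟪yn n s, f n s - η s⟫) := by
      intro n
      rw [← integral_add (hi.mono' (hFm n η hη) (ae_of_all _ (hFb n η)))
        ((hdi n).mono' (hFm n (fun s => f n s - η s) ((hfm n).aestronglyMeasurable.sub hη))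
          (ae_of_all _ (hFb n fun s => f n s - η s)))]
      refine integral_congr_ae (ae_of_all _ fun s => ?_)
      simp only [inner_sub_right]
      ring
    simp only [hsplit]
    rw [← add_zero (∫ s in Ioo 0 t, rlKer α (t - s) * ((smoothNorm ε (y s))⁻¹ * ⟪y s, η s⟫))]
    refine Tendsto.add ?_ ?_
    · refine tendsto_integral_of_dominated_convergence _ (fun n => hFm n η hη) hi
        (fun n => ae_of_all _ (hFb n η)) ?_
      filter_upwards [hlim_ae] with s hs
      exact (((hφ.continuous_grad.tendsto _).comp hs).mul (hs.inner tendsto_const_nhds)).const_mul _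
    · rw [tendsto_zero_iff_enorm_tendsto_zero]
      refine tendsto_of_tendsto_of_tendsto_of_le_of_le tendsto_const_nhds hpow
        (fun n => zero_le) fun n => ?_
      refine (enorm_integral_le_lintegral_enorm _).trans (le_trans ?_ (hdt n))
      refine lintegral_mono fun s => ?_
      simp only [hκ, hd]
      rw [← ofReal_norm, ← edist_eq_enorm_sub, edist_comm, edist_eq_enorm_sub,
        ← ofReal_norm, ← ENNReal.ofReal_mul (hker0 s)]
      exact ENNReal.ofReal_le_ofReal (hFb n (fun s => f n s - η s) s)
  refine le_of_tendsto_of_tendsto' ((hφ.continuous_fun.tendsto _).comp hlim_t)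
    (hlimint.const_add _) fun n => ?_
  have h1 := H.step_energy hφ z₀ (I n) (c n) (hc n) (u n) ht
  have h2 : 0 ≤ ∫ s in Ioi 0, rlKer α (t - s) •
      ((smoothNorm ε (yn n s))⁻¹ * ‖yn n s‖ ^ 2) :=
    integral_nonneg fun s => mul_nonneg (rlKer_nonneg hα _)
      (mul_nonneg (inv_pos.2 (smoothNorm_pos hε _)).le (sq_nonneg _))
  have h3 := mul_nonneg H.mu_pos.le h2
  rw [setIntegral_rlKer t (fun s => (smoothNorm ε (stepSol T S z₀ (I n) (c n) (u n) s))⁻¹ *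
    ⟪stepSol T S z₀ (I n) (c n) (u n) s, stepFun (I n) (c n) (u n) s⟫)] at h1
  simp only [smul_eq_mul] at h1 h3
  simp only [Function.comp, hyn, hf] at h3 ⊢
  linarith

/-- Norm bound from an almost everywhere bound of the integrand in `energy_le`. -/
theorem norm_le_of_smooth_le {ε : ℝ} (hε : 0 < ε) (z₀ : E) {t : ℝ} (ht : 0 < t) {η : ℝ → E}
    {P : ℝ → ℝ} (hη : AEStronglyMeasurable η (volume.restrict (Ioo 0 t)))
    (hi : IntegrableOn (fun s => rlKer α (t - s) * ‖η s‖) (Ioo 0 t))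
    (hP : IntegrableOn (fun s => rlKer α (t - s) * P s) (Ioo 0 t)) (hP0 : ∀ s ∈ Ioo 0 t, 0 ≤ P s)
    (hle : ∀ᵐ s ∂volume.restrict (Ioo 0 t), (smoothNorm ε (T s z₀ + mildOp S η s))⁻¹ *
      ⟪T s z₀ + mildOp S η s, η s⟫ ≤ P s) :
    ‖T t z₀ + mildOp S η t‖ ≤ ε + ‖z₀‖ + ∫ s in Ioo 0 t, rlKer α (t - s) * P s := by
  have h1 := H.energy_le hε z₀ ht hη hi
  have h2 : ∫ s in Ioo 0 t, rlKer α (t - s) *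
      ((smoothNorm ε (T s z₀ + mildOp S η s))⁻¹ * ⟪T s z₀ + mildOp S η s, η s⟫) ≤
      ∫ s in Ioo 0 t, rlKer α (t - s) * P s := by
    by_cases hint : IntegrableOn (fun s => rlKer α (t - s) *
      ((smoothNorm ε (T s z₀ + mildOp S η s))⁻¹ * ⟪T s z₀ + mildOp S η s, η s⟫)) (Ioo 0 t)
    · refine integral_mono_ae hint hP ?_
      filter_upwards [hle] with s hs
      exact mul_le_mul_of_nonneg_left hs (rlKer_nonneg H.pos _)
    -- In the non-integrable case the integral has the default value zero, and the right side is
    -- nonnegative.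
    · rw [integral_undef hint]
      exact setIntegral_nonneg measurableSet_Ioo fun s hs =>
        mul_nonneg (rlKer_nonneg H.pos _) (hP0 s hs)
  have h4 := smoothNorm_le hε z₀
  have h5 := norm_le_smoothNorm ε (T t z₀ + mildOp S η t)
  linarith

/-- Norm bound for a mild solution whose forcing term satisfies `⟪y, η⟫ ≤ P ‖y‖`. -/
theorem norm_le_of_inner_le (z₀ : E) {t : ℝ} (ht : 0 < t) {η : ℝ → E} {P : ℝ → ℝ}
    (hη : AEStronglyMeasurable η (volume.restrict (Ioo 0 t)))
    (hi : IntegrableOn (fun s => rlKer α (t - s) * ‖η s‖) (Ioo 0 t))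
    (hP : IntegrableOn (fun s => rlKer α (t - s) * P s) (Ioo 0 t)) (hP0 : ∀ s ∈ Ioo 0 t, 0 ≤ P s)
    (hle : ∀ᵐ s ∂volume.restrict (Ioo 0 t),
      ⟪T s z₀ + mildOp S η s, η s⟫ ≤ P s * ‖T s z₀ + mildOp S η s‖) :
    ‖T t z₀ + mildOp S η t‖ ≤ ‖z₀‖ + ∫ s in Ioo 0 t, rlKer α (t - s) * P s := by
  refine le_of_forall_pos_le_add fun ε hε => ?_
  have := H.norm_le_of_smooth_le hε z₀ ht hη hi hP hP0 ?_
  · linarith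
  filter_upwards [hle, ae_restrict_mem measurableSet_Ioo] with s hs hst
  rw [inv_mul_le_iff₀ (smoothNorm_pos hε _), mul_comm]
  exact hs.trans (mul_le_mul_of_nonneg_left (norm_le_smoothNorm _ _) (hP0 s hst))

/-- Norm bound for a mild solution whose forcing term satisfies `⟪y, η⟫ ≤ Q`. -/
theorem norm_le_of_inner_le_const {ε : ℝ} (hε : 0 < ε) (z₀ : E) {t : ℝ} (ht : 0 < t) {η : ℝ → E}
    {Q : ℝ → ℝ} (hη : AEStronglyMeasurable η (volume.restrict (Ioo 0 t)))
    (hi : IntegrableOn (fun s => rlKer α (t - s) * ‖η s‖) (Ioo 0 t))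
    (hQ : IntegrableOn (fun s => rlKer α (t - s) * Q s) (Ioo 0 t)) (hQ0 : ∀ s ∈ Ioo 0 t, 0 ≤ Q s)
    (hle : ∀ᵐ s ∂volume.restrict (Ioo 0 t), ⟪T s z₀ + mildOp S η s, η s⟫ ≤ Q s) :
    ‖T t z₀ + mildOp S η t‖ ≤ ε + ‖z₀‖ + ε⁻¹ * ∫ s in Ioo 0 t, rlKer α (t - s) * Q s := by
  have := H.norm_le_of_smooth_le hε z₀ ht hη hi (P := fun s => ε⁻¹ * Q s)
    ((hQ.const_mul ε⁻¹).congr (ae_of_all _ fun s => by ring))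
    (fun s hs => mul_nonneg (inv_pos.2 hε).le (hQ0 s hs)) ?_
  · rw [← integral_const_mul]
    simpa only [mul_left_comm] using this
  filter_upwards [hle, ae_restrict_mem measurableSet_Ioo] with s hs hst
  refine (mul_le_mul_of_nonneg_left hs (inv_pos.2 (smoothNorm_pos hε _)).le).trans ?_
  exact mul_le_mul_of_nonneg_right (inv_anti₀ hε (le_smoothNorm ε _)) (hQ0 s hst)

end CoerciveFamily

end FracControl

end

/-! ### The convolution operator on `L²` and its strong positivity. -/

noncomputable section

namespace FracControl

variable {E : Type*} [NormedAddCommGroup E] [InnerProductSpace ℝ E]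
  {α μ a : ℝ} {A : E →ₗ.[ℝ] E} {T S : ℝ → E →L[ℝ] E} {ι : Type*}

theorem vol_eq_restrict_Ioo (a : ℝ) : vol a = volume.restrict (Ioo 0 a) :=
  Measure.restrict_congr_set Ioo_ae_eq_Icc.symm

theorem sq_lintegral_le {X : Type*} [MeasurableSpace X] (ν : Measure X) {e : X → ℝ≥0∞}
    (he : AEMeasurable e ν) : (∫⁻ x, e x ∂ν) ^ 2 ≤ ν univ * ∫⁻ x, e x ^ 2 ∂ν := by
  have h := ENNReal.lintegral_mul_le_Lp_mul_Lq ν Real.HolderConjugate.two_two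
    (aemeasurable_const (b := (1 : ℝ≥0∞))) he
  have h2 := pow_le_pow_left' h 2
  rw [mul_pow, ← ENNReal.rpow_natCast, ← ENNReal.rpow_natCast ((∫⁻ a, _ ∂ν) ^ _),
    ← ENNReal.rpow_natCast ((∫⁻ a, _ ∂ν) ^ _), ← ENNReal.rpow_mul, ← ENNReal.rpow_mul] at h2
  simpa using h2

theorem sq_rlConv_le (s : ℝ) {e : ℝ → ℝ≥0∞}
    (he : AEMeasurable e (volume.restrict (Ioo 0 s))) :
    (∫⁻ r in Ioo 0 s, ENNReal.ofReal (rlKer α (s - r)) * e r) ^ 2 ≤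
      (∫⁻ r in Ioo 0 s, ENNReal.ofReal (rlKer α (s - r))) *
        ∫⁻ r in Ioo 0 s, ENNReal.ofReal (rlKer α (s - r)) * e r ^ 2 := by
  set κ : ℝ → ℝ≥0∞ := fun r => ENNReal.ofReal (rlKer α (s - r)) with hκ
  have hκm : Measurable κ :=
    (measurable_rlKer.comp (by fun_prop : Measurable fun r : ℝ => s - r)).ennreal_ofReal
  have h := sq_lintegral_le ((volume.restrict (Ioo 0 s)).withDensity κ)
    (he.mono_ac (withDensity_absolutelyContinuous _ _))
  simp only [lintegral_withDensity_eq_lintegral_mul_non_measurable _ hκm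
        (ae_of_all _ fun s => ENNReal.ofReal_lt_top), withDensity_apply _ MeasurableSet.univ,
        Measure.restrict_univ, Pi.mul_apply] at h
  exact h

theorem lintegral_rlKer_sub_le {s t : ℝ} (hst : s ≤ t) :
    ∫⁻ r in Ioo 0 s, ENNReal.ofReal (rlKer α (s - r)) ≤
      ∫⁻ r in Ioo 0 t, ENNReal.ofReal (rlKer α r) := by
  have h1 : ∫⁻ r in Ioo 0 s, ENNReal.ofReal (rlKer α (s - r)) =
      ∫⁻ r, (Ioo 0 s).indicator (fun r => ENNReal.ofReal (rlKer α r)) (s - r) := by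
    rw [← lintegral_indicator measurableSet_Ioo]
    refine lintegral_congr fun r => ?_
    simp only [indicator_apply, mem_Ioo, sub_pos, sub_lt_self_iff, and_comm]
  rw [h1, lintegral_sub_left_eq_self (fun r => (Ioo 0 s).indicator
    (fun r => ENNReal.ofReal (rlKer α r)) r) s, lintegral_indicator measurableSet_Ioo]
  exact lintegral_mono_set (Ioo_subset_Ioo_right hst)

/-- Young's inequality in `L²`: Cauchy-Schwarz for the weighted measure in the inner integral, then
the `L¹` version applied to `e ^ 2`. -/
theorem lintegral_sq_rlConv_le (hα : 0 < α) (t : ℝ) {e : ℝ → ℝ≥0∞}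
    (he : AEMeasurable e (volume.restrict (Ioo 0 t))) :
    ∫⁻ s in Ioo 0 t, (∫⁻ r in Ioo 0 s, ENNReal.ofReal (rlKer α (s - r)) * e r) ^ 2 ≤
      (∫⁻ s in Ioo 0 t, ENNReal.ofReal (rlKer α s)) ^ 2 * ∫⁻ s in Ioo 0 t, e s ^ 2 := by
  set C := ∫⁻ s in Ioo 0 t, ENNReal.ofReal (rlKer α s) with hC
  have hCfin : C ≠ ∞ := (lintegral_rlKer_lt_top hα t).ne
  calc _ ≤ ∫⁻ s in Ioo 0 t, C * ∫⁻ r in Ioo 0 s, ENNReal.ofReal (rlKer α (s - r)) * e r ^ 2 := by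
        refine setLIntegral_mono' measurableSet_Ioo fun s hs => ?_
        refine (sq_rlConv_le s (he.mono_measure (Measure.restrict_mono
          (Ioo_subset_Ioo_right hs.2.le) le_rfl))).trans ?_
        gcongr
        exact lintegral_rlKer_sub_le hs.2.le
    _ ≤ _ := by
        rw [lintegral_const_mul' _ _ hCfin, sq, mul_assoc]
        gcongr
        exact lintegral_rlKer_conv_le t (he.pow_const 2)

theorem mildOp_congr {b t : ℝ} {h h' : ℝ → E} (hh : h =ᵐ[vol b] h') (ht : t ≤ b) :
    mildOp S h t = mildOp S h' t := by
  refine setIntegral_congr_ae₀ measurableSet_Ioo.nullMeasurableSet ?_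
  rw [vol_eq_restrict_Ioo] at hh
  have := (ae_restrict_iff' measurableSet_Ioo).1 hh
  filter_upwards [this] with s hs hst
  rw [hs ⟨hst.1, hst.2.trans_le ht⟩]

theorem _root_.MeasureTheory.MemLp.integrableOn_Ioo {h : ℝ → E} (hh : MemLp h 2 (vol a)) :
    IntegrableOn h (Ioo 0 a) := by
  have := hh.integrable (by norm_num : (1 : ℝ≥0∞) ≤ 2)
  rwa [vol_eq_restrict_Ioo] at this

namespace CoerciveFamily

variable (H : CoerciveFamily α A T S μ) [CompleteSpace E]
include H

theorem aestronglyMeasurable_mildOp {t : ℝ} {h : ℝ → E}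
    (hh : AEStronglyMeasurable h (volume.restrict (Ioo 0 t))) :
    AEStronglyMeasurable (mildOp S h) (volume.restrict (Ioo 0 t)) := by
  have h0 : AEStronglyMeasurable ((Ioo 0 t).indicator h) volume :=
    (aestronglyMeasurable_indicator_iff measurableSet_Ioo).2 hh
  have h1 : AEStronglyMeasurable (fun s => ∫ r, posOp S (s - r) ((Ioo 0 t).indicator h r))
      volume := by
    refine AEStronglyMeasurable.integral_prod_right'
      (f := fun p : ℝ × ℝ => posOp S (p.1 - p.2) ((Ioo 0 t).indicator h p.2)) ?_
    exact H.aestronglyMeasurable_posOp (by fun_prop) h0.comp_snd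
  refine h1.restrict.congr ?_
  filter_upwards [ae_restrict_mem measurableSet_Ioo] with s hs
  rw [mildOp, ← integral_indicator measurableSet_Ioo]
  refine integral_congr_ae (ae_of_all _ fun r => ?_)
  simp only
  by_cases hr : r ∈ Ioo 0 s
  · rw [indicator_of_mem hr, indicator_of_mem (show r ∈ Ioo 0 t from ⟨hr.1, hr.2.trans hs.2⟩),
      posOp, if_pos (by linarith [hr.2])]
  · rw [indicator_of_notMem hr]
    by_cases h0 : 0 < r
    · rw [posOp, if_neg (by simpa using fun h => hr ⟨h0, h⟩)]; simp
    · rw [indicator_of_notMem (fun h => h0 h.1), map_zero]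

theorem enorm_mildOp_le {t : ℝ} (h : ℝ → E) :
    ‖mildOp S h t‖ₑ ≤ ∫⁻ s in Ioo 0 t, ENNReal.ofReal (rlKer α (t - s)) * ‖h s‖ₑ := by
  rw [mildOp]
  refine (enorm_integral_le_lintegral_enorm _).trans (setLIntegral_mono' measurableSet_Ioo ?_)
  intro s hs
  rw [← ofReal_norm, ← ofReal_norm, ← ENNReal.ofReal_mul (rlKer_nonneg H.pos _)]
  exact ENNReal.ofReal_le_ofReal (H.norm_resolvent_le _ (by linarith [hs.2]))

theorem eLpNorm_mildOp_le {h : ℝ → E} (hh : AEStronglyMeasurable h (vol a)) :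
    eLpNorm (mildOp S h) 2 (vol a) ≤
      (∫⁻ s in Ioo 0 a, ENNReal.ofReal (rlKer α s)) * eLpNorm h 2 (vol a) := by
  rw [vol_eq_restrict_Ioo] at hh ⊢
  rw [← ENNReal.pow_le_pow_left_iff (n := 2) (by norm_num), mul_pow]
  have key : ∀ f : ℝ → E, eLpNorm f 2 (volume.restrict (Ioo 0 a)) ^ 2 =
      ∫⁻ s in Ioo 0 a, ‖f s‖ₑ ^ 2 := by
    intro f
    rw [eLpNorm_eq_lintegral_rpow_enorm_toReal (by norm_num) (by norm_num),
      ← ENNReal.rpow_natCast, ← ENNReal.rpow_mul]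
    simp
  rw [key, key]
  refine le_trans (lintegral_mono fun s => ?_) (lintegral_sq_rlConv_le H.pos a hh.enorm)
  exact pow_le_pow_left' (H.enorm_mildOp_le h) 2

theorem memLp_mildOp {h : ℝ → E} (hh : MemLp h 2 (vol a)) : MemLp (mildOp S h) 2 (vol a) := by
  refine ⟨?_, (H.eLpNorm_mildOp_le hh.1).trans_lt
    (ENNReal.mul_lt_top (lintegral_rlKer_lt_top H.pos a) hh.2)⟩
  have := hh.1
  rw [vol_eq_restrict_Ioo] at this ⊢
  exact H.aestronglyMeasurable_mildOp this

theorem ae_integrableOn_mild {h : ℝ → E} (hh : MemLp h 2 (vol a)) :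
    ∀ᵐ t ∂vol a, IntegrableOn (fun s => S (t - s) (h s)) (Ioo 0 t) := by
  rw [vol_eq_restrict_Ioo]
  filter_upwards [ae_integrableOn_rlKer_mul_norm H.pos hh.integrableOn_Ioo,
    ae_restrict_mem measurableSet_Ioo] with t ht hta
  exact H.integrableOn_mild (hh.integrableOn_Ioo.aestronglyMeasurable.mono_measure
    (Measure.restrict_mono (Ioo_subset_Ioo_right hta.2.le) le_rfl)) ht

end CoerciveFamily

/-- Convolution with the resolvent family as a bounded operator on `L²(J, E)`. -/
def convOp (H : CoerciveFamily α A T S μ) [CompleteSpace E] (a : ℝ) :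
    Lp E 2 (vol a) →L[ℝ] Lp E 2 (vol a) :=
  LinearMap.mkContinuous
    { toFun := fun h => (H.memLp_mildOp (Lp.memLp h)).toLp _
      map_add' := by
        intro h h'
        rw [← MemLp.toLp_add]
        refine MemLp.toLp_congr _ _ ?_
        filter_upwards [H.ae_integrableOn_mild (Lp.memLp h), H.ae_integrableOn_mild (Lp.memLp h'),
          ae_restrict_mem measurableSet_Icc] with t h1 h2 ht
        rw [Pi.add_apply, mildOp_congr (Lp.coeFn_add h h') ht.2]
        simp only [mildOp, Pi.add_apply, map_add]
        exact integral_add h1 h2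
      map_smul' := by
        intro r h
        rw [RingHom.id_apply, ← MemLp.toLp_const_smul]
        refine MemLp.toLp_congr _ _ ?_
        filter_upwards [ae_restrict_mem measurableSet_Icc] with t ht
        rw [Pi.smul_apply, mildOp_congr (Lp.coeFn_smul r h) ht.2]
        simp only [mildOp, Pi.smul_apply, map_smul]
        exact integral_smul _ _ }
    (∫⁻ s in Ioo 0 a, ENNReal.ofReal (rlKer α s)).toReal <| by
      intro h
      simp only [LinearMap.coe_mk, AddHom.coe_mk]
      rw [Lp.norm_toLp, Lp.norm_def, ← ENNReal.toReal_mul]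
      exact ENNReal.toReal_mono (ENNReal.mul_ne_top (lintegral_rlKer_lt_top H.pos a).ne
        (Lp.eLpNorm_ne_top h)) (H.eLpNorm_mildOp_le (Lp.aestronglyMeasurable h))

namespace CoerciveFamily

variable (H : CoerciveFamily α A T S μ) [CompleteSpace E]

theorem coeFn_convOp (h : Lp E 2 (vol a)) : convOp H a h =ᵐ[vol a] mildOp S h :=
  (H.memLp_mildOp (Lp.memLp h)).coeFn_toLp

include H in
/-- Positivity of the convolution operator on step functions that vanish beyond `a`. -/
theorem step_positive (I : Finset ι) (c : ι → ℝ) (hc : ∀ i ∈ I, 0 ≤ c i) (u : ι → E) (ha : 0 < a)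
    (hz : ∀ s, a < s → stepFun I c u s = 0) :
    μ * ∫ s in Ioo 0 a, ‖stepSol T S 0 I c u s‖ ^ 2 ≤
      ∫ s in Ioo 0 a, ⟪stepSol T S 0 I c u s, stepFun I c u s⟫ := by
  have hα := H.pos
  set y := stepSol T S 0 I c u with hy
  have hyc : ContinuousOn y (Ici 0) := H.continuousOn_stepSol 0 I c u
  have hbd : ∀ t : ℝ, ∃ C, ∀ s ∈ Icc 0 t, ‖y s‖ ≤ C := fun t =>
    isCompact_Icc.exists_bound_of_continuousOn (hyc.mono fun s hs => hs.1)
  have hym : ∀ t : ℝ, AEStronglyMeasurable y (volume.restrict (Ioo 0 t)) := fun t =>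
    (hyc.mono fun s hs => hs.1.le).aestronglyMeasurable measurableSet_Ioo
  have hfm : ∀ t : ℝ, AEStronglyMeasurable (stepFun I c u) (volume.restrict (Ioo 0 t)) := fun t =>
    (stronglyMeasurable_stepFun I c u).aestronglyMeasurable
  set D := ∑ i ∈ I, ‖u i‖
  have hD : ∀ s, ‖stepFun I c u s‖ ≤ D := norm_stepFun_le I c u
  -- At a time `t > a` the forcing has stopped, so the right integral ends at `a`; the left one may
  -- be cut there because its integrand is nonnegative.
  have hstep : ∀ t, a < t → μ * ∫ s in Ioo 0 a, rlKer α (t - s) * ‖y s‖ ^ 2 ≤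
      ∫ s in Ioo 0 a, rlKer α (t - s) * ⟪y s, stepFun I c u s⟫ := by
    intro t hat
    have h1 := H.step_energy radialConvex_sq 0 I c hc u (ha.trans hat)
    simp only [one_mul, smul_eq_mul] at h1
    have h2 : 0 ≤ ‖stepSol T S 0 I c u t‖ ^ 2 / 2 := by positivity
    have h3 : ∫ s in Ioo 0 a, rlKer α (t - s) * ‖y s‖ ^ 2 ≤
        ∫ s in Ioi 0, rlKer α (t - s) * ‖y s‖ ^ 2 := by
      refine setIntegral_mono_set ?_ ?_ (ae_of_all _ Ioo_subset_Ioi_self)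
      · obtain ⟨C, hC⟩ := hbd t
        refine integrableOn_rlKer_smul_of_bounded hα (f := fun s => ‖y s‖ ^ 2) (C := C ^ 2)
          ((hym t).norm.pow 2) fun s hs => ?_
        rw [norm_pow, norm_norm]
        gcongr
        exact hC s ⟨hs.1.le, hs.2.le⟩
      · exact ae_of_all _ fun s => mul_nonneg (rlKer_nonneg hα _) (sq_nonneg _)
    have h4 : ∫ s in Ioi 0, rlKer α (t - s) * ⟪y s, stepFun I c u s⟫ =
        ∫ s in Ioo 0 a, rlKer α (t - s) * ⟪y s, stepFun I c u s⟫ := by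
      rw [← integral_Ioc_eq_integral_Ioo]
      refine setIntegral_eq_of_subset_of_forall_sdiff_eq_zero measurableSet_Ioi
        Ioc_subset_Ioi_self fun s hs => ?_
      rw [hz s (not_le.1 fun h => hs.2 ⟨hs.1, h⟩), inner_zero_right, mul_zero]
    rw [h4] at h1
    have h5 := mul_le_mul_of_nonneg_left h3 H.mu_pos.le
    simp only [norm_zero] at h1
    linarith
  obtain ⟨C, hC⟩ := hbd a
  -- Dividing by `k(t)` and sending `t = 2 a + n` to infinity flattens the weight: the ratio is `(1
  -- - s / t) ^ (α - 1) → 1`, bounded by `2 ^ (1 - α)` since `s / t ≤ 1 / 2`.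
  have hlim : ∀ (w : ℝ → ℝ) (M : ℝ), AEStronglyMeasurable w (volume.restrict (Ioo 0 a)) →
      (∀ s ∈ Ioo 0 a, ‖w s‖ ≤ M) → Tendsto (fun n : ℕ => (rlKer α (2 * a + n))⁻¹ *
        ∫ s in Ioo 0 a, rlKer α (2 * a + n - s) * w s) atTop (𝓝 (∫ s in Ioo 0 a, w s)) := by
    intro w M hw hM
    have hpow : ∀ (n : ℕ), ∀ s ∈ Ioo 0 a, (rlKer α (2 * a + n))⁻¹ * rlKer α (2 * a + n - s) =
        (1 - s / (2 * a + n)) ^ (α - 1) := by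
      intro n s hs
      have hn : (0 : ℝ) ≤ n := n.cast_nonneg
      have h1 : 0 < 2 * a + n := by linarith
      have h2 : 0 < 2 * a + n - s := by linarith [hs.2]
      have hG := (Real.Gamma_pos_of_pos hα).ne'
      have hp := (Real.rpow_pos_of_pos h1 (α - 1)).ne'
      rw [rlKer_of_pos h1, rlKer_of_pos h2, one_sub_div h1.ne', Real.div_rpow h2.le h1.le]
      field_simp
    simp only [← integral_const_mul]
    refine tendsto_integral_of_dominated_convergence (fun _ => 2 ^ (1 - α) * M) (fun n => ?_)
      (integrable_const _) (fun n => ?_) ?_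
    · exact ((measurable_rlKer.comp (by fun_prop : Measurable fun s : ℝ => 2 * a + n - s)
        ).aestronglyMeasurable.mul hw).const_mul _
    · filter_upwards [ae_restrict_mem measurableSet_Ioo] with s hs
      have hn : (0 : ℝ) ≤ n := n.cast_nonneg
      have h0 : (1 : ℝ) / 2 ≤ 1 - s / (2 * a + n) := by
        have : s / (2 * a + n) ≤ 1 / 2 := by
          rw [div_le_div_iff₀ (by linarith) (by norm_num)]
          linarith [hs.2]
        linarith
      rw [← mul_assoc, hpow n s hs, norm_mul, Real.norm_of_nonneg (Real.rpow_nonneg (by linarith) _)]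
      refine mul_le_mul ?_ (hM s hs) (norm_nonneg _) (by positivity)
      refine (Real.rpow_le_rpow_of_nonpos (by norm_num) h0 (by linarith [H.lt_one])).trans ?_
      rw [one_div, Real.inv_rpow (by norm_num), ← Real.rpow_neg (by norm_num), neg_sub]
    · filter_upwards [ae_restrict_mem measurableSet_Ioo] with s hs
      simp only [← mul_assoc]
      have h1 : Tendsto (fun n : ℕ => (1 - s / (2 * a + n)) ^ (α - 1) * w s) atTop
          (𝓝 ((1 - 0) ^ (α - 1) * w s)) := by
        refine Tendsto.mul_const _ (Tendsto.rpow_const ?_ (Or.inl (by norm_num)))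
        refine tendsto_const_nhds.sub (tendsto_const_nhds.div_atTop ?_)
        exact tendsto_atTop_add_const_left _ _ tendsto_natCast_atTop_atTop
      rw [sub_zero, Real.one_rpow, one_mul] at h1
      refine h1.congr fun n => ?_
      rw [hpow n s hs]
  have l1 := (hlim (fun s => ‖y s‖ ^ 2) (C ^ 2) ((hym a).norm.pow 2) fun s hs => by
    rw [norm_pow, norm_norm]
    gcongr
    exact hC s ⟨hs.1.le, hs.2.le⟩).const_mul μ
  have l2 := hlim (fun s => ⟪y s, stepFun I c u s⟫) (C * D) ((hym a).inner (hfm a)) fun s hs => by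
    have := hC s ⟨hs.1.le, hs.2.le⟩
    exact (norm_inner_le_norm _ _).trans
      (mul_le_mul this (hD s) (norm_nonneg _) ((norm_nonneg _).trans this))
  refine le_of_tendsto_of_tendsto' l1 l2 fun n => ?_
  have hn : (0 : ℝ) ≤ n := n.cast_nonneg
  rw [mul_left_comm]
  exact mul_le_mul_of_nonneg_left (hstep _ (by linarith)) (inv_pos.2 (rlKer_pos hα (by linarith))).le

/-- Strong positivity of the convolution operator. -/
theorem convOp_positive (ha : 0 < a) (h : Lp E 2 (vol a)) :
    μ * ‖convOp H a h‖ ^ 2 ≤ ⟪convOp H a h, h⟫ := by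
  have hstep : ∀ (I : Finset (ℕ × Bool)) c u, (∀ i ∈ I, 0 ≤ c i) →
      (∀ s, a < s → stepFun I c u s = 0) → ∀ k : Lp E 2 (vol a), k =ᵐ[vol a] stepFun I c u →
      μ * ‖convOp H a k‖ ^ 2 ≤ ⟪convOp H a k, k⟫ := by
    intro I c u hc hz k hk
    have h1 : convOp H a k =ᵐ[vol a] stepSol T S 0 I c u := by
      filter_upwards [H.coeFn_convOp k, ae_restrict_mem measurableSet_Icc] with t h1 ht
      rw [h1, mildOp_congr hk ht.2, H.stepSol_eq 0 I c hc, map_zero, zero_add]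
    have h2 := H.step_positive I c hc u ha hz
    have e1 : ‖convOp H a k‖ ^ 2 = ∫ s in Ioo 0 a, ‖stepSol T S 0 I c u s‖ ^ 2 := by
      rw [← real_inner_self_eq_norm_sq, L2.inner_def, ← vol_eq_restrict_Ioo]
      refine integral_congr_ae ?_
      filter_upwards [h1] with t ht
      rw [ht, real_inner_self_eq_norm_sq]
    have e2 : ⟪convOp H a k, k⟫ =
        ∫ s in Ioo 0 a, ⟪stepSol T S 0 I c u s, stepFun I c u s⟫ := by
      rw [L2.inner_def, ← vol_eq_restrict_Ioo]
      refine integral_congr_ae ?_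
      filter_upwards [h1, hk] with t ht hk
      rw [ht, hk]
    rwa [e1, e2]
  have hclosed : IsClosed {k : Lp E 2 (vol a) | μ * ‖convOp H a k‖ ^ 2 ≤ ⟪convOp H a k, k⟫} :=
    isClosed_le (by fun_prop) (by fun_prop)
  refine hclosed.closure_subset (EMetric.mem_closure_iff.2 fun ε hε => ?_)
  have hae : ∀ᵐ s ∂vol a, s ∈ Ioo 0 a := by
    rw [vol_eq_restrict_Ioo]; exact ae_restrict_mem measurableSet_Ioo
  obtain ⟨δ, hδ, hδε⟩ := exists_between hε
  obtain ⟨I, c, u, hc, hz, hap⟩ := exists_stepFun_approx ha hae ENNReal.ofNat_ne_top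
    (by norm_num) (Lp.memLp h) hδ.ne'
  have hmem : MemLp (stepFun I c u) 2 (vol a) :=
    MemLp.of_bound (stronglyMeasurable_stepFun I c u).aestronglyMeasurable (∑ i ∈ I, ‖u i‖)
      (ae_of_all _ (norm_stepFun_le I c u))
  refine ⟨hmem.toLp _, hstep I c u hc hz _ hmem.coeFn_toLp, ?_⟩
  rw [Lp.edist_def]
  refine lt_of_le_of_lt (le_of_eq_of_le (eLpNorm_congr_ae ?_) hap) hδε
  filter_upwards [hmem.coeFn_toLp] with s hs
  simp [hs]

end CoerciveFamily

end FracControl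

end

/-! ### Monotone operators and Minty's theorem. -/

noncomputable section

namespace FracControl

section monotone

variable {H : Type*} [NormedAddCommGroup H] [InnerProductSpace ℝ H]

/-- A monotone operator that is continuous along lines at its base points. -/
structure IsMonotoneHemi (N : H → H) : Prop where
  mono : ∀ x y, 0 ≤ ⟪N x - N y, x - y⟫
  hemi : ∀ x z, Tendsto (fun t : ℝ => ⟪N (x + t • z), z⟫) (𝓝[>] 0) (𝓝 ⟪N x, z⟫)

theorem IsMonotoneHemi.add {N M : H → H} (hN : IsMonotoneHemi N) (hM : IsMonotoneHemi M) :
    IsMonotoneHemi fun x => N x + M x where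
  mono x y := by
    rw [add_sub_add_comm, inner_add_left]
    exact add_nonneg (hN.mono x y) (hM.mono x y)
  hemi x z := by
    simp only [inner_add_left]
    exact (hN.hemi x z).add (hM.hemi x z)

theorem IsMonotoneHemi.const_smul {N : H → H} (hN : IsMonotoneHemi N) {r : ℝ} (hr : 0 ≤ r) :
    IsMonotoneHemi fun x => r • N x where
  mono x y := by
    rw [← smul_sub, real_inner_smul_left]
    exact mul_nonneg hr (hN.mono x y)
  hemi x z := by
    simp only [real_inner_smul_left]
    exact (hN.hemi x z).const_mul r

theorem isMonotoneHemi_of_continuous {N : H → H} (hN : Continuous N)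
    (h : ∀ x y, 0 ≤ ⟪N x - N y, x - y⟫) : IsMonotoneHemi N where
  mono := h
  hemi x z := by
    have : Continuous fun t : ℝ => ⟪N (x + t • z), z⟫ := by fun_prop
    have := this.tendsto 0
    rw [zero_smul, add_zero] at this
    exact this.mono_left nhdsWithin_le_nhds

/-- Minty's variational characterisation. -/
theorem IsMonotoneHemi.eq_of_forall {N : H → H} (hN : IsMonotoneHemi N) {x h : H}
    (hx : ∀ y, 0 ≤ ⟪h - N y, x - y⟫) : h = N x := by
  have key : ∀ z, ⟪N x - h, z⟫ = 0 := by
    have h1 : ∀ z, 0 ≤ ⟪N x - h, z⟫ := by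
      intro z
      have h2 : Tendsto (fun t : ℝ => ⟪N (x + t • z) - h, z⟫) (𝓝[>] 0) (𝓝 ⟪N x - h, z⟫) := by
        simp only [inner_sub_left]
        exact (hN.hemi x z).sub tendsto_const_nhds
      refine ge_of_tendsto h2 ?_
      filter_upwards [self_mem_nhdsWithin] with t ht
      have h3 := hx (x + t • z)
      rw [sub_add_cancel_left, inner_neg_right, real_inner_smul_right, ← mul_neg,
        ← inner_neg_left, neg_sub] at h3
      exact nonneg_of_mul_nonneg_right h3 ht
    intro z
    have h4 := h1 (-z)
    rw [inner_neg_right] at h4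
    linarith [h1 z]
  have := key (N x - h)
  rw [inner_self_eq_zero, sub_eq_zero] at this
  exact this.symm

/-- The finite-dimensional core of Minty's theorem, a consequence of the minimax theorem. -/
theorem exists_forall_inner_nonpos {ι : Type*} [Fintype ι] [Nonempty ι] (y n : ι → H)
    (hyn : ∀ i j, 0 ≤ ⟪n i - n j, y i - y j⟫) : ∃ x, ∀ i, ⟪n i + x, x - y i⟫ ≤ 0 := by
  classical
  set L : (ι → ℝ) →ₗ[ℝ] H := Fintype.linearCombination ℝ y with hL
  have hLc : Continuous L := L.continuous_of_finiteDimensional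
  -- On the simplex `f` is convex in `a` and linear in `b`, so there is a saddle point `(a, b)`.
  -- Testing with a vertex and with `b` gives `⟪n i + L a, L a - y i⟫ ≤ f b b`, and `f b b ≤ 0`
  -- follows from monotonicity after symmetrising the double sum.
  set f : (ι → ℝ) → (ι → ℝ) → ℝ := fun a b => ∑ i, b i * ⟪n i + L a, L a - y i⟫ with hf
  have hXc : Convex ℝ (stdSimplex ℝ ι) := convex_stdSimplex ℝ ι
  have hXk : IsCompact (stdSimplex ℝ ι) := isCompact_stdSimplex ℝ ι
  have hXn : (stdSimplex ℝ ι).Nonempty :=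
    ⟨_, single_mem_stdSimplex ℝ (Classical.arbitrary ι)⟩
  have hconv : ∀ b ∈ stdSimplex ℝ ι, ConvexOn ℝ (stdSimplex ℝ ι) fun a => f a b := by
    intro b hb
    have h1 : ∀ i, ConvexOn ℝ (stdSimplex ℝ ι) fun a => ⟪n i + L a, L a - y i⟫ := by
      intro i
      have h2 : ConvexOn ℝ univ fun x : H => ‖x‖ ^ 2 :=
        (convexOn_univ_norm).pow (fun _ _ => norm_nonneg _) 2
      have h3 : ConvexOn ℝ (stdSimplex ℝ ι) fun a => ‖L a‖ ^ 2 :=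
        (h2.comp_linearMap L).subset (subset_univ _) hXc
      have h4 : ConvexOn ℝ (stdSimplex ℝ ι) fun a => ⟪n i - y i, L a⟫ :=
        (((innerₗ H (n i - y i)) ∘ₗ L).convexOn hXc)
      refine ((h3.add h4).add_const (-⟪n i, y i⟫)).congr fun a _ => ?_
      simp only [inner_sub_left, inner_sub_right, inner_add_left, real_inner_self_eq_norm_sq,
        Pi.add_apply]
      rw [real_inner_comm (L a) (y i)]
      ring
    refine ⟨hXc, fun u hu v hv r s hr hs hrs => ?_⟩
    simp only [hf, Finset.smul_sum, ← Finset.sum_add_distrib]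
    refine Finset.sum_le_sum fun i _ => ?_
    have h5 := mul_le_mul_of_nonneg_left ((h1 i).2 hu hv hr hs hrs) (hb.1 i)
    simp only [smul_eq_mul] at h5 ⊢
    linarith
  obtain ⟨a, ha, b, hb, hab⟩ := Sion.exists_isSaddlePointOn (f := f) hXn hXc hXk
    (fun b _ => (by fun_prop : Continuous fun a => f a b).lowerSemicontinuous.lowerSemicontinuousOn _)
    (fun b hb => (hconv b hb).quasiconvexOn) hXc hXn hXk
    (fun a _ => (by fun_prop : Continuous fun b => f a b).upperSemicontinuous.upperSemicontinuousOn _)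
    (fun a _ => by
      have : (fun b => f a b) = Fintype.linearCombination ℝ fun i => ⟪n i + L a, L a - y i⟫ := by
        ext b; simp [hf, Fintype.linearCombination_apply]
      rw [this]
      exact (LinearMap.concaveOn _ hXc).quasiconcaveOn)
  refine ⟨L a, fun i => ?_⟩
  have h1 := hab b hb _ (single_mem_stdSimplex ℝ i)
  have h2 : f a (Pi.single i 1) = ⟪n i + L a, L a - y i⟫ := by
    simp [hf, Pi.single_apply]
  have h3 : f b b ≤ 0 := by
    have e0 : ∑ i, b i = 1 := hb.2
    have eL : L b = ∑ j, b j • y j := by simp [hL, Fintype.linearCombination_apply]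
    have e1 : ∑ i, b i * ⟪L b, L b - y i⟫ = 0 := by
      simp only [inner_sub_right, mul_sub, Finset.sum_sub_distrib, ← Finset.sum_mul, e0, one_mul]
      nth_rewrite 2 [eL]
      rw [inner_sum]
      simp only [real_inner_smul_right, sub_self]
    have e2 : ∀ i, L b - y i = ∑ j, b j • (y j - y i) := by
      intro i
      simp only [smul_sub, Finset.sum_sub_distrib, ← Finset.sum_smul, e0, one_smul, eL]
    have e3 : f b b = ∑ i, ∑ j, b i * b j * ⟪n i, y j - y i⟫ := by
      simp only [hf, inner_add_left, mul_add, Finset.sum_add_distrib, e1, add_zero]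
      refine Finset.sum_congr rfl fun i _ => ?_
      rw [e2 i, inner_sum, Finset.mul_sum]
      refine Finset.sum_congr rfl fun j _ => ?_
      rw [real_inner_smul_right, mul_assoc]
    have e4 : f b b + f b b = ∑ i, ∑ j, b i * b j * -⟪n i - n j, y i - y j⟫ := by
      nth_rewrite 2 [e3]
      rw [Finset.sum_comm, e3, ← Finset.sum_add_distrib]
      refine Finset.sum_congr rfl fun i _ => ?_
      rw [← Finset.sum_add_distrib]
      refine Finset.sum_congr rfl fun j _ => ?_
      simp only [inner_sub_left, inner_sub_right]
      ring
    have e5 : f b b + f b b ≤ 0 := by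
      rw [e4]
      refine Finset.sum_nonpos fun i _ => Finset.sum_nonpos fun j _ => ?_
      exact mul_nonpos_of_nonneg_of_nonpos (mul_nonneg (hb.1 i) (hb.1 j)) (by linarith [hyn i j])
    linarith
  rw [h2] at h1
  exact h1.trans h3

variable [CompleteSpace H]

/-- Minty's theorem: `I + N` is onto. -/
theorem IsMonotoneHemi.exists_add_eq_zero {N : H → H} (hN : IsMonotoneHemi N) :
    ∃ x, x + N x = 0 := by
  classical
  -- Encodes `⟪N y + x, x - y⟫ ≤ 0` for the vector `x` representing `l`. The term `‖x‖²` is replaced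
  -- by all its affine minorants `2 ⟪x, z⟫ - ‖z‖²`, so that the set is visibly weak-* closed.
  set C : H → Set (WeakDual ℝ H) := fun y =>
    {l | ∀ z, 2 * l z - ‖z‖ ^ 2 + l (N y - y) - ⟪N y, y⟫ ≤ 0} with hC
  have hCc : ∀ y, IsClosed (C y) := by
    intro y
    simp only [hC, ofPred_forall]
    refine isClosed_iInter fun z => isClosed_le ?_ continuous_const
    have h1 := WeakDual.eval_continuous (𝕜 := ℝ) z
    have h2 := WeakDual.eval_continuous (𝕜 := ℝ) (N y - y)
    exact (((continuous_const.mul h1).sub continuous_const).add h2).sub continuous_const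
  have hk := WeakDual.isCompact_closedBall (𝕜 := ℝ) (E := H) 0 ‖N 0‖
  have hne := hk.inter_iInter_nonempty C hCc fun u => by
    -- The inequality at the added point `0` keeps all these finite-dimensional solutions in the
    -- ball of radius `‖N 0‖`, where weak-* compactness is available.
    have : Nonempty (insert 0 u : Finset H) := ⟨⟨0, Finset.mem_insert_self _ _⟩⟩
    obtain ⟨x, hx⟩ := exists_forall_inner_nonpos (fun i : (insert 0 u : Finset H) => (i : H))
      (fun i => N i) fun i j => hN.mono _ _
    refine ⟨StrongDual.toWeakDual (InnerProductSpace.toDual ℝ H x), ?_, ?_⟩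
    · have h0 := hx ⟨0, Finset.mem_insert_self _ _⟩
      simp only [sub_zero, inner_add_left, real_inner_self_eq_norm_sq] at h0
      have h1 : ‖x‖ ≤ ‖N 0‖ := by
        have h2 := neg_le_of_abs_le (abs_real_inner_le_norm (N 0) x)
        by_contra! h3
        nlinarith [norm_nonneg (N 0)]
      simpa using h1
    · simp only [mem_iInter]
      intro y hy z
      have h0 := hx ⟨y, Finset.mem_insert_of_mem hy⟩
      have h1 := sq_nonneg ‖x - z‖
      rw [← real_inner_self_eq_norm_sq] at h1 ⊢
      simp only [StrongDual.coe_toWeakDual, InnerProductSpace.toDual_apply_apply]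
      simp only [inner_sub_left, inner_sub_right, inner_add_left] at h0 h1 ⊢
      rw [real_inner_comm x z] at h1
      rw [real_inner_comm (N y) x]
      linarith
  obtain ⟨l, -, hl⟩ := hne
  set x := (InnerProductSpace.toDual ℝ H).symm (WeakDual.toStrongDual l) with hx
  have hlx : ∀ z, l z = ⟪x, z⟫ := fun z => by
    rw [hx, InnerProductSpace.toDual_symm_apply]; rfl
  refine ⟨x, ?_⟩
  have := hN.eq_of_forall (x := x) (h := -x) fun y => by
    have h1 := mem_iInter.1 hl y x
    rw [hlx, hlx, ← real_inner_self_eq_norm_sq] at h1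
    simp only [inner_sub_left, inner_sub_right, inner_neg_left] at h1 ⊢
    rw [real_inner_comm (N y) x] at h1
    linarith
  rw [← this, add_neg_cancel]

/-- A bounded family has a weak limit along every ultrafilter. -/
theorem exists_weak_limit {ι : Type*} (l : Ultrafilter ι) {h : ι → H} {C : ℝ}
    (hh : ∀ i, ‖h i‖ ≤ C) : ∃ k : H, ∀ z, Tendsto (fun i => ⟪h i, z⟫) l (𝓝 ⟪k, z⟫) := by
  have hk := WeakDual.isCompact_closedBall (𝕜 := ℝ) (E := H) 0 C
  obtain ⟨w, -, hw⟩ := hk.ultrafilter_le_nhds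
    (l.map fun i => StrongDual.toWeakDual (InnerProductSpace.toDual ℝ H (h i))) (by
      rw [Ultrafilter.coe_map, le_principal_iff, mem_map]
      exact Filter.univ_mem' fun i => by simpa using hh i)
  refine ⟨(InnerProductSpace.toDual ℝ H).symm (WeakDual.toStrongDual w), fun z => ?_⟩
  rw [InnerProductSpace.toDual_symm_apply]
  have h1 := ((WeakDual.eval_continuous (𝕜 := ℝ) z).tendsto w).comp hw
  exact h1

end monotone

end FracControl

end

/-! ### Hammerstein equations. -/

noncomputable section

namespace FracControl

section hammerstein

variable {H : Type*} [NormedAddCommGroup H] [InnerProductSpace ℝ H] [CompleteSpace H]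

/-- With `P = (K + ε)⁻¹`, which exists by Minty's theorem, the equation reads `P (x - q) = F x`. As
`P` is strongly monotone, `P (x - q) - δ x` is still monotone in `x`, and Minty's theorem applies
again after division by `δ`. -/
theorem exists_regularized_hammerstein {K : H →L[ℝ] H} (hK : ∀ h, 0 ≤ ⟪K h, h⟫) {F : H → H}
    (hF : IsMonotoneHemi fun x => -F x) (q : H) {ε : ℝ} (hε : 0 < ε) :
    ∃ x, x = q + K (F x) + ε • F x := by
  have hex : ∀ w, ∃ h, K h + ε • h = w := by
    intro w
    have h1 : IsMonotoneHemi fun h : H => ε⁻¹ • (K h - w) := by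
      refine isMonotoneHemi_of_continuous (by fun_prop) fun x y => ?_
      rw [← smul_sub, sub_sub_sub_cancel_right, ← map_sub, real_inner_smul_left]
      exact mul_nonneg (inv_pos.2 hε).le (hK _)
    obtain ⟨h, hh⟩ := h1.exists_add_eq_zero
    refine ⟨h, ?_⟩
    have h2 := congrArg (fun z => ε • z) hh
    simp only [smul_add, smul_inv_smul₀ hε.ne', smul_zero] at h2
    rw [← sub_eq_zero, ← h2]
    abel
  choose P hP using hex
  have hPd : ∀ w w', K (P w - P w') + ε • (P w - P w') = w - w' := by
    intro w w'
    nth_rewrite 3 [← hP w]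
    nth_rewrite 3 [← hP w']
    rw [map_sub, smul_sub]
    abel
  have hP1 : ∀ w w', ε * ‖P w - P w'‖ ^ 2 ≤ ⟪P w - P w', w - w'⟫ := by
    intro w w'
    rw [← hPd w w', inner_add_right, real_inner_smul_right, real_inner_self_eq_norm_sq,
      real_inner_comm]
    linarith [hK (P w - P w')]
  have hPc : Continuous P := by
    have h1 : LipschitzWith (Real.toNNReal ε⁻¹) P := by
      refine LipschitzWith.of_dist_le_mul fun w w' => ?_
      rw [Real.coe_toNNReal _ (inv_pos.2 hε).le, dist_eq_norm, dist_eq_norm, inv_mul_eq_div,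
        le_div_iff₀ hε]
      rcases (norm_nonneg (P w - P w')).eq_or_lt with h0 | h0
      · rw [← h0, zero_mul]; exact norm_nonneg _
      · have h2 := (hP1 w w').trans (real_inner_le_norm _ _)
        refine le_of_mul_le_mul_left ?_ h0
        linarith
    exact h1.continuous
  -- Combines `ε ‖P w - P w'‖² ≤ ⟪P w - P w', w - w'⟫` with `‖w - w'‖ ≤ (‖K‖ + ε) ‖P w - P w'‖`.
  set δ : ℝ := ε / (‖K‖ + ε) ^ 2 with hδ
  have hKε : 0 < ‖K‖ + ε := by positivity
  have hδ0 : 0 < δ := by positivity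
  have hP2 : ∀ w w', δ * ‖w - w'‖ ^ 2 ≤ ⟪P w - P w', w - w'⟫ := by
    intro w w'
    refine le_trans ?_ (hP1 w w')
    have h1 : ‖w - w'‖ ≤ (‖K‖ + ε) * ‖P w - P w'‖ := by
      rw [← hPd w w', add_mul]
      refine (norm_add_le _ _).trans (add_le_add (K.le_opNorm _) ?_)
      rw [norm_smul, Real.norm_of_nonneg hε.le]
    rw [hδ, div_mul_eq_mul_div, div_le_iff₀ (by positivity), mul_assoc]
    refine mul_le_mul_of_nonneg_left ?_ hε.le
    rw [mul_comm (‖P w - P w'‖ ^ 2), ← mul_pow]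
    exact pow_le_pow_left₀ (norm_nonneg _) h1 2
  have hN1 : IsMonotoneHemi fun x => P (x - q) - δ • x := by
    refine isMonotoneHemi_of_continuous (by fun_prop) fun x y => ?_
    have h1 := hP2 (x - q) (y - q)
    rw [sub_sub_sub_cancel_right] at h1
    rw [sub_sub_sub_comm, ← smul_sub, inner_sub_left, real_inner_smul_left,
      real_inner_self_eq_norm_sq]
    linarith
  obtain ⟨x, hx⟩ := ((hN1.add hF).const_smul (inv_pos.2 hδ0).le).exists_add_eq_zero
  have h2 : P (x - q) = F x := by
    have h3 := congrArg (fun z => δ • z) hx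
    simp only [smul_add, smul_inv_smul₀ hδ0.ne', smul_zero] at h3
    rw [← sub_eq_zero, ← h3]
    abel
  refine ⟨x, ?_⟩
  have h4 := hP (x - q)
  rw [h2] at h4
  rw [add_assoc, h4]
  abel

/-- Solvability of the Hammerstein equation `x = q + K (F x)` for a strongly positive `K` and a
negatively monotone `F` of linear growth. -/
theorem exists_hammerstein {K : H →L[ℝ] H} {μ : ℝ} (hμ : 0 < μ)
    (hK : ∀ h, μ * ‖K h‖ ^ 2 ≤ ⟪K h, h⟫) {F : H → H} (hF : IsMonotoneHemi fun x => -F x)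
    {c b : ℝ} (hb : 0 ≤ b) (hgrow : ∀ x, ‖F x‖ ≤ c + b * ‖x‖) (q : H) : ∃ x, x = q + K (F x) := by
  have hK0 : ∀ h, 0 ≤ ⟪K h, h⟫ := fun h => (mul_nonneg hμ.le (sq_nonneg _)).trans (hK h)
  have hmono : ∀ x y, ⟪F x - F y, x - y⟫ ≤ 0 := fun x y => by
    have := hF.mono x y
    rw [neg_sub_neg, ← neg_sub, inner_neg_left] at this
    linarith
  set ε : ℕ → ℝ := fun n => 1 / ((n : ℝ) + 1) with hε
  have hε0 : ∀ n, 0 < ε n := fun n => Nat.one_div_pos_of_nat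
  have hε1 : ∀ n, ε n ≤ 1 := fun n => by
    rw [hε, div_le_one (by positivity)]; linarith [n.cast_nonneg (α := ℝ)]
  have hεlim : Tendsto ε atTop (𝓝 0) := tendsto_one_div_add_atTop_nhds_zero_nat
  have hεanti : Antitone ε := fun n k h => Nat.one_div_le_one_div h
  choose x hx using fun n => exists_regularized_hammerstein hK0 hF q (hε0 n)
  set h : ℕ → H := fun n => F (x n) with hh
  have hxq : ∀ n, x n - q = K (h n) + ε n • h n := fun n => by
    nth_rewrite 1 [hx n]
    simp only [hh]
    abel
  set m := min μ 1 with hm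
  have hm0 : 0 < m := lt_min hμ one_pos
  set R := ‖F q‖
  -- Monotonicity between `x n` and `q` gives `m (p² + d²) ≤ R (p + d)` for `p = ‖K (h n)‖` and `d =
  -- ε n ‖h n‖`, using `ε n ≤ 1`; hence `p + d ≤ 2 R / m`.
  have hbound : ∀ n, ‖x n - q‖ ≤ 2 * R / m := by
    intro n
    have h1 := hmono (x n) q
    rw [inner_sub_left] at h1
    have h2 : ⟪h n, x n - q⟫ = ⟪K (h n), h n⟫ + ε n * ‖h n‖ ^ 2 := by
      rw [hxq, inner_add_right, real_inner_smul_right, real_inner_self_eq_norm_sq,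
        real_inner_comm]
    have h3 : ⟪F q, x n - q⟫ ≤ R * (‖K (h n)‖ + ε n * ‖h n‖) := by
      refine (real_inner_le_norm _ _).trans (mul_le_mul_of_nonneg_left ?_ (norm_nonneg _))
      rw [hxq]
      refine (norm_add_le _ _).trans (le_of_eq ?_)
      rw [norm_smul, Real.norm_of_nonneg (hε0 n).le]
    have h4 : ‖x n - q‖ ≤ ‖K (h n)‖ + ε n * ‖h n‖ := by
      rw [hxq]
      refine (norm_add_le _ _).trans (le_of_eq ?_)
      rw [norm_smul, Real.norm_of_nonneg (hε0 n).le]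
    refine h4.trans ?_
    have h5 := hK (h n)
    set p := ‖K (h n)‖
    have hp : 0 ≤ p := norm_nonneg _
    have h6 : (ε n * ‖h n‖) ^ 2 ≤ ε n * ‖h n‖ ^ 2 := by
      rw [mul_pow, sq (ε n)]
      refine mul_le_mul_of_nonneg_right ?_ (sq_nonneg _)
      exact mul_le_of_le_one_left (hε0 n).le (hε1 n)
    set d := ε n * ‖h n‖
    have hd : 0 ≤ d := mul_nonneg (hε0 n).le (norm_nonneg _)
    have h7 : m * p ^ 2 ≤ μ * p ^ 2 := mul_le_mul_of_nonneg_right (min_le_left _ _) (sq_nonneg _)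
    have h8 : m * d ^ 2 ≤ 1 * d ^ 2 := mul_le_mul_of_nonneg_right (min_le_right _ _) (sq_nonneg _)
    have h9 : m * (p ^ 2 + d ^ 2) ≤ R * (p + d) := by
      simp only [hh] at h2 h5 h6
      linarith
    rw [le_div_iff₀ hm0]
    by_contra! hlt
    have hpd : 0 < p + d := by
      rcases (add_nonneg hp hd).eq_or_lt with h0 | h0
      · rw [← h0, zero_mul] at hlt
        linarith [norm_nonneg (F q)]
      · exact h0
    have h10 := mul_lt_mul_of_pos_right hlt hpd
    nlinarith [mul_nonneg hm0.le (sq_nonneg (p - d))]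
  set C := c + b * (‖q‖ + 2 * R / m) with hC
  have hhC : ∀ n, ‖h n‖ ≤ C := by
    intro n
    refine (hgrow _).trans ?_
    have h1 : ‖x n‖ ≤ ‖q‖ + 2 * R / m := by
      have := norm_add_le q (x n - q)
      rw [add_sub_cancel] at this
      linarith [hbound n]
    have := mul_le_mul_of_nonneg_left h1 hb
    linarith
  have hC0 : 0 ≤ C := (norm_nonneg _).trans (hhC 0)
  -- Monotonicity bounds `⟪K (h n - h k), h n - h k⟫` by the regularisation terms alone, and strong
  -- positivity turns this into a Cauchy estimate.
  have hKd : ∀ n k N, N ≤ n → N ≤ k → dist (K (h n)) (K (h k)) ≤ √(4 * C ^ 2 * ε N / μ) := by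
    intro n k N hn hk
    refine Real.le_sqrt_of_sq_le ?_
    rw [le_div_iff₀ hμ, dist_eq_norm, ← map_sub]
    have h1 := hK (h n - h k)
    have h2 := hmono (x n) (x k)
    have h3 : x n - x k = K (h n - h k) + (ε n • h n - ε k • h k) := by
      rw [← sub_sub_sub_cancel_right (x n) (x k) q, hxq, hxq, map_sub]
      abel
    have h4 : |⟪h n - h k, ε n • h n - ε k • h k⟫| ≤ (C + C) * (ε N * C + ε N * C) := by
      refine (abs_real_inner_le_norm _ _).trans (mul_le_mul ?_ ?_ (norm_nonneg _) (by linarith))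
      · exact (norm_sub_le _ _).trans (add_le_add (hhC n) (hhC k))
      · refine (norm_sub_le _ _).trans (add_le_add ?_ ?_) <;>
          rw [norm_smul, Real.norm_of_nonneg (hε0 _).le]
        · exact mul_le_mul (hεanti hn) (hhC n) (norm_nonneg _) (hε0 N).le
        · exact mul_le_mul (hεanti hk) (hhC k) (norm_nonneg _) (hε0 N).le
    have h5 : ⟪h n - h k, x n - x k⟫ ≤ 0 := h2
    rw [h3, inner_add_right, real_inner_comm] at h5
    have h6 := neg_le_of_abs_le h4
    nlinarith
  have hlim0 : Tendsto (fun N => √(4 * C ^ 2 * ε N / μ)) atTop (𝓝 0) := by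
    have : Tendsto (fun N => √(4 * C ^ 2 * ε N / μ)) atTop (𝓝 √(4 * C ^ 2 * 0 / μ)) :=
      ((hεlim.const_mul _).div_const _).sqrt
    simpa using this
  obtain ⟨y, hy⟩ := cauchySeq_tendsto_of_complete (cauchySeq_of_le_tendsto_0 _ hKd hlim0)
  have hεh : Tendsto (fun n => ε n • h n) atTop (𝓝 0) := by
    rw [tendsto_zero_iff_norm_tendsto_zero]
    refine squeeze_zero (fun n => norm_nonneg _) (g := fun n => ε n * C) (fun n => ?_)
      (by simpa using hεlim.mul_const C)
    rw [norm_smul, Real.norm_of_nonneg (hε0 n).le]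
    exact mul_le_mul_of_nonneg_left (hhC n) (hε0 n).le
  have hxlim : Tendsto x atTop (𝓝 (q + y)) := by
    have := (hy.add hεh).const_add q
    rw [add_zero] at this
    refine this.congr fun n => ?_
    rw [← hxq, add_sub_cancel]
  -- The values `h n` are only bounded and converge weakly along `l`, but `x n` converges strongly;
  -- this pairing is enough for Minty's characterisation to identify the weak limit with `F` at the
  -- limit point.
  set l : Ultrafilter ℕ := Ultrafilter.of atTop with hl
  have hlle : (l : Filter ℕ) ≤ atTop := Ultrafilter.of_le _
  obtain ⟨k, hk⟩ := exists_weak_limit l hhC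
  have hKk : K k = y := by
    refine ext_inner_right ℝ fun z => ?_
    have h1 : Tendsto (fun n => ⟪K (h n), z⟫) l (𝓝 ⟪K k, z⟫) := by
      have := hk (ContinuousLinearMap.adjoint K z)
      simpa only [ContinuousLinearMap.adjoint_inner_right] using this
    exact tendsto_nhds_unique h1 ((hy.mono_left hlle).inner tendsto_const_nhds)
  have hkx : -k = -F (q + y) := by
    refine hF.eq_of_forall fun z => ?_
    have h0 : Tendsto (fun n => ⟪h n, x n - (q + y)⟫) l (𝓝 0) := by
      rw [tendsto_zero_iff_norm_tendsto_zero]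
      have h1 : Tendsto (fun n => C * ‖x n - (q + y)‖) l (𝓝 0) := by
        have := (tendsto_iff_norm_sub_tendsto_zero.1 (hxlim.mono_left hlle)).const_mul C
        rwa [mul_zero] at this
      refine squeeze_zero (fun n => norm_nonneg _) (fun n => ?_) h1
      exact (norm_inner_le_norm _ _).trans
        (mul_le_mul_of_nonneg_right (hhC n) (norm_nonneg _))
    have h1 : Tendsto (fun n => ⟪-h n - -F z, x n - z⟫) l (𝓝 ⟪-k - -F z, q + y - z⟫) := by
      have h2 : Tendsto (fun n => ⟪F z, x n - z⟫) l (𝓝 ⟪F z, q + y - z⟫) :=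
        tendsto_const_nhds.inner ((hxlim.mono_left hlle).sub_const z)
      have h3 := ((h0.add (hk (q + y - z))).neg).add h2
      convert h3 using 2
      · simp only [inner_sub_left, inner_sub_right, inner_neg_left, inner_add_right]
        ring
      · simp only [inner_sub_left, inner_neg_left]
        ring
    exact ge_of_tendsto' h1 fun n => hF.mono (x n) z
  refine ⟨q + y, ?_⟩
  rw [← neg_inj.1 hkx, hKk]

end hammerstein

end FracControl

end

/-! ### The Nemytskii operator and solvability for a fixed initial value. -/

noncomputable section

namespace FracControl

variable {E : Type*} [NormedAddCommGroup E] [InnerProductSpace ℝ E]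
  {α μ a : ℝ} {A : E →ₗ.[ℝ] E} {T S : ℝ → E →L[ℝ] E}

/-- The hypotheses on the nonlinearity: Carathéodory, linear growth, negatively monotone. -/
structure Nonlinearity (a : ℝ) (f : ℝ → E → E) (p : ℝ → ℝ) (b : ℝ) : Prop where
  caratheodory : IsCaratheodory a f
  memLp : MemLp p 2 (vol a)
  nonneg : 0 ≤ b
  growth : ∀ t ∈ Icc 0 a, ∀ x, ‖f t x‖ ≤ p t + b * ‖x‖
  mono : ∀ t ∈ Icc 0 a, ∀ x y, ⟪f t x - f t y, x - y⟫ ≤ 0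

omit [InnerProductSpace ℝ E] in
theorem IsCaratheodory.aestronglyMeasurable_comp {f : ℝ → E → E} (hf : IsCaratheodory a f)
    {x : ℝ → E} (hx : AEStronglyMeasurable x (vol a)) :
    AEStronglyMeasurable (fun t => f t (x t)) (vol a) := by
  have hs : ∀ s : SimpleFunc ℝ E, AEStronglyMeasurable (fun t => f t (s t)) (vol a) := by
    intro s
    have h1 : (fun t => f t (s t)) =
        fun t => ∑ y ∈ s.range, (s ⁻¹' {y}).indicator (fun t => f t y) t := by
      ext t
      rw [Finset.sum_eq_single (s t)]
      · simp
      · intro y _ hy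
        exact indicator_of_notMem (fun h => hy (by simpa using h.symm)) _
      · intro h; exact absurd (s.mem_range_self t) h
    rw [h1]
    exact Finset.aestronglyMeasurable_fun_sum _ fun y _ =>
      (hf.1 y).indicator (s.measurableSet_preimage _)
  have hm := hx.stronglyMeasurable_mk
  refine aestronglyMeasurable_of_tendsto_ae atTop (fun n => hs (hm.approx n)) ?_
  filter_upwards [hf.2, hx.ae_eq_mk] with t ht hxt
  rw [hxt]
  exact (ht.tendsto _).comp (hm.tendsto_approx t)

/-- The forcing term `w(s) + f(s, x(s))`. -/
def forcing (f : ℝ → E → E) (w x : ℝ → E) (s : ℝ) : E := w s + f s (x s)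

namespace Nonlinearity

variable {f : ℝ → E → E} {p : ℝ → ℝ} {b : ℝ} (hf : Nonlinearity a f p b)
include hf

theorem p_nonneg {t : ℝ} (ht : t ∈ Icc 0 a) : 0 ≤ p t := by
  have := hf.growth t ht 0
  rw [norm_zero, mul_zero, add_zero] at this
  exact (norm_nonneg _).trans this

/-- Monotonicity against the zero state removes the growth constant `b`, so the a priori bounds need
no Gronwall argument. -/
theorem inner_le {t : ℝ} (ht : t ∈ Icc 0 a) (x : E) : ⟪x, f t x⟫ ≤ p t * ‖x‖ := by
  have h1 := hf.mono t ht x 0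
  rw [sub_zero, inner_sub_left, real_inner_comm] at h1
  have h2 := (real_inner_le_norm (f t 0) x).trans
    (mul_le_mul_of_nonneg_right (hf.growth t ht 0) (norm_nonneg _))
  rw [norm_zero, mul_zero, add_zero] at h2
  linarith

theorem memLp_comp {x : ℝ → E} (hx : MemLp x 2 (vol a)) :
    MemLp (fun t => f t (x t)) 2 (vol a) := by
  refine (hf.memLp.add (hx.norm.const_mul b)).mono'
    (hf.caratheodory.aestronglyMeasurable_comp hx.1) ?_
  filter_upwards [ae_restrict_mem measurableSet_Icc] with t ht
  exact hf.growth t ht _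

theorem memLp_forcing {w x : ℝ → E} (hw : MemLp w 2 (vol a)) (hx : MemLp x 2 (vol a)) :
    MemLp (forcing f w x) 2 (vol a) := hw.add (hf.memLp_comp hx)

/-- The Nemytskii operator of `f` on `L²`. -/
def nemytskii (x : Lp E 2 (vol a)) : Lp E 2 (vol a) := (hf.memLp_comp (Lp.memLp x)).toLp _

theorem coeFn_nemytskii (x : Lp E 2 (vol a)) :
    hf.nemytskii x =ᵐ[vol a] fun t => f t (x t) := MemLp.coeFn_toLp _

theorem norm_nemytskii_le (x : Lp E 2 (vol a)) :
    ‖hf.nemytskii x‖ ≤ ‖hf.memLp.toLp p‖ + b * ‖x‖ := by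
  have hn : ‖(Lp.memLp x).norm.toLp _‖ = ‖x‖ := by
    rw [Lp.norm_toLp, eLpNorm_norm, Lp.norm_def]
  have h1 : ‖hf.nemytskii x‖ ≤ ‖hf.memLp.toLp p + b • (Lp.memLp x).norm.toLp _‖ := by
    refine Lp.norm_le_norm_of_ae_le ?_
    filter_upwards [hf.coeFn_nemytskii x, hf.memLp.coeFn_toLp, (Lp.memLp x).norm.coeFn_toLp,
      Lp.coeFn_add (hf.memLp.toLp p) (b • (Lp.memLp x).norm.toLp _),
      Lp.coeFn_smul b ((Lp.memLp x).norm.toLp _), ae_restrict_mem measurableSet_Icc]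
      with t h1 h2 h3 h4 h5 ht
    rw [h1, h4, Pi.add_apply, h5, h2, Pi.smul_apply, h3, smul_eq_mul]
    exact (hf.growth t ht _).trans (le_abs_self _)
  refine h1.trans ((norm_add_le _ _).trans ?_)
  rw [norm_smul, hn, Real.norm_of_nonneg hf.nonneg]

theorem isMonotoneHemi : IsMonotoneHemi fun x => -hf.nemytskii x where
  mono x y := by
    rw [neg_sub_neg, ← neg_sub, inner_neg_left, L2.inner_def, ← integral_neg]
    refine integral_nonneg_of_ae ?_
    filter_upwards [hf.coeFn_nemytskii x, hf.coeFn_nemytskii y, Lp.coeFn_sub x y,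
      Lp.coeFn_sub (hf.nemytskii x) (hf.nemytskii y), ae_restrict_mem measurableSet_Icc]
      with t h1 h2 h3 h4 ht
    rw [h3, h4, Pi.sub_apply, Pi.sub_apply, h1, h2]
    simpa using hf.mono t ht (x t) (y t)
  hemi x z := by
    simp only [inner_neg_left]
    refine Tendsto.neg ?_
    simp only [L2.inner_def]
    have hval : ∀ r : ℝ, ∀ᵐ t ∂vol a, hf.nemytskii (x + r • z) t = f t (x t + r • z t) := by
      intro r
      filter_upwards [hf.coeFn_nemytskii (x + r • z), Lp.coeFn_add x (r • z), Lp.coeFn_smul r z]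
        with t h1 h2 h3
      rw [h1, h2, Pi.add_apply, h3, Pi.smul_apply]
    have hm : ∀ r : ℝ, AEStronglyMeasurable (fun t => ⟪f t (x t + r • z t), z t⟫) (vol a) :=
      fun r => (hf.caratheodory.aestronglyMeasurable_comp ((Lp.aestronglyMeasurable x).add
        ((Lp.aestronglyMeasurable z).const_smul r))).inner (Lp.aestronglyMeasurable z)
    have key : Tendsto (fun r : ℝ => ∫ t, ⟪f t (x t + r • z t), z t⟫ ∂vol a) (𝓝[>] 0)
        (𝓝 (∫ t, ⟪f t (x t), z t⟫ ∂vol a)) := by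
      refine tendsto_integral_filter_of_dominated_convergence
        (fun t => (p t + b * (‖x t‖ + ‖z t‖)) * ‖z t‖) (Filter.Eventually.of_forall hm) ?_ ?_ ?_
      · filter_upwards [Ioo_mem_nhdsGT (zero_lt_one' ℝ)] with r hr
        filter_upwards [ae_restrict_mem measurableSet_Icc] with t ht
        refine (norm_inner_le_norm _ _).trans (mul_le_mul_of_nonneg_right ?_ (norm_nonneg _))
        refine (hf.growth t ht _).trans ?_
        gcongr
        · exact hf.nonneg
        · refine (norm_add_le _ _).trans ?_
          gcongr
          rw [norm_smul, Real.norm_of_nonneg hr.1.le]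
          exact mul_le_of_le_one_left (norm_nonneg _) hr.2.le
      · have h1 : MemLp (fun t => p t + b * (‖x t‖ + ‖z t‖)) 2 (vol a) :=
          hf.memLp.add (((Lp.memLp x).norm.add (Lp.memLp z).norm).const_mul b)
        exact h1.integrable_mul (Lp.memLp z).norm
      · filter_upwards [hf.caratheodory.2] with t h2
        have h3 : Continuous fun r : ℝ => ⟪f t (x t + r • z t), z t⟫ := by fun_prop
        have h4 := h3.tendsto 0
        rw [zero_smul, add_zero] at h4
        exact h4.mono_left nhdsWithin_le_nhds
    have e0 : ∫ t, ⟪hf.nemytskii x t, z t⟫ ∂vol a = ∫ t, ⟪f t (x t), z t⟫ ∂vol a := by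
      refine integral_congr_ae ?_
      filter_upwards [hf.coeFn_nemytskii x] with t h1
      rw [h1]
    rw [e0]
    refine key.congr fun r => integral_congr_ae ?_
    filter_upwards [hval r] with t h1
    rw [h1]

end Nonlinearity

theorem CoerciveFamily.memLp_solution (H : CoerciveFamily α A T S μ) (z₀ : E) :
    MemLp (fun t => T t z₀) 2 (vol a) := by
  have hc : ContinuousOn (fun t => T t z₀) (Icc 0 a) :=
    (H.solution.strongly_continuous z₀).mono fun t ht => ht.1
  obtain ⟨C, hC⟩ := isCompact_Icc.exists_bound_of_continuousOn hc
  exact MemLp.of_bound (hc.aestronglyMeasurable measurableSet_Icc) C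
    ((ae_restrict_iff' measurableSet_Icc).2 (ae_of_all _ hC))

/-- Existence of an `L²` solution of the integral equation with given initial value. -/
theorem Nonlinearity.exists_solution [CompleteSpace E] {f : ℝ → E → E} {p : ℝ → ℝ} {b : ℝ}
    (hf : Nonlinearity a f p b) (H : CoerciveFamily α A T S μ) (ha : 0 < a) {w : ℝ → E}
    (hw : MemLp w 2 (vol a)) (z₀ : E) :
    ∃ x : Lp E 2 (vol a), x =ᵐ[vol a] fun t => T t z₀ + mildOp S (forcing f w x) t := by
  set F : Lp E 2 (vol a) → Lp E 2 (vol a) := fun x => hw.toLp w + hf.nemytskii x with hF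
  have h1 : IsMonotoneHemi fun x => -F x := by
    have h2 : IsMonotoneHemi fun _ : Lp E 2 (vol a) => -hw.toLp w :=
      isMonotoneHemi_of_continuous continuous_const fun x y => by simp
    simpa only [hF, neg_add] using h2.add hf.isMonotoneHemi
  obtain ⟨x, hx⟩ := exists_hammerstein H.mu_pos (H.convOp_positive ha) h1
    (c := ‖hw.toLp w‖ + ‖hf.memLp.toLp p‖) hf.nonneg (fun x => by
      rw [add_assoc]
      exact (norm_add_le _ _).trans (by gcongr; exact hf.norm_nemytskii_le x))
    ((H.memLp_solution z₀).toLp _)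
  refine ⟨x, ?_⟩
  have hFx : F x =ᵐ[vol a] forcing f w x := by
    filter_upwards [Lp.coeFn_add (hw.toLp w) (hf.nemytskii x), hw.coeFn_toLp,
      hf.coeFn_nemytskii x] with t h1 h2 h3
    rw [hF, h1, Pi.add_apply, h2, h3, forcing]
  have hx' : x =ᵐ[vol a] ((H.memLp_solution z₀).toLp _ + convOp H a (F x) : Lp E 2 (vol a)) := by
    rw [← hx]
  filter_upwards [hx', Lp.coeFn_add ((H.memLp_solution z₀).toLp _) (convOp H a (F x)),
    H.coeFn_convOp (F x), (H.memLp_solution z₀).coeFn_toLp, ae_restrict_mem measurableSet_Icc]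
    with t h1 h2 h3 h4 ht
  rw [h1, h2, Pi.add_apply, h3, h4, mildOp_congr hFx ht.2]

end FracControl

end

/-! ### Iterated fractional integrals. -/

noncomputable section

namespace FracControl

variable {E : Type*} [NormedAddCommGroup E] [InnerProductSpace ℝ E]
  {α μ a : ℝ} {A : E →ₗ.[ℝ] E} {T S : ℝ → E →L[ℝ] E}

/-- One of `s` and `t - s` is at least `t / 2`, where the decreasing kernel is at most `k(t / 2) = 2
^ (1 - α) k(t)`. -/
theorem rlKer_mul_rlKer_le (hα : 0 < α) (hα₁ : α < 1) {t s : ℝ} (hs : s ∈ Ioo 0 t) :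
    rlKer α (t - s) * rlKer α s ≤ 2 ^ (1 - α) * rlKer α t * (rlKer α (t - s) + rlKer α s) := by
  have ht : 0 < t := hs.1.trans hs.2
  have h0 : rlKer α (t / 2) = 2 ^ (1 - α) * rlKer α t := by
    rw [rlKer_of_pos ht, rlKer_of_pos (by positivity), Real.div_rpow ht.le (by norm_num),
      ← neg_sub α 1, Real.rpow_neg (by norm_num)]
    ring
  rw [← h0]
  have n1 := rlKer_nonneg hα (t - s)
  have n2 := rlKer_nonneg hα s
  have n3 := rlKer_nonneg hα (t / 2)
  rcases le_total s (t / 2) with h | h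
  · have h1 := rlKer_antitone hα hα₁ (by linarith) (by linarith : t / 2 ≤ t - s)
    nlinarith [mul_le_mul_of_nonneg_right h1 n2, mul_nonneg n3 n1]
  · have h1 := rlKer_antitone hα hα₁ (by linarith) h
    nlinarith [mul_le_mul_of_nonneg_left h1 n1, mul_nonneg n3 n2]

/-- The fractional integral of a nonnegative function. -/
def rlConv (α : ℝ) (e : ℝ → ℝ≥0∞) (t : ℝ) : ℝ≥0∞ :=
  ∫⁻ s in Ioo 0 t, ENNReal.ofReal (rlKer α (t - s)) * e s

theorem measurable_ofReal_rlKer : Measurable fun s => ENNReal.ofReal (rlKer α s) :=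
  measurable_rlKer.ennreal_ofReal

theorem rlConv_eq_lintegral (e : ℝ → ℝ≥0∞) (t : ℝ) :
    rlConv α e t = ∫⁻ s, ENNReal.ofReal (rlKer α (t - s)) * (Ioi 0).indicator e s := by
  rw [rlConv, ← lintegral_indicator measurableSet_Ioo]
  refine lintegral_congr fun s => ?_
  by_cases h0 : 0 < s
  · by_cases h1 : s < t
    · simp [h0, h1]
    · rw [indicator_of_notMem (fun h => h1 h.2), rlKer_of_nonpos (by linarith)]; simp
  · rw [indicator_of_notMem (fun h => h0 h.1), indicator_of_notMem (show s ∉ Ioi 0 from h0), mul_zero]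

theorem lintegral_rlKer_sub_eq (t : ℝ) :
    ∫⁻ r in Ioo 0 t, ENNReal.ofReal (rlKer α (t - r)) =
      ∫⁻ r in Ioo 0 t, ENNReal.ofReal (rlKer α r) := by
  rw [← lintegral_indicator measurableSet_Ioo, ← lintegral_indicator measurableSet_Ioo,
    ← lintegral_sub_left_eq_self _ t]
  refine lintegral_congr fun r => ?_
  simp only [indicator_apply, mem_Ioo, sub_pos, sub_lt_self_iff, and_comm, sub_sub_cancel]

theorem lintegral_rlKer_mul_rlKer_le (hα : 0 < α) (hα₁ : α < 1) {t b : ℝ} (htb : t ≤ b) :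
    ∫⁻ s, ENNReal.ofReal (rlKer α (t - s)) * ENNReal.ofReal (rlKer α s) ≤
      ENNReal.ofReal (2 ^ (1 - α)) * (2 * ∫⁻ s in Ioo 0 b, ENNReal.ofReal (rlKer α s)) *
        ENNReal.ofReal (rlKer α t) := by
  have e1 : ∫⁻ s, ENNReal.ofReal (rlKer α (t - s)) * ENNReal.ofReal (rlKer α s) =
      ∫⁻ s in Ioo 0 t, ENNReal.ofReal (rlKer α (t - s)) * ENNReal.ofReal (rlKer α s) := by
    rw [← lintegral_indicator measurableSet_Ioo]
    refine lintegral_congr fun s => ?_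
    by_cases hs : s ∈ Ioo 0 t
    · rw [indicator_of_mem hs]
    · rw [indicator_of_notMem hs]
      by_cases h0 : 0 < s
      · rw [rlKer_of_nonpos (sub_nonpos.2 (not_lt.1 fun h => hs ⟨h0, h⟩))]; simp
      · rw [rlKer_of_nonpos (not_lt.1 h0)]; simp
  rw [e1]
  calc _ ≤ ∫⁻ s in Ioo 0 t, ENNReal.ofReal (2 ^ (1 - α)) * ENNReal.ofReal (rlKer α t) *
        (ENNReal.ofReal (rlKer α (t - s)) + ENNReal.ofReal (rlKer α s)) := by
        refine setLIntegral_mono' measurableSet_Ioo fun s hs => ?_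
        rw [← ENNReal.ofReal_mul (rlKer_nonneg hα _), ← ENNReal.ofReal_mul (by positivity),
          ← ENNReal.ofReal_add (rlKer_nonneg hα _) (rlKer_nonneg hα _),
          ← ENNReal.ofReal_mul (mul_nonneg (by positivity) (rlKer_nonneg hα _))]
        exact ENNReal.ofReal_le_ofReal (rlKer_mul_rlKer_le hα hα₁ hs)
    _ ≤ _ := by
        rw [lintegral_const_mul' _ _ (ENNReal.mul_ne_top ENNReal.ofReal_ne_top
          ENNReal.ofReal_ne_top), lintegral_add_right _ measurable_ofReal_rlKer, lintegral_rlKer_sub_eq, ← two_mul,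
          mul_right_comm]
        gcongr

/-- Integrating the previous product bound gives `k * k ≤ C k`. Hence a double fractional integral
at `t` is controlled by the single one at the same time, also at an exceptional time such as a node.
-/
theorem rlConv_rlConv_le (hα : 0 < α) (hα₁ : α < 1) {t b : ℝ} (htb : t ≤ b) {e : ℝ → ℝ≥0∞}
    (he : AEMeasurable e (volume.restrict (Ioo 0 t))) :
    rlConv α (rlConv α e) t ≤ ENNReal.ofReal (2 ^ (1 - α)) *
      (2 * ∫⁻ s in Ioo 0 b, ENNReal.ofReal (rlKer α s)) * rlConv α e t := by
  set M := ENNReal.ofReal (2 ^ (1 - α)) * (2 * ∫⁻ s in Ioo 0 b, ENNReal.ofReal (rlKer α s))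
  set κ : ℝ → ℝ≥0∞ := fun s => ENNReal.ofReal (rlKer α s) with hκ
  have hκm : Measurable κ := measurable_ofReal_rlKer
  set e' : ℝ → ℝ≥0∞ := (Ioo 0 t).indicator e with he'
  have hem : AEMeasurable e' := (aemeasurable_indicator_iff measurableSet_Ioo).2 he
  have hsub : ∀ s ≤ t, rlConv α e s = ∫⁻ r, κ (s - r) * e' r := by
    intro s hs
    rw [rlConv_eq_lintegral]
    refine lintegral_congr fun r => ?_
    by_cases h0 : 0 < r
    · by_cases h1 : r < t
      · rw [he', indicator_of_mem (show r ∈ Ioi 0 from h0),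
          indicator_of_mem (show r ∈ Ioo 0 t from ⟨h0, h1⟩)]
      · simp only [hκ]
        rw [rlKer_of_nonpos (by linarith)]; simp
    · rw [he', indicator_of_notMem (show r ∉ Ioi 0 from h0),
        indicator_of_notMem (fun h => h0 h.1)]
  have h1 : rlConv α (rlConv α e) t ≤ ∫⁻ s, κ (t - s) * ∫⁻ r, κ (s - r) * e' r := by
    rw [rlConv]
    refine (setLIntegral_mono' measurableSet_Ioo fun s hs => ?_).trans (setLIntegral_le_lintegral _ _)
    rw [hsub s hs.2.le]
  refine h1.trans ?_
  have h2 : ∀ s, κ (t - s) * ∫⁻ r, κ (s - r) * e' r = ∫⁻ r, κ (t - s) * (κ (s - r) * e' r) :=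
    fun s => (lintegral_const_mul' _ _ ENNReal.ofReal_ne_top).symm
  simp only [h2]
  rw [lintegral_lintegral_swap]
  · rw [hsub t le_rfl, ← lintegral_const_mul'']
    · refine lintegral_mono fun r => ?_
      have h3 : ∫⁻ s, κ (t - s) * (κ (s - r) * e' r) = (∫⁻ s, κ (t - r - s) * κ s) * e' r := by
        rw [← lintegral_mul_const'' _ (by fun_prop),
          ← lintegral_sub_right_eq_self (fun s => κ (t - r - s) * κ s * e' r) r]
        refine lintegral_congr fun s => ?_
        simp only [sub_sub_sub_cancel_right, mul_assoc]
      rw [h3, ← mul_assoc]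
      by_cases hr : r ∈ Ioo 0 t
      · gcongr
        exact lintegral_rlKer_mul_rlKer_le hα hα₁ (by linarith [hr.1])
      · rw [he', indicator_of_notMem hr]; simp
    · exact (by fun_prop : AEMeasurable fun r => κ (t - r)).mul hem
  · refine AEMeasurable.mul ?_ (AEMeasurable.mul ?_ hem.comp_snd)
    · exact (hκm.comp (by fun_prop : Measurable fun p : ℝ × ℝ => t - p.1)).aemeasurable
    · exact (hκm.comp (by fun_prop : Measurable fun p : ℝ × ℝ => p.1 - p.2)).aemeasurable

end FracControl

end

/-! ### A priori bounds and dependence on the initial value. -/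

noncomputable section

namespace FracControl

variable {E : Type*} [NormedAddCommGroup E] [InnerProductSpace ℝ E]
  {α μ a : ℝ} {A : E →ₗ.[ℝ] E} {T S : ℝ → E →L[ℝ] E}

theorem aemeasurable_restrict_Ioo {β : Type*} [MeasurableSpace β] {e : ℝ → β}
    (he : AEMeasurable e (vol a)) {t : ℝ} (ht : t ≤ a) :
    AEMeasurable e (volume.restrict (Ioo 0 t)) := by
  rw [vol_eq_restrict_Ioo] at he
  exact he.mono_measure (Measure.restrict_mono (Ioo_subset_Ioo_right ht) le_rfl)

omit [InnerProductSpace ℝ E] in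
theorem aestronglyMeasurable_restrict_Ioo {e : ℝ → E}
    (he : AEStronglyMeasurable e (vol a)) {t : ℝ} (ht : t ≤ a) :
    AEStronglyMeasurable e (volume.restrict (Ioo 0 t)) := by
  rw [vol_eq_restrict_Ioo] at he
  exact he.mono_measure (Measure.restrict_mono (Ioo_subset_Ioo_right ht) le_rfl)

theorem ae_restrict_Ioo {P : ℝ → Prop} (h : ∀ᵐ s ∂vol a, P s) {t : ℝ} (ht : t ≤ a) :
    ∀ᵐ s ∂volume.restrict (Ioo 0 t), P s := by
  rw [vol_eq_restrict_Ioo] at h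
  exact ae_mono (Measure.restrict_mono (Ioo_subset_Ioo_right ht) le_rfl) h

theorem rlConv_mono_ae {e e' : ℝ → ℝ≥0∞} {t : ℝ}
    (h : ∀ᵐ s ∂volume.restrict (Ioo 0 t), e s ≤ e' s) : rlConv α e t ≤ rlConv α e' t := by
  refine lintegral_mono_ae ?_
  filter_upwards [h] with s hs
  gcongr

theorem rlConv_add {e e' : ℝ → ℝ≥0∞} {t : ℝ} (he : AEMeasurable e (volume.restrict (Ioo 0 t))) :
    rlConv α (fun s => e s + e' s) t = rlConv α e t + rlConv α e' t := by
  simp only [rlConv, mul_add]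
  exact lintegral_add_left' ((measurable_ofReal_rlKer.comp
    (by fun_prop : Measurable fun s : ℝ => t - s)).aemeasurable.mul he) _

theorem rlConv_const_mul {c : ℝ≥0∞} (hc : c ≠ ∞) (e : ℝ → ℝ≥0∞) (t : ℝ) :
    rlConv α (fun s => c * e s) t = c * rlConv α e t := by
  simp only [rlConv, mul_left_comm _ c]
  exact lintegral_const_mul' _ _ hc

theorem rlConv_const_lt_top (hα : 0 < α) {c : ℝ≥0∞} (hc : c ≠ ∞) (t : ℝ) :
    rlConv α (fun _ => c) t < ∞ := by
  rw [rlConv, lintegral_mul_const' _ _ hc, lintegral_rlKer_sub_eq]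
  exact ENNReal.mul_lt_top (lintegral_rlKer_lt_top hα t) hc.lt_top

theorem integrableOn_rlKer_mul (hα : 0 < α) {t : ℝ} {P : ℝ → ℝ}
    (hP : AEMeasurable P (volume.restrict (Ioo 0 t))) (hP0 : ∀ s ∈ Ioo 0 t, 0 ≤ P s)
    (hfin : rlConv α (fun s => ENNReal.ofReal (P s)) t < ∞) :
    IntegrableOn (fun s => rlKer α (t - s) * P s) (Ioo 0 t) ∧
      ∫ s in Ioo 0 t, rlKer α (t - s) * P s =
        (rlConv α (fun s => ENNReal.ofReal (P s)) t).toReal := by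
  have h1 := (integrableOn_rlKer_mul_norm_iff hα hP.aestronglyMeasurable).2 (by
    refine lt_of_le_of_lt (le_of_eq (setLIntegral_congr_fun measurableSet_Ioo fun s hs => ?_)) hfin
    simp only
    rw [Real.enorm_of_nonneg (hP0 s hs)])
  have h2 : IntegrableOn (fun s => rlKer α (t - s) * P s) (Ioo 0 t) :=
    h1.congr_fun (fun s hs => by simp only [Real.norm_of_nonneg (hP0 s hs)]) measurableSet_Ioo
  refine ⟨h2, ?_⟩
  rw [integral_eq_lintegral_of_nonneg_ae _ h2.aestronglyMeasurable]
  · congr 1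
    exact setLIntegral_congr_fun measurableSet_Ioo fun s hs =>
      ENNReal.ofReal_mul (rlKer_nonneg hα _)
  · filter_upwards [ae_restrict_mem measurableSet_Ioo] with s hs
    exact mul_nonneg (rlKer_nonneg hα _) (hP0 s hs)

/-- `x` solves the integral equation with initial value `z₀` and inhomogeneity `w`. -/
structure IsSolution (a : ℝ) (T S : ℝ → E →L[ℝ] E) (f : ℝ → E → E) (w : ℝ → E) (z₀ : E)
    (x : ℝ → E) : Prop where
  memLp : MemLp x 2 (vol a)
  eq : x =ᵐ[vol a] fun t => T t z₀ + mildOp S (forcing f w x) t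

/-- The value at `t` of the continuous representative of a solution. -/
def solVal (T S : ℝ → E →L[ℝ] E) (f : ℝ → E → E) (w : ℝ → E) (z₀ : E) (x : ℝ → E) (t : ℝ) : E :=
  T t z₀ + mildOp S (forcing f w x) t

/-- A pointwise majorant of the forcing term of a solution. -/
def majorant (α : ℝ) (p : ℝ → ℝ) (b R Z s : ℝ) : ℝ≥0∞ :=
  ENNReal.ofReal (p s + R) + ENNReal.ofReal b *
    (ENNReal.ofReal Z + rlConv α (fun r => ENNReal.ofReal (p r + R)) s)

/-- The times at which the fractional integral of `p` exists. -/
def IsGoodTime (α a : ℝ) (p : ℝ → ℝ) (t : ℝ) : Prop :=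
  t ∈ Icc 0 a ∧ rlConv α (fun s => ENNReal.ofReal (p s)) t < ∞

section bounds

variable {f : ℝ → E → E} {p : ℝ → ℝ} {b R Z : ℝ} (hf : Nonlinearity a f p b)
include hf

theorem Nonlinearity.aemeasurable_p : AEMeasurable p (vol a) :=
  hf.memLp.1.aemeasurable

theorem Nonlinearity.aemeasurable_P {t : ℝ} (ht : t ≤ a) :
    AEMeasurable (fun s => ENNReal.ofReal (p s + R)) (volume.restrict (Ioo 0 t)) :=
  ((aemeasurable_restrict_Ioo hf.aemeasurable_p ht).add_const R).ennreal_ofReal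

theorem Nonlinearity.rlConv_P_lt_top (hα : 0 < α) {t : ℝ} (ht : IsGoodTime α a p t) :
    rlConv α (fun s => ENNReal.ofReal (p s + R)) t < ∞ := by
  have h1 : rlConv α (fun s => ENNReal.ofReal (p s + R)) t ≤
      rlConv α (fun s => ENNReal.ofReal (p s) + ENNReal.ofReal R) t :=
    rlConv_mono_ae (ae_of_all _ fun s => ENNReal.ofReal_add_le)
  refine h1.trans_lt ?_
  rw [rlConv_add (aemeasurable_restrict_Ioo hf.aemeasurable_p ht.1.2).ennreal_ofReal]
  exact ENNReal.add_lt_top.2 ⟨ht.2, rlConv_const_lt_top hα ENNReal.ofReal_ne_top t⟩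

theorem Nonlinearity.ae_isGoodTime (hα : 0 < α) : ∀ᵐ t ∂vol a, IsGoodTime α a p t := by
  have h1 : ∫⁻ s in Ioo 0 a, ENNReal.ofReal (p s) ≠ ∞ :=
    hf.memLp.integrableOn_Ioo.lintegral_lt_top.ne
  have h2 := ae_rlConv_lt_top hα a
    (aemeasurable_restrict_Ioo hf.aemeasurable_p le_rfl).ennreal_ofReal h1
  rw [← vol_eq_restrict_Ioo] at h2
  filter_upwards [h2, ae_restrict_mem measurableSet_Icc] with t ht hta
  exact ⟨hta, ht⟩

theorem Nonlinearity.aemeasurable_majorant {t : ℝ} (ht : t ≤ a) :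
    AEMeasurable (majorant α p b R Z) (volume.restrict (Ioo 0 t)) :=
  (hf.aemeasurable_P ht).add (((aemeasurable_rlConv t (hf.aemeasurable_P ht)).const_add _).const_mul _)

/-- The majorant already contains a fractional integral; `rlConv_rlConv_le` absorbs the second one.
-/
theorem Nonlinearity.rlConv_majorant_lt_top (hα : 0 < α) (hα₁ : α < 1) {t : ℝ}
    (ht : IsGoodTime α a p t) : rlConv α (majorant α p b R Z) t < ∞ := by
  have h1 := hf.rlConv_P_lt_top (R := R) hα ht
  change rlConv α (fun s => ENNReal.ofReal (p s + R) + ENNReal.ofReal b *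
    (ENNReal.ofReal Z + rlConv α (fun r => ENNReal.ofReal (p r + R)) s)) t < ∞
  rw [rlConv_add (hf.aemeasurable_P ht.1.2), rlConv_const_mul ENNReal.ofReal_ne_top,
    rlConv_add aemeasurable_const]
  refine ENNReal.add_lt_top.2 ⟨h1, ENNReal.mul_lt_top ENNReal.ofReal_lt_top
    (ENNReal.add_lt_top.2 ⟨rlConv_const_lt_top hα ENNReal.ofReal_ne_top t, ?_⟩)⟩
  refine (rlConv_rlConv_le hα hα₁ le_rfl (hf.aemeasurable_P ht.1.2)).trans_lt ?_
  exact ENNReal.mul_lt_top (ENNReal.mul_lt_top ENNReal.ofReal_lt_top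
    (ENNReal.mul_lt_top (by simp) (lintegral_rlKer_lt_top hα t))) h1

variable [CompleteSpace E] (H : CoerciveFamily α A T S μ) {w : ℝ → E} (hw : MemLp w 2 (vol a))
include H hw

/-- First half of a bootstrap: the bound under the extra assumption that the fractional integral of
the forcing exists at `t`, which is so far known only almost everywhere. -/
theorem Nonlinearity.norm_solVal_le_of_integrableOn (hR : 0 ≤ R) (hwR : ∀ᵐ s ∂vol a, ‖w s‖ ≤ R)
    {z₀ : E} {x : ℝ → E} (hx : IsSolution a T S f w z₀ x) {t : ℝ} (ht0 : 0 < t)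
    (ht : IsGoodTime α a p t)
    (hi : IntegrableOn (fun s => rlKer α (t - s) * ‖forcing f w x s‖) (Ioo 0 t)) :
    ‖solVal T S f w z₀ x t‖ ≤
      ‖z₀‖ + (rlConv α (fun s => ENNReal.ofReal (p s + R)) t).toReal := by
  have hta := ht.1.2
  have hsub : ∀ s ∈ Ioo 0 t, s ∈ Icc 0 a := fun s hs => ⟨hs.1.le, hs.2.le.trans hta⟩
  have hP0 : ∀ s ∈ Ioo 0 t, 0 ≤ p s + R := fun s hs =>
    add_nonneg (hf.p_nonneg (hsub s hs)) hR
  obtain ⟨h1, h2⟩ := integrableOn_rlKer_mul H.pos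
    ((aemeasurable_restrict_Ioo hf.aemeasurable_p hta).add_const R) hP0
    (hf.rlConv_P_lt_top (R := R) H.pos ht)
  rw [← h2]
  refine H.norm_le_of_inner_le z₀ ht0
    (aestronglyMeasurable_restrict_Ioo (hf.memLp_forcing hw hx.memLp).1 hta) hi h1 hP0 ?_
  filter_upwards [ae_restrict_Ioo hx.eq hta, ae_restrict_Ioo hwR hta,
    ae_restrict_mem measurableSet_Ioo] with s h3 h4 hs
  rw [← h3, forcing, inner_add_right]
  have h5 := hf.inner_le (hsub s hs) (x s)
  have h6 := (real_inner_le_norm (x s) (w s)).trans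
    (mul_le_mul_of_nonneg_left h4 (norm_nonneg _))
  linarith

theorem Nonlinearity.ae_integrableOn_forcing {x : ℝ → E} (hx : MemLp x 2 (vol a)) :
    ∀ᵐ t ∂vol a, IntegrableOn (fun s => rlKer α (t - s) * ‖forcing f w x s‖) (Ioo 0 t) := by
  rw [vol_eq_restrict_Ioo]
  exact ae_integrableOn_rlKer_mul_norm H.pos (hf.memLp_forcing hw hx).integrableOn_Ioo

/-- Inserting the conditional bound, valid at almost every time, into the growth condition yields a
majorant that depends on the solution only through the bounds `R` and `Z`. -/
theorem Nonlinearity.ae_enorm_forcing_le (hR : 0 ≤ R) (hwR : ∀ᵐ s ∂vol a, ‖w s‖ ≤ R)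
    {z₀ : E} (hZ : ‖z₀‖ ≤ Z) {x : ℝ → E} (hx : IsSolution a T S f w z₀ x) :
    ∀ᵐ s ∂vol a, ‖forcing f w x s‖ₑ ≤ majorant α p b R Z s := by
  have hpos : ∀ᵐ s ∂vol a, 0 < s := by
    rw [vol_eq_restrict_Ioo]
    filter_upwards [ae_restrict_mem measurableSet_Ioo] with s hs using hs.1
  filter_upwards [hf.ae_integrableOn_forcing H hw hx.memLp, hf.ae_isGoodTime H.pos, hx.eq, hwR,
    hpos] with s h1 h2 h3 h4 h0
  have h5 := hf.norm_solVal_le_of_integrableOn H hw hR hwR hx h0 h2 h1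
  have h6 := (hf.rlConv_P_lt_top (R := R) H.pos h2).ne
  rw [solVal, ← h3] at h5
  have h7 : ‖forcing f w x s‖ ≤ (p s + R) + b * (Z +
      (rlConv α (fun r => ENNReal.ofReal (p r + R)) s).toReal) := by
    have h8 := hf.growth s h2.1 (x s)
    have h9 := mul_le_mul_of_nonneg_left (h5.trans (add_le_add_left hZ _)) hf.nonneg
    have h10 := norm_add_le (w s) (f s (x s))
    rw [forcing]
    linarith
  have hZ0 : 0 ≤ Z := (norm_nonneg _).trans hZ
  rw [← ofReal_norm]
  refine (ENNReal.ofReal_le_ofReal h7).trans (le_of_eq ?_)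
  rw [majorant, ENNReal.ofReal_add (add_nonneg (hf.p_nonneg h2.1) hR)
    (mul_nonneg hf.nonneg (by positivity)), ENNReal.ofReal_mul hf.nonneg,
    ENNReal.ofReal_add hZ0 ENNReal.toReal_nonneg, ENNReal.ofReal_toReal h6]

/-- End of the bootstrap: the majorant has a finite fractional integral at every good time, so the
integrability assumption can be removed there. -/
theorem Nonlinearity.integrableOn_forcing (hR : 0 ≤ R) (hwR : ∀ᵐ s ∂vol a, ‖w s‖ ≤ R)
    {z₀ : E} {x : ℝ → E} (hx : IsSolution a T S f w z₀ x) {t : ℝ} (ht : IsGoodTime α a p t) :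
    IntegrableOn (fun s => rlKer α (t - s) * ‖forcing f w x s‖) (Ioo 0 t) := by
  rw [integrableOn_rlKer_mul_norm_iff H.pos
    (aestronglyMeasurable_restrict_Ioo (hf.memLp_forcing hw hx.memLp).1 ht.1.2)]
  refine lt_of_le_of_lt ?_ (hf.rlConv_majorant_lt_top (R := R) (Z := ‖z₀‖) H.pos H.lt_one ht)
  exact rlConv_mono_ae (ae_restrict_Ioo (hf.ae_enorm_forcing_le H hw hR hwR le_rfl hx) ht.1.2)

theorem Nonlinearity.norm_solVal_le (hR : 0 ≤ R) (hwR : ∀ᵐ s ∂vol a, ‖w s‖ ≤ R)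
    {z₀ : E} {x : ℝ → E} (hx : IsSolution a T S f w z₀ x) {t : ℝ} (ht : IsGoodTime α a p t) :
    ‖solVal T S f w z₀ x t‖ ≤
      ‖z₀‖ + (rlConv α (fun s => ENNReal.ofReal (p s + R)) t).toReal := by
  rcases ht.1.1.eq_or_lt with rfl | h0
  · simp [solVal, mildOp, rlConv, H.solution.map_zero]
  · exact hf.norm_solVal_le_of_integrableOn H hw hR hwR hx h0 ht
      (hf.integrableOn_forcing H hw hR hwR hx ht)

/-- Solutions for the same inhomogeneity depend nonexpansively on the initial value. -/
theorem Nonlinearity.norm_solVal_sub_le (hR : 0 ≤ R) (hwR : ∀ᵐ s ∂vol a, ‖w s‖ ≤ R)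
    {z₀ z₁ : E} {x x' : ℝ → E} (hx : IsSolution a T S f w z₀ x) (hx' : IsSolution a T S f w z₁ x')
    {t : ℝ} (ht : IsGoodTime α a p t) :
    ‖solVal T S f w z₀ x t - solVal T S f w z₁ x' t‖ ≤ ‖z₀ - z₁‖ := by
  rcases ht.1.1.eq_or_lt with rfl | h0
  · simp [solVal, mildOp, H.solution.map_zero]
  have hta := ht.1.2
  set h := forcing f w x with hh
  set h' := forcing f w x' with hh'
  have hm := (hf.memLp_forcing hw hx.memLp).1
  have hm' := (hf.memLp_forcing hw hx'.memLp).1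
  have hsubval : ∀ s ≤ a, IntegrableOn (fun r => rlKer α (s - r) * ‖h r‖) (Ioo 0 s) →
      IntegrableOn (fun r => rlKer α (s - r) * ‖h' r‖) (Ioo 0 s) →
      T s (z₀ - z₁) + mildOp S (fun r => h r - h' r) s =
        (T s z₀ + mildOp S h s) - (T s z₁ + mildOp S h' s) := by
    intro s hs h1 h2
    have h3 : mildOp S (fun r => h r - h' r) s = mildOp S h s - mildOp S h' s := by
      simp only [mildOp, map_sub]
      exact integral_sub (H.integrableOn_mild (aestronglyMeasurable_restrict_Ioo hm hs) h1)
        (H.integrableOn_mild (aestronglyMeasurable_restrict_Ioo hm' hs) h2)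
    rw [h3, map_sub]
    abel
  have hi := hf.integrableOn_forcing H hw hR hwR hx ht
  have hi' := hf.integrableOn_forcing H hw hR hwR hx' ht
  have hid : IntegrableOn (fun s => rlKer α (t - s) * ‖h s - h' s‖) (Ioo 0 t) := by
    refine (hi.add hi').mono' ?_ (ae_of_all _ fun s => ?_)
    · exact (measurable_rlKer.comp
        (by fun_prop : Measurable fun r : ℝ => t - r)).aestronglyMeasurable.mul
        (aestronglyMeasurable_restrict_Ioo (hm.sub hm') hta).norm
    · rw [norm_mul, norm_norm, Real.norm_of_nonneg (rlKer_nonneg H.pos _), Pi.add_apply,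
        ← mul_add]
      exact mul_le_mul_of_nonneg_left (norm_sub_le _ _) (rlKer_nonneg H.pos _)
  -- The difference of the forcing terms pairs nonpositively with the difference of the states, so
  -- `P = 0` is allowed and the Lipschitz constant is one.
  have key := H.norm_le_of_inner_le (z₀ - z₁) h0 (η := fun s => h s - h' s) (P := fun _ => 0)
    (aestronglyMeasurable_restrict_Ioo (hm.sub hm') hta) hid (by simp) (fun _ _ => le_rfl) ?_
  · rw [hsubval t hta hi hi'] at key
    simpa [solVal] using key
  · filter_upwards [ae_restrict_Ioo hx.eq hta, ae_restrict_Ioo hx'.eq hta,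
      ae_restrict_Ioo (hf.ae_integrableOn_forcing H hw hx.memLp) hta,
      ae_restrict_Ioo (hf.ae_integrableOn_forcing H hw hx'.memLp) hta,
      ae_restrict_mem measurableSet_Ioo] with s h1 h2 h3 h4 hs
    rw [hsubval s (hs.2.le.trans hta) h3 h4, ← h1, ← h2, zero_mul, real_inner_comm]
    simpa [hh, hh', forcing] using
      hf.mono s ⟨hs.1.le, hs.2.le.trans hta⟩ (x s) (x' s)

end bounds

end FracControl

end

/-! ### The nonlocal condition. -/

noncomputable section

namespace FracControl

variable {E U : Type*} [NormedAddCommGroup E] [InnerProductSpace ℝ E]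
  [NormedAddCommGroup U] [InnerProductSpace ℝ U]
  {α μ a : ℝ} {A : E →ₗ.[ℝ] E} {T S : ℝ → E →L[ℝ] E} {m : ℕ} {c τ : Fin m → ℝ}

theorem enorm_le_iSup_enorm (T : ℝ → E →L[ℝ] E) {t : ℝ} (ht : 0 ≤ t) :
    ‖T t‖ₑ ≤ ⨆ s : ℝ≥0, ‖T s‖ₑ := le_iSup (fun s : ℝ≥0 => ‖T s‖ₑ) ⟨t, ht⟩

theorem isUnit_one_sub_nodes [CompleteSpace E] (hτ : ∀ k, 0 ≤ τ k)
    (hc : (⨆ t : ℝ≥0, ‖T t‖ₑ) * ∑ k, ‖c k‖ₑ < 1) :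
    IsUnit (1 - ∑ k, c k • T (τ k)) := by
  refine isUnit_one_sub_of_norm_lt_one ?_
  have h1 : ‖∑ k, c k • T (τ k)‖ₑ < 1 := by
    refine lt_of_le_of_lt ?_ hc
    rw [Finset.mul_sum, ← ofReal_norm]
    refine (ENNReal.ofReal_le_ofReal (norm_sum_le _ _)).trans ?_
    rw [ENNReal.ofReal_sum_of_nonneg fun _ _ => norm_nonneg _]
    refine Finset.sum_le_sum fun k _ => ?_
    rw [ofReal_norm]
    rw [enorm_smul, mul_comm]
    gcongr
    exact enorm_le_iSup_enorm T (hτ k)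
  rw [← ofReal_norm] at h1
  exact ENNReal.ofReal_lt_one.1 h1

/-- On a nontrivial space `T 0 = 1` makes the supremum of the norms at least one, so `γ = ∑ |cₖ| <
1` works; on the trivial space `γ = 0` does. -/
theorem exists_contraction_const (h0 : T 0 = 1) (hc : (⨆ t : ℝ≥0, ‖T t‖ₑ) * ∑ k, ‖c k‖ₑ < 1) :
    ∃ γ : ℝ, 0 ≤ γ ∧ γ < 1 ∧ ∀ (y : Fin m → E) (D : ℝ), 0 ≤ D → (∀ k, ‖y k‖ ≤ D) →
      ‖∑ k, c k • y k‖ ≤ γ * D := by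
  rcases subsingleton_or_nontrivial E with hE | hE
  · refine ⟨0, le_rfl, one_pos, fun y D _ _ => ?_⟩
    rw [Subsingleton.elim (∑ k, c k • y k) 0]
    simp
  have h1 : (1 : ℝ≥0∞) ≤ ⨆ t : ℝ≥0, ‖T t‖ₑ := by
    refine le_trans ?_ (enorm_le_iSup_enorm T le_rfl)
    rw [h0, ← ofReal_norm, norm_one, ENNReal.ofReal_one]
  have h2 : ∑ k, ‖c k‖ₑ < 1 := lt_of_le_of_lt (le_mul_of_one_le_left' h1) hc
  have h3 : ∑ k, ‖c k‖ₑ = ENNReal.ofReal (∑ k, ‖c k‖) := by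
    rw [ENNReal.ofReal_sum_of_nonneg fun _ _ => norm_nonneg _]
    simp only [ofReal_norm]
  rw [h3, ENNReal.ofReal_lt_one] at h2
  refine ⟨∑ k, ‖c k‖, by positivity, h2, fun y D hD hy => ?_⟩
  rw [Finset.sum_mul]
  refine norm_sum_le_of_le _ fun k _ => ?_
  rw [norm_smul]
  exact mul_le_mul_of_nonneg_left (hy k) (norm_nonneg _)

theorem nonlocalInverse_eq_iff (hu : IsUnit (1 - ∑ k, c k • T (τ k))) (z w : E) :
    z = nonlocalInverse T c τ w ↔ z = ∑ k, c k • T (τ k) z + w := by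
  have h1 := Ring.mul_inverse_cancel _ hu
  have h2 := Ring.inverse_mul_cancel _ hu
  have e : ∀ z, (1 - ∑ k, c k • T (τ k)) z = z - ∑ k, c k • T (τ k) z := fun z => by
    simp [sum_apply]
  constructor
  · rintro h
    have h3 := congrArg (fun L : E →L[ℝ] E => L w) h1
    simp only [mul_apply_eq_comp, one_apply_eq_self] at h3
    rw [nonlocalInverse] at h
    rw [← h, e] at h3
    rw [← h3]
    abel
  · intro h
    have h3 := congrArg (fun L : E →L[ℝ] E => L z) h2
    simp only [mul_apply_eq_comp, one_apply_eq_self] at h3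
    rw [e] at h3
    rw [nonlocalInverse, ← h3]
    congr 1
    rw [sub_eq_iff_eq_add']
    exact h

variable [CompleteSpace E]

/-- The Green formula is variation of constants with initial value `(I - ∑ cₖ T(τₖ))⁻¹ ∑ cₖ (S *
h)(τₖ)`. -/
theorem integral_green (hτ : ∀ k, τ k ∈ Icc 0 a) {h : ℝ → E} {t : ℝ} (ht : t ∈ Icc 0 a)
    (hk : ∀ k, IntegrableOn (fun s => S (τ k - s) (h s)) (Ioo 0 (τ k)))
    (hi : IntegrableOn (fun s => S (t - s) (h s)) (Ioo 0 t)) :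
    Integrable (fun s => green T S c τ t s (h s)) (vol a) ∧
      ∫ s, green T S c τ t s (h s) ∂(vol a) =
        T t (nonlocalInverse T c τ (∑ k, c k • mildOp S h (τ k))) + mildOp S h t := by
  have hcut : ∀ b ∈ Icc 0 a, IntegrableOn (fun s => S (b - s) (h s)) (Ioo 0 b) →
      Integrable (fun s => (if s < b then (1 : ℝ) else 0) • S (b - s) (h s)) (vol a) ∧
      ∫ s, (if s < b then (1 : ℝ) else 0) • S (b - s) (h s) ∂(vol a) = mildOp S h b := by
    intro b hb hbi
    have e : ∀ᵐ s ∂vol a, (Ioo 0 b).indicator (fun s => S (b - s) (h s)) s =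
        (if s < b then (1 : ℝ) else 0) • S (b - s) (h s) := by
      rw [vol_eq_restrict_Ioo]
      filter_upwards [ae_restrict_mem measurableSet_Ioo] with s hs
      by_cases hsb : s < b
      · rw [indicator_of_mem (show s ∈ Ioo 0 b from ⟨hs.1, hsb⟩), if_pos hsb, one_smul]
      · rw [indicator_of_notMem (fun h => hsb h.2), if_neg hsb, zero_smul]
    have hsub : Ioo 0 b ∩ Icc 0 a = Ioo 0 b :=
      inter_eq_left.2 fun s hs => ⟨hs.1.le, hs.2.le.trans hb.2⟩
    refine ⟨Integrable.congr ?_ e, ?_⟩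
    · exact (hbi.integrable_indicator measurableSet_Ioo).mono_measure Measure.restrict_le_self
    · rw [← integral_congr_ae e, integral_indicator measurableSet_Ioo,
        Measure.restrict_restrict measurableSet_Ioo, hsub]
      rfl
  obtain ⟨g1, g2⟩ := hcut t ht hi
  have e : (fun s => green T S c τ t s (h s)) = fun s =>
      (T t * nonlocalInverse T c τ) (∑ k, c k • ((if s < τ k then (1 : ℝ) else 0) •
        S (τ k - s) (h s))) + (if s < t then (1 : ℝ) else 0) • S (t - s) (h s) := by
    ext s
    simp only [green, add_apply, sum_apply,
      smul_apply, mul_apply_eq_comp, map_sum, map_smul]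
    congr 1
    refine Finset.sum_congr rfl fun k _ => ?_
    split_ifs <;> simp
  have hterm : ∀ k, Integrable (fun s => c k • ((if s < τ k then (1 : ℝ) else 0) •
      S (τ k - s) (h s))) (vol a) := fun k => ((hcut _ (hτ k) (hk k)).1).smul (c k)
  have hsumi : Integrable (fun s => ∑ k, c k • ((if s < τ k then (1 : ℝ) else 0) •
      S (τ k - s) (h s))) (vol a) :=
    integrable_finsetSum _ fun k _ => hterm k
  rw [e]
  refine ⟨((T t * nonlocalInverse T c τ).integrable_comp hsumi).add g1, ?_⟩
  rw [integral_add ((T t * nonlocalInverse T c τ).integrable_comp hsumi) g1, g2,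
    ContinuousLinearMap.integral_comp_comm _ hsumi,
    integral_finsetSum _ fun k _ => hterm k]
  simp only [integral_smul, (hcut _ (hτ _) (hk _)).2]
  rfl

theorem isGoodTime_node {p : ℝ → ℝ} (hα : 0 < α) (hτ : ∀ k, τ k ∈ Icc 0 a)
    (hp_nodes : ∀ k, IntegrableOn (fun s => (τ k - s) ^ (α - 1) * p s) (Ioo 0 (τ k))) (k : Fin m) :
    IsGoodTime α a p (τ k) := by
  refine ⟨hτ k, lt_of_le_of_lt (le_of_eq ?_)
    ((hp_nodes k).const_mul (Real.Gamma α)⁻¹).lintegral_lt_top⟩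
  refine setLIntegral_congr_fun measurableSet_Ioo fun s hs => ?_
  have h1 : 0 < τ k - s := by linarith [hs.2]
  simp only
  rw [← ENNReal.ofReal_mul (rlKer_nonneg hα _), rlKer_of_pos h1]
  congr 1
  ring

variable {f : ℝ → E → E} {p : ℝ → ℝ} {b R : ℝ}

/-- Replaces the Green formula by an initial value problem together with a fixed point condition at
the nodes. In the backward direction the node integrals exist because the nodes are good times. -/
theorem Nonlinearity.isMildSolution_iff (hf : Nonlinearity a f p b) (H : CoerciveFamily α A T S μ)
    (hτ : ∀ k, τ k ∈ Icc 0 a) (hg : ∀ k, IsGoodTime α a p (τ k))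
    (hu : IsUnit (1 - ∑ k, c k • T (τ k))) (hR : 0 ≤ R) (B : U →L[ℝ] E) {v : Lp U 2 (vol a)}
    (hvR : ∀ᵐ s ∂vol a, ‖B (v s)‖ ≤ R) (x : Lp E 2 (vol a)) :
    IsMildSolution a T S c τ B f v x ↔ ∃ z₀, IsSolution a T S f (fun s => B (v s)) z₀ x ∧
      z₀ = ∑ k, c k • solVal T S f (fun s => B (v s)) z₀ x (τ k) := by
  set w : ℝ → E := fun s => B (v s) with hw
  have hwp : MemLp w 2 (vol a) := B.comp_memLp' (Lp.memLp v)
  have hhp := hf.memLp_forcing hwp (Lp.memLp x)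
  have hnode : ∀ z₀, z₀ = nonlocalInverse T c τ (∑ k, c k • mildOp S (forcing f w x) (τ k)) ↔
      z₀ = ∑ k, c k • solVal T S f w z₀ x (τ k) := by
    intro z₀
    rw [nonlocalInverse_eq_iff hu]
    simp only [solVal, smul_add, Finset.sum_add_distrib]
  have hgr : (∀ k, IntegrableOn (fun s => S (τ k - s) (forcing f w x s)) (Ioo 0 (τ k))) →
      ∀ᵐ t ∂vol a, Integrable (fun s => green T S c τ t s (forcing f w x s)) (vol a) ∧
      ∫ s, green T S c τ t s (forcing f w x s) ∂(vol a) =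
        T t (nonlocalInverse T c τ (∑ k, c k • mildOp S (forcing f w x) (τ k))) +
          mildOp S (forcing f w x) t := by
    intro hk
    filter_upwards [H.ae_integrableOn_mild hhp, ae_restrict_mem measurableSet_Icc] with t h1 ht
    exact integral_green hτ ht hk h1
  constructor
  · rintro ⟨hk, hx⟩
    refine ⟨nonlocalInverse T c τ (∑ k, c k • mildOp S (forcing f w x) (τ k)),
      ⟨Lp.memLp x, ?_⟩, (hnode _).1 rfl⟩
    filter_upwards [hx, hgr hk] with t h1 h2
    rw [h1.2]
    exact h2.2
  · rintro ⟨z₀, hx, hz⟩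
    have hk : ∀ k, IntegrableOn (fun s => S (τ k - s) (forcing f w x s)) (Ioo 0 (τ k)) :=
      fun k => H.integrableOn_mild (aestronglyMeasurable_restrict_Ioo hhp.1 (hτ k).2)
        (hf.integrableOn_forcing H hwp hR hvR hx (hg k))
    refine ⟨hk, ?_⟩
    have hz' := (hnode z₀).2 hz
    filter_upwards [hx.eq, hgr hk] with t h1 h2
    refine ⟨h2.1, ?_⟩
    rw [h1, hz']
    exact h2.2.symm

/-- Existence of a solution of the nonlocal problem. -/
theorem Nonlinearity.exists_nonlocal_solution (hf : Nonlinearity a f p b)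
    (H : CoerciveFamily α A T S μ) (ha : 0 < a) (hg : ∀ k, IsGoodTime α a p (τ k))
    (hc : (⨆ t : ℝ≥0, ‖T t‖ₑ) * ∑ k, ‖c k‖ₑ < 1) (hR : 0 ≤ R) {w : ℝ → E}
    (hw : MemLp w 2 (vol a)) (hwR : ∀ᵐ s ∂vol a, ‖w s‖ ≤ R) :
    ∃ (x : Lp E 2 (vol a)) (z₀ : E), IsSolution a T S f w z₀ x ∧
      z₀ = ∑ k, c k • solVal T S f w z₀ x (τ k) := by
  obtain ⟨γ, hγ0, hγ1, hγ⟩ := exists_contraction_const H.solution.map_zero hc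
  choose x hx using hf.exists_solution H ha hw
  have hx' : ∀ z, IsSolution a T S f w z (x z) := fun z => ⟨Lp.memLp _, hx z⟩
  -- Node values depend nonexpansively on `z`, whichever solution `x z` is chosen, so the map
  -- contracts by `γ`.
  have hcon : ContractingWith ⟨γ, hγ0⟩ fun z => ∑ k, c k • solVal T S f w z (x z) (τ k) := by
    refine ⟨by exact_mod_cast hγ1, LipschitzWith.of_dist_le_mul fun z z' => ?_⟩
    rw [dist_eq_norm, dist_eq_norm, ← Finset.sum_sub_distrib]
    simp only [← smul_sub]
    exact hγ _ _ (norm_nonneg _) fun k =>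
      hf.norm_solVal_sub_le H hw hR hwR (hx' z) (hx' z') (hg k)
  exact ⟨x hcon.fixedPoint, hcon.fixedPoint, hx' _, hcon.fixedPoint_isFixedPt.symm⟩

end FracControl

end

/-! ### Compactness and the response to weakly null forcing. -/

noncomputable section

namespace FracControl

variable {E : Type*} [NormedAddCommGroup E] [InnerProductSpace ℝ E] [CompleteSpace E]
  {α μ a : ℝ} {A : E →ₗ.[ℝ] E} {T S : ℝ → E →L[ℝ] E} {m : ℕ} {c τ : Fin m → ℝ}

/-- Compactness of the Green operators forces compactness of the resolvent family. -/
theorem isCompactOperator_resolvent (hτ : ∀ k, τ k ∈ Icc 0 a)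
    (hc : (⨆ t : ℝ≥0, ‖T t‖ₑ) * ∑ k, ‖c k‖ₑ < 1)
    (hG : ∀ t s : ℝ, 0 ≤ s → s < t → t ≤ a → IsCompactOperator (green T S c τ t s))
    {r : ℝ} (hr : r ∈ Ioc 0 a) : IsCompactOperator (S r) := by
  set V : E →L[ℝ] E := ∑ k, (if 0 < τ k then c k else 0) • S (τ k) with hV
  have hgreen : ∀ t, 0 < t → green T S c τ t 0 = T t * nonlocalInverse T c τ * V + S t := by
    intro t ht
    simp only [green, if_pos ht, one_smul, sub_zero, hV, Finset.mul_sum, mul_smul_comm]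
  have hN := isUnit_one_sub_nodes (fun k => (hτ k).1) hc
  set N : E →L[ℝ] E := 1 - ∑ k, c k • T (τ k) with hNdef
  -- Nodes at time zero have to be split off: they do not contribute to `V`, and no compactness is
  -- assumed for the Green operator at `(0, 0)`. Dropping weights preserves the smallness condition.
  have hL : IsUnit (1 - ∑ k, (if 0 < τ k then 0 else c k) • T (τ k)) := by
    refine isUnit_one_sub_nodes (fun k => (hτ k).1) (lt_of_le_of_lt ?_ hc)
    gcongr with k
    split_ifs <;> simp
  set L : E →L[ℝ] E := 1 - ∑ k, (if 0 < τ k then 0 else c k) • T (τ k) with hLdef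
  have hLN : ∑ k, (if 0 < τ k then c k else 0) • T (τ k) = L - N := by
    rw [hLdef, hNdef, sub_sub_sub_cancel_left, ← Finset.sum_sub_distrib]
    refine Finset.sum_congr rfl fun k _ => ?_
    split_ifs <;> simp
  -- This compact combination equals `L` composed with the nonlocal part of the Green operator.
  -- Inverting `L` shows that this part is compact, and subtracting it from the Green operator
  -- leaves `S r`.
  set W : E →L[ℝ] E := ∑ k, (if 0 < τ k then c k else 0) • green T S c τ (τ k) 0 with hW
  have hWc : IsCompactOperator W := by
    have h1 : W ∈ {f : E →L[ℝ] E | IsCompactOperator f} := by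
      refine Finset.sum_induction _ (fun f : E →L[ℝ] E => IsCompactOperator f)
        (fun f g hf hg => hf.add hg) isCompactOperator_zero fun k _ => ?_
      split_ifs with h
      · exact (hG _ 0 le_rfl h (hτ k).2).smul (c k)
      · rw [zero_smul]; exact isCompactOperator_zero
    exact h1
  have hWeq : W = L * (nonlocalInverse T c τ * V) := by
    have h1 : W = (∑ k, (if 0 < τ k then c k else 0) • T (τ k)) * (nonlocalInverse T c τ * V) + V := by
      nth_rewrite 2 [hV]
      rw [hW, Finset.sum_mul, ← Finset.sum_add_distrib]
      refine Finset.sum_congr rfl fun k _ => ?_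
      split_ifs with h
      · rw [hgreen _ h, smul_add, smul_mul_assoc, mul_assoc]
      · simp
    have h2 : N * (nonlocalInverse T c τ * V) = V := by
      rw [← mul_assoc, nonlocalInverse, Ring.mul_inverse_cancel _ hN, one_mul]
    rw [h1, hLN, sub_mul, h2, sub_add_cancel]
  have hOV : nonlocalInverse T c τ * V = Ring.inverse L * W := by
    rw [hWeq, ← mul_assoc, Ring.inverse_mul_cancel _ hL, one_mul]
  have hS : S r = green T S c τ r 0 - T r * (Ring.inverse L * W) := by
    rw [hgreen r hr.1, mul_assoc, hOV, add_sub_cancel_left]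
  rw [hS]
  exact (hG r 0 le_rfl hr.1 hr.2).sub ((hWc.clm_comp (Ring.inverse L)).clm_comp (T r))

/-- A compact operator maps bounded weakly null sequences to null sequences. -/
theorem tendsto_zero_of_weakly_null {K : E →L[ℝ] E} (hK : IsCompactOperator K) {e : ℕ → E} {C : ℝ}
    (hC : ∀ n, ‖e n‖ ≤ C) (he : ∀ z, Tendsto (fun n => ⟪e n, z⟫) atTop (𝓝 0)) :
    Tendsto (fun n => K (e n)) atTop (𝓝 0) := by
  obtain ⟨s, hs, hsub⟩ := IsCompactOperator.image_closedBall_subset_compact (f := (K : E →ₗ[ℝ] E)) hK C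
  refine hs.tendsto_nhds_of_unique_mapClusterPt
    (Eventually.of_forall fun n => hsub ⟨e n, by simpa using hC n, rfl⟩) fun y _ hy => ?_
  refine ext_inner_right ℝ fun z => ?_
  have h1 : MapClusterPt ⟪y, z⟫ atTop fun n => ⟪K (e n), z⟫ :=
    MapClusterPt.continuousAt_comp (f := fun y => ⟪y, z⟫) (by fun_prop) hy
  have h2 : Tendsto (fun n => ⟪K (e n), z⟫) atTop (𝓝 0) := by
    simpa only [ContinuousLinearMap.adjoint_inner_right] using
      he (ContinuousLinearMap.adjoint K z)
  rw [inner_zero_left]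
  obtain ⟨φ, hφ, hlim⟩ := h1.tendsto_subseq
  exact tendsto_nhds_unique hlim (h2.comp hφ.tendsto_atTop)

/-- Here `‖K* e‖² = ⟪K K* e, e⟫` and `K K*` is compact. -/
theorem tendsto_adjoint_zero_of_weakly_null {K : E →L[ℝ] E} (hK : IsCompactOperator K) {e : ℕ → E}
    {C : ℝ} (hC : ∀ n, ‖e n‖ ≤ C) (he : ∀ z, Tendsto (fun n => ⟪e n, z⟫) atTop (𝓝 0)) :
    Tendsto (fun n => ContinuousLinearMap.adjoint K (e n)) atTop (𝓝 0) := by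
  have h1 : IsCompactOperator (K ∘L ContinuousLinearMap.adjoint K) :=
    hK.comp_clm (ContinuousLinearMap.adjoint K)
  have h2 := tendsto_zero_of_weakly_null h1 hC he
  rw [tendsto_zero_iff_norm_tendsto_zero] at h2 ⊢
  have h3 : Tendsto (fun n => √(‖(K ∘L ContinuousLinearMap.adjoint K) (e n)‖ * C)) atTop (𝓝 0) := by
    have := (h2.mul_const C).sqrt
    simpa using this
  refine squeeze_zero (fun _ => norm_nonneg _) (fun n => Real.le_sqrt_of_sq_le ?_) h3
  rw [← real_inner_self_eq_norm_sq, ContinuousLinearMap.adjoint_inner_right]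
  exact (real_inner_le_norm _ _).trans (mul_le_mul_of_nonneg_left (hC n) (norm_nonneg _))

namespace CoerciveFamily

variable (H : CoerciveFamily α A T S μ)
include H

/-- For `α ≤ 1 / 2` the kernel is not square integrable, so the value of the convolution at `t` is
not a bounded functional on `L²`-forcing by the kernel estimate. Keeping only `s < t - ε` bounds the
kernel. -/
theorem exists_cutoff_clm {t ε : ℝ} (ht : t ≤ a) (hε : 0 < ε) :
    ∃ L : Lp E 2 (vol a) →L[ℝ] E, ∀ h : Lp E 2 (vol a),
      L h = mildOp S ((Ioo 0 (t - ε)).indicator h) t := by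
  set I : (ℝ → E) → ℝ → E := (Ioo 0 (t - ε)).indicator with hI
  set C : ℝ≥0∞ := ENNReal.ofReal (rlKer α ε) *
    vol a univ ^ (1 / (1 : ℝ≥0∞).toReal - 1 / (2 : ℝ≥0∞).toReal) with hC
  have hCfin : C ≠ ∞ := ENNReal.mul_ne_top ENNReal.ofReal_ne_top
    (ENNReal.rpow_ne_top_of_nonneg (by norm_num) (measure_ne_top _ _))
  have hbound : ∀ h : Lp E 2 (vol a),
      ∫⁻ s in Ioo 0 t, ENNReal.ofReal (rlKer α (t - s)) * ‖I h s‖ₑ ≤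
        C * eLpNorm h 2 (vol a) := by
    intro h
    calc _ ≤ ∫⁻ s in Ioo 0 t, ENNReal.ofReal (rlKer α ε) * ‖h s‖ₑ := by
          refine setLIntegral_mono' measurableSet_Ioo fun s hs => ?_
          by_cases h1 : s ∈ Ioo 0 (t - ε)
          · rw [hI, indicator_of_mem h1]
            gcongr
            exact rlKer_antitone H.pos H.lt_one hε (by linarith [h1.2])
          · rw [hI, indicator_of_notMem h1]; simp
      _ ≤ ENNReal.ofReal (rlKer α ε) * eLpNorm h 1 (vol a) := by
          rw [lintegral_const_mul' _ _ ENNReal.ofReal_ne_top, eLpNorm_one_eq_lintegral_enorm]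
          gcongr
          exact Measure.restrict_mono
            (show Ioo 0 t ⊆ Icc 0 a from fun s hs => ⟨hs.1.le, hs.2.le.trans ht⟩) le_rfl
      _ ≤ _ := by
          rw [hC, mul_assoc, mul_comm (vol a univ ^ _)]
          gcongr
          exact eLpNorm_le_eLpNorm_mul_rpow_measure_univ (by norm_num) (Lp.aestronglyMeasurable h)
  have hint : ∀ h : Lp E 2 (vol a), IntegrableOn (fun s => S (t - s) (I h s)) (Ioo 0 t) := by
    intro h
    have hm : AEStronglyMeasurable (I h) (volume.restrict (Ioo 0 t)) :=
      (aestronglyMeasurable_restrict_Ioo (Lp.aestronglyMeasurable h) ht).indicator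
        measurableSet_Ioo
    exact H.integrableOn_mild hm ((integrableOn_rlKer_mul_norm_iff H.pos hm).2
      ((hbound h).trans_lt (ENNReal.mul_lt_top hCfin.lt_top (Lp.eLpNorm_lt_top h))))
  have hcongr : ∀ h h' : ℝ → E, h =ᵐ[vol a] h' → mildOp S (I h) t = mildOp S (I h') t := by
    intro h h' hh
    refine mildOp_congr ?_ ht
    filter_upwards [hh] with s hs
    simp only [hI, indicator_apply, hs]
  refine ⟨LinearMap.mkContinuous
    { toFun := fun h => mildOp S (I h) t
      map_add' := fun h h' => ?_
      map_smul' := fun r h => ?_ } C.toReal fun h => ?_, fun h => rfl⟩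
  · rw [hcongr _ _ (Lp.coeFn_add h h'), hI, indicator_add']
    simp only [mildOp, Pi.add_apply, map_add]
    exact integral_add (hint h) (hint h')
  · rw [hcongr _ _ (Lp.coeFn_smul r h), hI]
    change ∫ s in Ioo 0 t, S (t - s) ((Ioo 0 (t - ε)).indicator (fun s => r • h s) s) = _
    rw [indicator_const_smul]
    simp only [mildOp, map_smul, RingHom.id_apply]
    exact integral_smul _ _
  · simp only [LinearMap.coe_mk, AddHom.coe_mk]
    rw [Lp.norm_def, ← ENNReal.toReal_mul, ← toReal_enorm]
    exact ENNReal.toReal_mono (ENNReal.mul_ne_top hCfin (Lp.eLpNorm_ne_top h))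
      ((H.enorm_mildOp_le _).trans (hbound h))

theorem integrableOn_rlKer_mul_norm_of_bound {R t : ℝ} {h : ℝ → E}
    (hm : AEStronglyMeasurable h (volume.restrict (Ioo 0 t)))
    (hR : ∀ᵐ s ∂volume.restrict (Ioo 0 t), ‖h s‖ ≤ R) :
    IntegrableOn (fun s => rlKer α (t - s) * ‖h s‖) (Ioo 0 t) := by
  have h1 := ((integrableOn_rlKer_sub H.pos t).mono_set
    (Ioo_subset_Ioi_self : Ioo 0 t ⊆ Ioi 0))
  exact Integrable.mul_bdd (c := R) h1 hm.norm (by simpa using hR)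

/-- For forcing bounded by `R` the removed piece near `s = t` is at most `R` times a small integral
of the kernel, uniformly in the forcing. -/
theorem exists_clm_approx {t R η : ℝ} (ht : t ≤ a) (hη : 0 < η) :
    ∃ L : Lp E 2 (vol a) →L[ℝ] E, ∀ h : Lp E 2 (vol a), (∀ᵐ s ∂vol a, ‖h s‖ ≤ R) →
      ‖mildOp S h t - L h‖ ≤ η := by
  have hfin : ∫⁻ s in Ioo 0 t, ENNReal.ofReal R * ENNReal.ofReal (rlKer α (t - s)) ≠ ∞ := by
    rw [lintegral_const_mul' _ _ ENNReal.ofReal_ne_top, lintegral_rlKer_sub_eq]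
    exact ENNReal.mul_ne_top ENNReal.ofReal_ne_top (lintegral_rlKer_lt_top H.pos t).ne
  obtain ⟨δ, hδ, hδη⟩ := exists_pos_setLIntegral_lt_of_measure_lt hfin
    (ε := ENNReal.ofReal η) (by simpa using hη)
  obtain ⟨ε, hε0, hεδ⟩ := ENNReal.lt_iff_exists_real_btwn.1 hδ
  have hε : 0 < ε := by simpa using hεδ.1
  obtain ⟨L, hL⟩ := H.exists_cutoff_clm ht hε
  refine ⟨L, fun h hR => ?_⟩
  have hm : AEStronglyMeasurable h (volume.restrict (Ioo 0 t)) :=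
    aestronglyMeasurable_restrict_Ioo (Lp.aestronglyMeasurable h) ht
  have hR' := ae_restrict_Ioo hR ht
  have hm2 := hm.indicator (measurableSet_Ioo (a := (0 : ℝ)) (b := t - ε))
  have hR2 : ∀ᵐ s ∂volume.restrict (Ioo 0 t), ‖(Ioo 0 (t - ε)).indicator h s‖ ≤ R := by
    filter_upwards [hR'] with s hs
    exact (norm_indicator_le_norm_self _ _).trans hs
  have h1 := H.enorm_mildOp_sub_le hm (H.integrableOn_rlKer_mul_norm_of_bound hm hR') hm2
    (H.integrableOn_rlKer_mul_norm_of_bound hm2 hR2)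
  rw [← hL] at h1
  have hset : volume.restrict (Ioo 0 t) (Ioo 0 (t - ε))ᶜ < δ := by
    rw [Measure.restrict_apply measurableSet_Ioo.compl]
    refine (measure_mono (t := Ico (t - ε) t) ?_).trans_lt ?_
    · rintro s ⟨hs1, hs2⟩
      exact ⟨not_lt.1 fun h => hs1 ⟨hs2.1, h⟩, hs2.2⟩
    · rw [Real.volume_Ico, sub_sub_cancel]
      exact hεδ.2
  have h2 := hδη _ hset
  rw [← ofReal_norm] at h1
  refine (ENNReal.ofReal_le_ofReal_iff hη.le).1 (h1.trans (le_trans ?_ h2.le))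
  rw [← lintegral_indicator measurableSet_Ioo.compl]
  refine lintegral_mono_ae ?_
  filter_upwards [hR'] with s hs
  by_cases h3 : s ∈ Ioo 0 (t - ε)
  · rw [indicator_of_mem h3, sub_self]; simp
  · rw [indicator_of_notMem h3, sub_zero, indicator_of_mem (mem_compl h3), mul_comm]
    gcongr
    rw [← ofReal_norm]
    exact ENNReal.ofReal_le_ofReal hs

/-- Bounded weakly null forcing terms yield mild solutions that tend to zero pointwise. -/
theorem tendsto_mildOp_zero {t R : ℝ} (ht : t ≤ a)
    (hS : ∀ r ∈ Ioc 0 a, IsCompactOperator (S r)) {h : ℕ → Lp E 2 (vol a)} (hR0 : 0 ≤ R)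
    (hR : ∀ n, ∀ᵐ s ∂vol a, ‖h n s‖ ≤ R) (hw : ∀ z, Tendsto (fun n => ⟪h n, z⟫) atTop (𝓝 0)) :
    Tendsto (fun n => mildOp S (h n) t) atTop (𝓝 0) := by
  set e : ℕ → E := fun n => mildOp S (h n) t with he
  have hm : ∀ n, AEStronglyMeasurable (h n) (volume.restrict (Ioo 0 t)) := fun n =>
    aestronglyMeasurable_restrict_Ioo (Lp.aestronglyMeasurable _) ht
  have hR' := fun n => ae_restrict_Ioo (hR n) ht
  have hki : IntegrableOn (fun s => rlKer α (t - s) * R) (Ioo 0 t) :=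
    ((integrableOn_rlKer_sub H.pos t).mono_set
      (Ioo_subset_Ioi_self : Ioo 0 t ⊆ Ioi 0)).mul_const R
  have hSb : ∀ n, ∀ᵐ s ∂volume.restrict (Ioo 0 t), ‖S (t - s) (h n s)‖ ≤ rlKer α (t - s) * R := by
    intro n
    filter_upwards [hR' n, ae_restrict_mem measurableSet_Ioo] with s h1 hs
    exact (H.norm_resolvent_le _ (by linarith [hs.2])).trans
      (mul_le_mul_of_nonneg_left h1 (rlKer_nonneg H.pos _))
  set C := ∫ s in Ioo 0 t, rlKer α (t - s) * R with hC
  have heC : ∀ n, ‖e n‖ ≤ C := fun n => norm_integral_le_of_norm_le hki (hSb n)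
  -- Weak convergence needs no compactness: `e n` is uniformly close to bounded linear images of `h
  -- n`.
  have hew : ∀ z, Tendsto (fun n => ⟪e n, z⟫) atTop (𝓝 0) := by
    intro z
    rw [Metric.tendsto_atTop]
    intro κ hκ
    obtain ⟨L, hL⟩ := H.exists_clm_approx (R := R) ht
      (show 0 < κ / (2 * (‖z‖ + 1)) by positivity)
    have h1 : Tendsto (fun n => ⟪L (h n), z⟫) atTop (𝓝 0) := by
      simpa only [ContinuousLinearMap.adjoint_inner_right] using
        hw (ContinuousLinearMap.adjoint L z)
    obtain ⟨N, hN⟩ := Metric.tendsto_atTop.1 h1 (κ / 2) (by positivity)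
    refine ⟨N, fun n hn => ?_⟩
    have h2 := hN n hn
    rw [Real.dist_eq, sub_zero] at h2 ⊢
    have h3 : ⟪e n, z⟫ = ⟪e n - L (h n), z⟫ + ⟪L (h n), z⟫ := by rw [inner_sub_left]; ring
    have h4 : |⟪e n - L (h n), z⟫| ≤ κ / 2 := by
      refine (abs_real_inner_le_norm _ _).trans ?_
      calc _ ≤ κ / (2 * (‖z‖ + 1)) * (‖z‖ + 1) := by
            refine mul_le_mul (hL _ (hR n)) (by linarith) (norm_nonneg _) (by positivity)
        _ = κ / 2 := by field_simp
    rw [h3]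
    exact (abs_add_le _ _).trans_lt (by linarith)
  -- Strong convergence comes from `‖e n‖² = ∫ ⟪h n s, S(t - s)* e n⟫`: by compactness `S(t - s)* e
  -- n → 0` for each `s`, and dominated convergence applies. No norm continuity of `S` is used.
  have hpt : ∀ᵐ s ∂volume.restrict (Ioo 0 t),
      Tendsto (fun n => ⟪S (t - s) (h n s), e n⟫) atTop (𝓝 0) := by
    filter_upwards [ae_all_iff.2 hR', ae_restrict_mem measurableSet_Ioo] with s h1 hs
    have h2 := tendsto_adjoint_zero_of_weakly_null
      (hS (t - s) ⟨by linarith [hs.2], by linarith [hs.1]⟩) heC hew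
    rw [tendsto_zero_iff_norm_tendsto_zero] at h2 ⊢
    refine squeeze_zero (fun _ => norm_nonneg _) (fun n => ?_) (by simpa using h2.const_mul R)
    rw [← ContinuousLinearMap.adjoint_inner_right]
    exact (norm_inner_le_norm _ _).trans (mul_le_mul_of_nonneg_right (h1 n) (norm_nonneg _))
  have hsq : Tendsto (fun n => ‖e n‖ ^ 2) atTop (𝓝 0) := by
    have h1 : ∀ n, ‖e n‖ ^ 2 = ∫ s in Ioo 0 t, ⟪S (t - s) (h n s), e n⟫ := by
      intro n
      rw [← real_inner_self_eq_norm_sq]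
      have h2 := H.integrableOn_mild (hm n) (H.integrableOn_rlKer_mul_norm_of_bound (hm n) (hR' n))
      have h3 : ∫ s in Ioo 0 t, ⟪e n, S (t - s) (h n s)⟫ = ⟪e n, e n⟫ := integral_inner h2 (e n)
      rw [← h3]
      exact integral_congr_ae (ae_of_all _ fun s => real_inner_comm _ _)
    simp only [h1]
    have h0 : ∫ _ in Ioo 0 t, (0 : ℝ) = 0 := integral_zero _ _
    refine (congrArg 𝓝 h0).le.trans' ?_
    refine tendsto_integral_of_dominated_convergence (fun s => rlKer α (t - s) * R * C)
      (fun n => ?_) (hki.mul_const C) (fun n => ?_) hpt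
    · exact (H.aestronglyMeasurable_mild (hm n)).inner aestronglyMeasurable_const
    · filter_upwards [hSb n] with s hs
      exact (norm_inner_le_norm _ _).trans (mul_le_mul hs (heC n) (norm_nonneg _)
        (mul_nonneg (rlKer_nonneg H.pos _) hR0))
  rw [tendsto_zero_iff_norm_tendsto_zero]
  have := hsq.sqrt
  simpa using this

end CoerciveFamily

end FracControl

end

/-! ### Stability of solutions. -/

noncomputable section

namespace FracControl

variable {E : Type*} [NormedAddCommGroup E] [InnerProductSpace ℝ E]
  {α μ a : ℝ} {A : E →ₗ.[ℝ] E} {T S : ℝ → E →L[ℝ] E} {m : ℕ} {c τ : Fin m → ℝ}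

/-- The fractional integral of `h` exists at `t`. -/
def RLIntegrable (α t : ℝ) (h : ℝ → E) : Prop :=
  AEStronglyMeasurable h (volume.restrict (Ioo 0 t)) ∧
    IntegrableOn (fun s => rlKer α (t - s) * ‖h s‖) (Ioo 0 t)

theorem RLIntegrable.sub (hα : 0 < α) {t : ℝ} {h h' : ℝ → E} (hh : RLIntegrable α t h)
    (hh' : RLIntegrable α t h') : RLIntegrable α t fun s => h s - h' s := by
  refine ⟨hh.1.sub hh'.1, (hh.2.add hh'.2).mono' ?_ (ae_of_all _ fun s => ?_)⟩
  · exact (measurable_rlKer.comp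
      (by fun_prop : Measurable fun r : ℝ => t - r)).aestronglyMeasurable.mul (hh.1.sub hh'.1).norm
  · rw [norm_mul, norm_norm, Real.norm_of_nonneg (rlKer_nonneg hα _), Pi.add_apply, ← mul_add]
    exact mul_le_mul_of_nonneg_left (norm_sub_le _ _) (rlKer_nonneg hα _)

theorem CoerciveFamily.mildOp_sub [CompleteSpace E] (H : CoerciveFamily α A T S μ) {t : ℝ}
    {h h' : ℝ → E} (hh : RLIntegrable α t h) (hh' : RLIntegrable α t h') :
    mildOp S (fun s => h s - h' s) t = mildOp S h t - mildOp S h' t := by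
  simp only [mildOp, map_sub]
  exact integral_sub (H.integrableOn_mild hh.1 hh.2) (H.integrableOn_mild hh'.1 hh'.2)

variable [CompleteSpace E] {f : ℝ → E → E} {p : ℝ → ℝ} {b R Z : ℝ} (hf : Nonlinearity a f p b)
  (H : CoerciveFamily α A T S μ)
include hf H

theorem Nonlinearity.rlIntegrable_forcing (hR : 0 ≤ R) {w : ℝ → E} (hw : MemLp w 2 (vol a))
    (hwR : ∀ᵐ s ∂vol a, ‖w s‖ ≤ R) {z₀ : E} {x : ℝ → E} (hx : IsSolution a T S f w z₀ x) {t : ℝ}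
    (ht : IsGoodTime α a p t) : RLIntegrable α t (forcing f w x) :=
  ⟨aestronglyMeasurable_restrict_Ioo (hf.memLp_forcing hw hx.memLp).1 ht.1.2,
    hf.integrableOn_forcing H hw hR hwR hx ht⟩

/-- The fixed point condition gives `‖z₀‖ ≤ γ (‖z₀‖ + C)` with `γ < 1`, so the initial values are
bounded uniformly in the inhomogeneity. -/
theorem Nonlinearity.exists_initial_bound (hR : 0 ≤ R) (hg : ∀ k, IsGoodTime α a p (τ k))
    (hc : (⨆ t : ℝ≥0, ‖T t‖ₑ) * ∑ k, ‖c k‖ₑ < 1) :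
    ∃ Z, ∀ (w x : ℝ → E) (z₀ : E), MemLp w 2 (vol a) → (∀ᵐ s ∂vol a, ‖w s‖ ≤ R) →
      IsSolution a T S f w z₀ x → z₀ = ∑ k, c k • solVal T S f w z₀ x (τ k) → ‖z₀‖ ≤ Z := by
  obtain ⟨γ, hγ0, hγ1, hγ⟩ := exists_contraction_const H.solution.map_zero hc
  set C : Fin m → ℝ := fun k => (rlConv α (fun s => ENNReal.ofReal (p s + R)) (τ k)).toReal
  have hC : ∀ k, C k ≤ ∑ j, C j := fun k =>
    Finset.single_le_sum (f := C) (fun j _ => ENNReal.toReal_nonneg) (Finset.mem_univ k)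
  refine ⟨γ * (∑ j, C j) / (1 - γ), fun w x z₀ hw hwR hx hz => ?_⟩
  have h1 := hγ (fun k => solVal T S f w z₀ x (τ k)) (‖z₀‖ + ∑ j, C j)
    (add_nonneg (norm_nonneg _) (Finset.sum_nonneg fun j _ => ENNReal.toReal_nonneg))
    fun k => (hf.norm_solVal_le H hw hR hwR hx (hg k)).trans (by linarith [hC k])
  rw [← hz] at h1
  rw [le_div_iff₀ (by linarith)]
  linarith

section comparison

variable {w w' : ℝ → E} (hw : MemLp w 2 (vol a)) (hw' : MemLp w' 2 (vol a))
  (hR : 0 ≤ R) (hwR : ∀ᵐ s ∂vol a, ‖w s‖ ≤ R) (hwR' : ∀ᵐ s ∂vol a, ‖w' s‖ ≤ R)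
  {z z' : E} {x x' : ℝ → E} (hx : IsSolution a T S f w z x) (hx' : IsSolution a T S f w' z' x')
include hw hw' hR hwR hwR' hx hx'

theorem Nonlinearity.ae_enorm_sub_le (hZ : ‖z‖ ≤ Z) (hZ' : ‖z'‖ ≤ Z) :
    ∀ᵐ s ∂vol a, ‖f s (x s) - f s (x' s)‖ₑ ≤ 2 * (majorant α p b R Z s + ENNReal.ofReal R) := by
  filter_upwards [hf.ae_enorm_forcing_le H hw hR hwR hZ hx,
    hf.ae_enorm_forcing_le H hw' hR hwR' hZ' hx', hwR, hwR'] with s h1 h2 h3 h4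
  have h5 : ∀ (w x : ℝ → E), ‖w s‖ ≤ R → ‖forcing f w x s‖ₑ ≤ majorant α p b R Z s →
      ‖f s (x s)‖ₑ ≤ majorant α p b R Z s + ENNReal.ofReal R := by
    intro w x hw hx
    have e : f s (x s) = forcing f w x s - w s := by rw [forcing, add_sub_cancel_left]
    rw [e]
    refine (enorm_sub_le).trans (add_le_add hx ?_)
    rw [← ofReal_norm]
    exact ENNReal.ofReal_le_ofReal hw
  rw [two_mul]
  exact enorm_sub_le.trans (add_le_add (h5 w x h3 h1) (h5 w' x' h4 h2))

/-- Quantitative stability of solutions in the inhomogeneity and the initial value. -/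
theorem Nonlinearity.norm_solVal_sub_sub_le {t ε : ℝ} (ht : IsGoodTime α a p t) (hε : 0 < ε)
    (hfin : rlConv α (fun s => ‖f s (x s) - f s (x' s)‖ₑ *
      ‖mildOp S (fun r => w r - w' r) s‖ₑ) t < ∞) :
    ‖solVal T S f w z x t - solVal T S f w' z' x' t - mildOp S (fun r => w r - w' r) t‖ ≤
      ε + ‖z - z'‖ + ε⁻¹ * (rlConv α (fun s => ‖f s (x s) - f s (x' s)‖ₑ *
        ‖mildOp S (fun r => w r - w' r) s‖ₑ) t).toReal := by
  have hα := H.pos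
  rcases ht.1.1.eq_or_lt with rfl | h0
  · have : ‖z - z'‖ ≤ ε + ‖z - z'‖ := by linarith
    simpa [solVal, mildOp, H.solution.map_zero, rlConv] using this
  have hta := ht.1.2
  set ζ : ℝ → E := mildOp S (fun r => w r - w' r) with hζ
  -- Subtracting the linear response `ζ` leaves only the difference of the nonlinear terms as
  -- forcing. Monotonicity then bounds its pairing with the corrected difference by `‖η‖ ‖ζ‖`, which
  -- is small with `ζ`.
  set η : ℝ → E := fun s => (forcing f w x s - forcing f w' x' s) - (w s - w' s) with hη
  have hηe : ∀ s, η s = f s (x s) - f s (x' s) := fun s => by simp only [hη, forcing]; abel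
  have hwd : ∀ s ≤ a, RLIntegrable α s fun r => w r - w' r := by
    intro s hs
    have hm := aestronglyMeasurable_restrict_Ioo (hw.1.sub hw'.1) hs
    refine ⟨hm, H.integrableOn_rlKer_mul_norm_of_bound (R := R + R) hm ?_⟩
    filter_upwards [ae_restrict_Ioo hwR hs, ae_restrict_Ioo hwR' hs] with s h1 h2
    exact (norm_sub_le _ _).trans (add_le_add h1 h2)
  have hid : ∀ s, IsGoodTime α a p s → RLIntegrable α s η ∧ T s (z - z') + mildOp S η s =
      solVal T S f w z x s - solVal T S f w' z' x' s - ζ s := by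
    intro s hs
    have h1 := hf.rlIntegrable_forcing H hR hw hwR hx hs
    have h2 := hf.rlIntegrable_forcing H hR hw' hwR' hx' hs
    refine ⟨(h1.sub hα h2).sub hα (hwd s hs.1.2), ?_⟩
    rw [hη, H.mildOp_sub (h1.sub hα h2) (hwd s hs.1.2), H.mildOp_sub h1 h2, map_sub, solVal, solVal]
    abel
  obtain ⟨hηt, hval⟩ := hid t ht
  have hζm : AEStronglyMeasurable ζ (volume.restrict (Ioo 0 t)) :=
    H.aestronglyMeasurable_mildOp (hwd t hta).1
  have hQ : (fun s => ‖f s (x s) - f s (x' s)‖ₑ * ‖ζ s‖ₑ) =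
      fun s => ENNReal.ofReal (‖η s‖ * ‖ζ s‖) := by
    ext s
    rw [ENNReal.ofReal_mul (norm_nonneg _), ofReal_norm, ofReal_norm, hηe]
  rw [hQ] at hfin ⊢
  obtain ⟨h1, h2⟩ := integrableOn_rlKer_mul hα (P := fun s => ‖η s‖ * ‖ζ s‖) (hηt.1.norm.mul hζm.norm).aemeasurable
    (fun s _ => mul_nonneg (norm_nonneg _) (norm_nonneg _)) hfin
  have key := H.norm_le_of_inner_le_const hε (z - z') h0 hηt.1 hηt.2 h1
    (fun s _ => mul_nonneg (norm_nonneg _) (norm_nonneg _)) ?_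
  · rw [hval] at key
    rw [← h2]
    exact key
  · filter_upwards [ae_restrict_Ioo (hf.ae_isGoodTime hα) hta, ae_restrict_Ioo hx.eq hta,
      ae_restrict_Ioo hx'.eq hta] with s h3 h4 h5
    rw [(hid s h3).2, solVal, solVal, ← h4, ← h5, inner_sub_left]
    have h6 := hf.mono s h3.1 (x s) (x' s)
    rw [← hηe, real_inner_comm] at h6
    have h7 := neg_le_of_abs_le (abs_real_inner_le_norm (ζ s) (η s))
    rw [mul_comm] at h7
    linarith

end comparison

/-- Strong pointwise convergence of solutions of the nonlocal problem, given pointwise convergence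
of the linear response to the inhomogeneities. -/
theorem Nonlinearity.ae_tendsto_solution (hR : 0 ≤ R) (hg : ∀ k, IsGoodTime α a p (τ k))
    (hc : (⨆ t : ℝ≥0, ‖T t‖ₑ) * ∑ k, ‖c k‖ₑ < 1)
    {w : ℝ → E} {wn : ℕ → ℝ → E} (hw : MemLp w 2 (vol a)) (hwn : ∀ n, MemLp (wn n) 2 (vol a))
    (hwR : ∀ᵐ s ∂vol a, ‖w s‖ ≤ R) (hwnR : ∀ n, ∀ᵐ s ∂vol a, ‖wn n s‖ ≤ R)
    {x : ℝ → E} {xn : ℕ → ℝ → E} {z : E} {zn : ℕ → E}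
    (hx : IsSolution a T S f w z x) (hxn : ∀ n, IsSolution a T S f (wn n) (zn n) (xn n))
    (hz : z = ∑ k, c k • solVal T S f w z x (τ k))
    (hzn : ∀ n, zn n = ∑ k, c k • solVal T S f (wn n) (zn n) (xn n) (τ k))
    (hζ : ∀ t ∈ Icc 0 a, Tendsto (fun n => mildOp S (fun s => wn n s - w s) t) atTop (𝓝 0)) :
    ∀ᵐ t ∂vol a, Tendsto (fun n => xn n t) atTop (𝓝 (x t)) := by
  have hα := H.pos
  obtain ⟨Z, hZ⟩ := hf.exists_initial_bound H hR hg hc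
  have hzZ := hZ w x z hw hwR hx hz
  have hznZ := fun n => hZ (wn n) (xn n) (zn n) (hwn n) (hwnR n) (hxn n) (hzn n)
  set ζ : ℕ → ℝ → E := fun n => mildOp S (fun s => wn n s - w s) with hζdef
  set q : ℕ → ℝ → ℝ≥0∞ := fun n s => ‖f s (xn n s) - f s (x s)‖ₑ * ‖ζ n s‖ₑ with hq
  set M : ℝ≥0∞ := ENNReal.ofReal (R + R) * ∫⁻ s in Ioo 0 a, ENNReal.ofReal (rlKer α s) with hM
  have hMfin : M ≠ ∞ := ENNReal.mul_ne_top ENNReal.ofReal_ne_top (lintegral_rlKer_lt_top hα a).ne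
  have hζM : ∀ n, ∀ s ≤ a, ‖ζ n s‖ₑ ≤ M := by
    intro n s hs
    refine (H.enorm_mildOp_le _).trans ?_
    calc _ ≤ ∫⁻ r in Ioo 0 s, ENNReal.ofReal (R + R) * ENNReal.ofReal (rlKer α (s - r)) := by
          refine lintegral_mono_ae ?_
          filter_upwards [ae_restrict_Ioo hwR hs, ae_restrict_Ioo (hwnR n) hs] with r h1 h2
          refine (mul_comm _ _).le.trans (mul_le_mul' ?_ le_rfl)
          rw [← ofReal_norm]
          exact ENNReal.ofReal_le_ofReal ((norm_sub_le _ _).trans (add_le_add h2 h1))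
      _ ≤ _ := by
          rw [lintegral_const_mul' _ _ ENNReal.ofReal_ne_top]
          exact mul_le_mul' le_rfl (lintegral_rlKer_sub_le hs)
  -- A majorant common to all `n`, with finite fractional integral at good times; dominated
  -- convergence thus holds at the nodes as well.
  set D : ℝ → ℝ≥0∞ := fun s => M * (2 * (majorant α p b R Z s + ENNReal.ofReal R)) with hD
  have hqD : ∀ n, ∀ᵐ s ∂vol a, q n s ≤ D s := by
    intro n
    filter_upwards [hf.ae_enorm_sub_le H (hwn n) hw hR (hwnR n) hwR (hxn n) hx (hznZ n) hzZ,
      ae_restrict_mem measurableSet_Icc] with s h1 hs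
    exact (mul_comm _ _).le.trans (mul_le_mul' (hζM n s hs.2) h1)
  have hDfin : ∀ t, IsGoodTime α a p t → rlConv α D t < ∞ := by
    intro t ht
    rw [hD, rlConv_const_mul hMfin, rlConv_const_mul (by simp),
      rlConv_add (hf.aemeasurable_majorant ht.1.2)]
    exact ENNReal.mul_lt_top hMfin.lt_top (ENNReal.mul_lt_top (by simp) (ENNReal.add_lt_top.2
      ⟨hf.rlConv_majorant_lt_top hα H.lt_one ht, rlConv_const_lt_top hα ENNReal.ofReal_ne_top t⟩))
  have hqfin : ∀ t, IsGoodTime α a p t → ∀ n, rlConv α (q n) t < ∞ := fun t ht n =>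
    (rlConv_mono_ae (ae_restrict_Ioo (hqD n) ht.1.2)).trans_lt (hDfin t ht)
  have hqlim : ∀ t, IsGoodTime α a p t → Tendsto (fun n => (rlConv α (q n) t).toReal) atTop (𝓝 0) := by
    intro t ht
    have hta := ht.1.2
    have h1 : Tendsto (fun n => rlConv α (q n) t) atTop (𝓝 (∫⁻ _ in Ioo 0 t, (0 : ℝ≥0∞))) := by
      refine tendsto_lintegral_of_dominated_convergence'
        (fun s => ENNReal.ofReal (rlKer α (t - s)) * D s) (fun n => ?_) (fun n => ?_)
        (hDfin t ht).ne ?_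
      · have h2 : AEMeasurable (fun s => ‖f s (xn n s) - f s (x s)‖ₑ * ‖ζ n s‖ₑ)
            (volume.restrict (Ioo 0 t)) :=
          (aestronglyMeasurable_restrict_Ioo (((hf.memLp_comp (hxn n).memLp).sub
            (hf.memLp_comp hx.memLp)).1) hta).enorm.mul
          (H.aestronglyMeasurable_mildOp (aestronglyMeasurable_restrict_Ioo
            ((hwn n).sub hw).1 hta)).enorm
        exact (measurable_ofReal_rlKer.comp
          (by fun_prop : Measurable fun s : ℝ => t - s)).aemeasurable.mul h2
      · filter_upwards [ae_restrict_Ioo (hqD n) hta] with s hs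
        gcongr
      · filter_upwards [ae_restrict_Ioo (ae_all_iff.2 fun n => hf.ae_enorm_sub_le H (hwn n) hw hR
          (hwnR n) hwR (hxn n) hx (hznZ n) hzZ) hta, ae_restrict_mem measurableSet_Ioo,
          ae_restrict_Ioo (hf.ae_isGoodTime hα) hta] with s h2 hs hgs
        have hc : 2 * (majorant α p b R Z s + ENNReal.ofReal R) ≠ ∞ :=
          ENNReal.mul_ne_top (by simp) (ENNReal.add_ne_top.2 ⟨ENNReal.add_ne_top.2
            ⟨ENNReal.ofReal_ne_top, ENNReal.mul_ne_top ENNReal.ofReal_ne_top (ENNReal.add_ne_top.2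
              ⟨ENNReal.ofReal_ne_top, (hf.rlConv_P_lt_top hα hgs).ne⟩)⟩, ENNReal.ofReal_ne_top⟩)
        have h3 : Tendsto (fun n => ‖ζ n s‖ₑ) atTop (𝓝 0) := by
          have := (hζ s hgs.1).enorm
          rwa [enorm_zero] at this
        have h4 := ENNReal.Tendsto.const_mul (a := ENNReal.ofReal (rlKer α (t - s)))
          (ENNReal.Tendsto.const_mul h3 (Or.inr hc)) (Or.inr ENNReal.ofReal_ne_top)
        rw [mul_zero, mul_zero] at h4
        refine tendsto_of_tendsto_of_tendsto_of_le_of_le tendsto_const_nhds h4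
          (fun n => zero_le) fun n => ?_
        exact mul_le_mul' le_rfl (mul_le_mul' (h2 n) le_rfl)
    rw [lintegral_zero] at h1
    have h2 := (ENNReal.tendsto_toReal ENNReal.zero_ne_top).comp h1
    exact h2
  have hcmp : ∀ t, IsGoodTime α a p t → ∀ ε, 0 < ε → ∀ n,
      ‖solVal T S f (wn n) (zn n) (xn n) t - solVal T S f w z x t‖ ≤
        ε + ‖zn n - z‖ + (ε⁻¹ * (rlConv α (q n) t).toReal + ‖ζ n t‖) := by
    intro t ht ε hε n
    have h1 := hf.norm_solVal_sub_sub_le H (hwn n) hw hR (hwnR n) hwR (hxn n) hx ht hε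
      (hqfin t ht n)
    have h2 := norm_sub_norm_le (solVal T S f (wn n) (zn n) (xn n) t - solVal T S f w z x t) (ζ n t)
    simp only [hζdef, hq] at h2 ⊢
    linarith
  have herr : ∀ t, IsGoodTime α a p t → ∀ ε : ℝ, Tendsto (fun n =>
      ε⁻¹ * (rlConv α (q n) t).toReal + ‖ζ n t‖) atTop (𝓝 0) := by
    intro t ht ε
    have := ((hqlim t ht).const_mul ε⁻¹).add (hζ t ht.1).norm
    simpa using this
  obtain ⟨γ, hγ0, hγ1, hγ⟩ := exists_contraction_const H.solution.map_zero hc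
  have hzlim : Tendsto (fun n => ‖zn n - z‖) atTop (𝓝 0) := by
    rw [Metric.tendsto_atTop]
    intro κ hκ
    -- Eventually the node estimate reads `‖zn n - z‖ ≤ γ (2 ε + ‖zn n - z‖)`, and `2 ε = (1 - γ) κ`
    -- then gives a distance below `κ`.
    set ε := κ * (1 - γ) / 2 with hε
    have hε0 : 0 < ε := by have : 0 < 1 - γ := by linarith
                           positivity
    have h1 : Tendsto (fun n => ∑ k, (ε⁻¹ * (rlConv α (q n) (τ k)).toReal + ‖ζ n (τ k)‖)) atTop
        (𝓝 0) := by
      have := tendsto_finsetSum Finset.univ fun k _ => herr (τ k) (hg k) ε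
      simpa using this
    obtain ⟨N, hN⟩ := Metric.tendsto_atTop.1 h1 ε hε0
    refine ⟨N, fun n hn => ?_⟩
    have h2 := hN n hn
    have hpos : ∀ k, 0 ≤ ε⁻¹ * (rlConv α (q n) (τ k)).toReal + ‖ζ n (τ k)‖ := fun k => by positivity
    rw [Real.dist_eq, sub_zero, abs_of_nonneg (Finset.sum_nonneg fun k _ => hpos k)] at h2
    rw [Real.dist_eq, sub_zero, abs_of_nonneg (norm_nonneg _)]
    have h3 := hγ (fun k => solVal T S f (wn n) (zn n) (xn n) (τ k) - solVal T S f w z x (τ k))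
      (ε + ‖zn n - z‖ + ε) (by positivity) fun k => (hcmp _ (hg k) ε hε0 n).trans (by
        have := Finset.single_le_sum (f := fun k => ε⁻¹ * (rlConv α (q n) (τ k)).toReal +
          ‖ζ n (τ k)‖) (fun k _ => hpos k) (Finset.mem_univ k)
        linarith)
    simp only [smul_sub, Finset.sum_sub_distrib] at h3
    rw [← hz, ← hzn] at h3
    have h4 : (1 - γ) * ‖zn n - z‖ < (1 - γ) * κ := by
      have : γ * (2 * ε) < 2 * ε := by nlinarith
      have : 2 * ε = (1 - γ) * κ := by rw [hε]; ring
      linarith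
    exact lt_of_mul_lt_mul_left h4 (by linarith)
  filter_upwards [hf.ae_isGoodTime hα, hx.eq, ae_all_iff.2 fun n => (hxn n).eq] with t ht h1 h2
  rw [tendsto_iff_norm_sub_tendsto_zero, Metric.tendsto_atTop]
  intro κ hκ
  have h3 := hzlim.add (herr t ht (κ / 2))
  rw [add_zero] at h3
  obtain ⟨N, hN⟩ := Metric.tendsto_atTop.1 h3 (κ / 2) (by positivity)
  refine ⟨N, fun n hn => ?_⟩
  have h4 := hN n hn
  rw [Real.dist_eq, sub_zero] at h4 ⊢
  rw [abs_of_nonneg (norm_nonneg _)]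
  have h5 := hcmp t ht (κ / 2) (by positivity) n
  rw [solVal, solVal, ← h1, ← h2] at h5
  have h6 := (abs_lt.1 h4).2
  linarith

end FracControl

end

/-! ### Weak limits and lower semicontinuity of integrals. -/

noncomputable section

namespace FracControl

section Hilbert

variable {H : Type*} [NormedAddCommGroup H] [InnerProductSpace ℝ H] [CompleteSpace H]

/-- The space need not be separable: sequential Banach-Alaoglu is applied in the closed span of the
sequence, and orthogonal projection carries the result to all test vectors. -/
theorem exists_weakly_convergent_subseq {u : ℕ → H} {R : ℝ} (hu : ∀ n, ‖u n‖ ≤ R) :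
    ∃ (v : H) (φ : ℕ → ℕ), StrictMono φ ∧
      ∀ z, Tendsto (fun n => ⟪u (φ n), z⟫) atTop (𝓝 ⟪v, z⟫) := by
  set V := (Submodule.span ℝ (range u)).topologicalClosure with hV
  have huV : ∀ n, u n ∈ V := fun n =>
    Submodule.le_topologicalClosure _ (Submodule.subset_span (mem_range_self n))
  have : CompleteSpace V := (Submodule.isClosed_topologicalClosure _).completeSpace_coe
  have : TopologicalSpace.SeparableSpace V := by
    have h1 : TopologicalSpace.IsSeparable (V : Set H) := by
      rw [hV, Submodule.topologicalClosure_coe]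
      exact ((countable_range u).isSeparable.span (R := ℝ)).closure
    exact h1.separableSpace
  let w : ℕ → V := fun n => ⟨u n, huV n⟩
  obtain ⟨l, -, φ, hφ, hl⟩ := WeakDual.isSeqCompact_closedBall ℝ V 0 R
    (x := fun n => StrongDual.toWeakDual (InnerProductSpace.toDual ℝ V (w n)))
    (fun n => by simpa [w] using hu n)
  refine ⟨((InnerProductSpace.toDual ℝ V).symm (WeakDual.toStrongDual l) : V), φ, hφ, fun z => ?_⟩
  rw [tendsto_iff_forall_eval_tendsto_topDualPairing] at hl
  have h1 := hl (V.orthogonalProjectionOnto z)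
  have e1 : ⟪(((InnerProductSpace.toDual ℝ V).symm (WeakDual.toStrongDual l) : V) : H), z⟫ =
      l (V.orthogonalProjectionOnto z) := by
    rw [← Submodule.inner_orthogonalProjectionOnto_eq_of_mem_left, ]
    exact InnerProductSpace.toDual_symm_apply
  rw [e1]
  refine h1.congr fun n => ?_
  have : ⟪(w (φ n) : H), z⟫ = ⟪w (φ n), V.orthogonalProjectionOnto z⟫ :=
    (Submodule.inner_orthogonalProjectionOnto_eq_of_mem_left _ _).symm
  exact this.symm

theorem mem_of_weak_limit {C : Set H} (hC : Convex ℝ C) (hCc : IsClosed C) {u : ℕ → H} {v : H}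
    (hu : ∀ᶠ n in atTop, u n ∈ C) (hv : ∀ z, Tendsto (fun n => ⟪u n, z⟫) atTop (𝓝 ⟪v, z⟫)) :
    v ∈ C := by
  by_contra h
  obtain ⟨l, r, h1, h2⟩ := geometric_hahn_banach_point_closed hC hCc h
  set z := (InnerProductSpace.toDual ℝ H).symm l with hz
  have e : ∀ x, l x = ⟪x, z⟫ := fun x => by
    rw [real_inner_comm, hz, InnerProductSpace.toDual_symm_apply]
  have h3 : r ≤ ⟪v, z⟫ := ge_of_tendsto (hv z) (by
    filter_upwards [hu] with n hn
    rw [← e]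
    exact (h2 _ hn).le)
  rw [e] at h1
  linarith

/-- Mazur's lemma for a tail of the sequence. -/
theorem mem_closure_convexHull_of_weak_limit {u : ℕ → H} {v : H}
    (hv : ∀ z, Tendsto (fun n => ⟪u n, z⟫) atTop (𝓝 ⟪v, z⟫)) (N : ℕ) :
    v ∈ closure (convexHull ℝ (u '' Ici N)) := by
  refine mem_of_weak_limit (convex_convexHull ℝ _).closure isClosed_closure ?_ hv
  filter_upwards [eventually_ge_atTop N] with n hn
  exact subset_closure (subset_convexHull ℝ _ (mem_image_of_mem _ hn))

end Hilbert

section Lebesgue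

variable {U X : Type*} [NormedAddCommGroup U] [InnerProductSpace ℝ U]
  {mX : MeasurableSpace X} {ν : Measure X}

theorem convex_ae_mem {C : Set U} (hC : Convex ℝ C) :
    Convex ℝ {y : Lp U 2 ν | ∀ᵐ t ∂ν, y t ∈ C} := by
  intro y hy y' hy' r r' hr hr' hrr'
  filter_upwards [hy, hy', Lp.coeFn_add (r • y) (r' • y'), Lp.coeFn_smul r y,
    Lp.coeFn_smul r' y'] with t h1 h2 h3 h4 h5
  rw [h3, Pi.add_apply, h4, h5]
  exact hC h1 h2 hr hr' hrr'

omit [InnerProductSpace ℝ U] in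
theorem isClosed_ae_mem {C : Set U} (hC : IsClosed C) :
    IsClosed {y : Lp U 2 ν | ∀ᵐ t ∂ν, y t ∈ C} := by
  refine IsSeqClosed.isClosed fun y v hy hv => ?_
  change ∀ᵐ t ∂ν, v t ∈ C
  obtain ⟨n, -, hn⟩ := (tendstoInMeasure_of_tendsto_Lp hv).exists_seq_tendsto_ae
  filter_upwards [hn, ae_all_iff.2 hy] with t h1 h2
  exact hC.mem_of_tendsto h1 (Eventually.of_forall fun k => h2 _)

theorem ae_mem_of_weak_limit [CompleteSpace U] {C : Set U} (hC : Convex ℝ C) (hCc : IsClosed C)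
    {y : ℕ → Lp U 2 ν} {v : Lp U 2 ν} (hy : ∀ n, ∀ᵐ t ∂ν, y n t ∈ C)
    (hv : ∀ z, Tendsto (fun n => ⟪y n, z⟫) atTop (𝓝 ⟪v, z⟫)) : ∀ᵐ t ∂ν, v t ∈ C := by
  have h := mem_of_weak_limit (C := {y : Lp U 2 ν | ∀ᵐ t ∂ν, y t ∈ C}) (convex_ae_mem hC)
    (isClosed_ae_mem hCc) (Eventually.of_forall hy) hv
  exact h

/-- Functions `y` all of whose affine images that are eventually dominated by `φ` are dominated by
a common function of integral at most `s`. -/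
def AffinelyDominated (ν : Measure X) (v : ℕ → Lp U 2 ν) (φ : ℕ → X → ℝ≥0∞) (N : ℕ)
    (s : ℝ≥0∞) : Set (Lp U 2 ν) :=
  {y | ∃ F : X → ℝ≥0∞, AEMeasurable F ν ∧ ∫⁻ t, F t ∂ν ≤ s ∧ ∀ᵐ t ∂ν, ∀ (l : U →L[ℝ] ℝ) (c : ℝ),
    (∀ i ≥ N, ENNReal.ofReal (c + l (v i t)) ≤ φ i t) → ENNReal.ofReal (c + l (y t)) ≤ F t}

/-- Affine functions respect convex combinations, so the dominating functions combine with the same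
weights. Quantifying over all functionals inside the almost everywhere statement avoids countable
families, hence separability of `U`. -/
theorem convex_affinelyDominated (v : ℕ → Lp U 2 ν) (φ : ℕ → X → ℝ≥0∞) (N : ℕ) (s : ℝ≥0∞) :
    Convex ℝ (AffinelyDominated ν v φ N s) := by
  rintro y ⟨F, hF, hFs, hFy⟩ y' ⟨F', hF', hFs', hFy'⟩ r r' hr hr' hrr'
  refine ⟨fun t => ENNReal.ofReal r * F t + ENNReal.ofReal r' * F' t,
    (hF.const_mul _).add (hF'.const_mul _), ?_, ?_⟩
  · rw [lintegral_add_left' (hF.const_mul _), lintegral_const_mul' _ _ ENNReal.ofReal_ne_top,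
      lintegral_const_mul' _ _ ENNReal.ofReal_ne_top]
    calc _ ≤ ENNReal.ofReal r * s + ENNReal.ofReal r' * s := by gcongr
      _ = s := by rw [← add_mul, ← ENNReal.ofReal_add hr hr', hrr', ENNReal.ofReal_one, one_mul]
  · filter_upwards [hFy, hFy', Lp.coeFn_add (r • y) (r' • y'), Lp.coeFn_smul r y,
      Lp.coeFn_smul r' y'] with t h1 h2 h3 h4 h5 l c hl
    have e : c + l ((r • y + r' • y' : Lp U 2 ν) t) =
        r * (c + l (y t)) + r' * (c + l (y' t)) := by
      rw [h3, Pi.add_apply, h4, h5]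
      simp only [Pi.smul_apply, map_add, map_smul, smul_eq_mul]
      linear_combination (-c) * hrr'
    rw [e]
    refine ENNReal.ofReal_add_le.trans ?_
    rw [ENNReal.ofReal_mul hr, ENNReal.ofReal_mul hr']
    exact add_le_add (mul_le_mul_right (h1 l c hl) _) (mul_le_mul_right (h2 l c hl) _)

/-- Lower semicontinuity of integrals along a weakly convergent sequence whose integrands are
asymptotically bounded below by affine functions. -/
theorem lintegral_le_of_weak_limit [CompleteSpace U] {v : ℕ → Lp U 2 ν} {w : Lp U 2 ν}
    (hw : ∀ z, Tendsto (fun n => ⟪v n, z⟫) atTop (𝓝 ⟪w, z⟫)) {φ : ℕ → X → ℝ≥0∞}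
    (hφ : ∀ n, AEMeasurable (φ n) ν) {s : ℕ → ℝ≥0∞} {I : ℝ≥0∞} (hs : Antitone s)
    (hsI : Tendsto s atTop (𝓝 I)) (hφs : ∀ n, ∫⁻ t, φ n t ∂ν ≤ s n) {Φ : X → ℝ≥0∞}
    (hΦ : ∀ᵐ t ∂ν, ∀ r : ℝ≥0∞, r < Φ t → ∃ (l : U →L[ℝ] ℝ) (c : ℝ) (N : ℕ),
      (∀ i ≥ N, ENNReal.ofReal (c + l (v i t)) ≤ φ i t) ∧ r ≤ ENNReal.ofReal (c + l (w t))) :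
    ∫⁻ t, Φ t ∂ν ≤ I := by
  have h1 : ∀ N, ∃ y ∈ AffinelyDominated ν v φ N (s N), dist w y < 1 / ((N : ℝ) + 1) := by
    intro N
    obtain ⟨y, hy, hd⟩ := Metric.mem_closure_iff.1 (mem_closure_convexHull_of_weak_limit hw N) _
      (Nat.one_div_pos_of_nat (n := N) (α := ℝ))
    refine ⟨y, convexHull_min ?_ (convex_affinelyDominated v φ N (s N)) hy, hd⟩
    rintro _ ⟨i, hi, rfl⟩
    exact ⟨φ i, hφ i, (hφs i).trans (hs hi), ae_of_all _ fun t l c h => h i hi⟩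
  choose y hy hyw using h1
  have hlim : Tendsto y atTop (𝓝 w) := by
    rw [tendsto_iff_dist_tendsto_zero]
    refine squeeze_zero (fun _ => dist_nonneg) (fun n => ?_) tendsto_one_div_add_atTop_nhds_zero_nat
    rw [dist_comm]
    exact (hyw n).le
  obtain ⟨n, hn, hlim'⟩ := (tendstoInMeasure_of_tendsto_Lp hlim).exists_seq_tendsto_ae
  choose F hF hFs hFy using hy
  -- The convex combinations converge almost everywhere along `n`, so each affine minorant passes to
  -- the limit and `Φ` lies below the lower limit of the dominating functions; Fatou's lemma does
  -- the rest.
  calc ∫⁻ t, Φ t ∂ν ≤ ∫⁻ t, liminf (fun k => F (n k) t) atTop ∂ν := by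
        refine lintegral_mono_ae ?_
        filter_upwards [hΦ, hlim', ae_all_iff.2 hFy] with t h1 h2 h3
        refine le_of_forall_lt fun r hr => ?_
        obtain ⟨r', hr1, hr2⟩ := exists_between hr
        refine hr1.trans_le ?_
        obtain ⟨l, c, N, h4, h5⟩ := h1 r' hr2
        refine h5.trans ?_
        have h6 : Tendsto (fun k => ENNReal.ofReal (c + l (y (n k) t))) atTop
            (𝓝 (ENNReal.ofReal (c + l (w t)))) :=
          ENNReal.tendsto_ofReal (((l.continuous.tendsto _).comp h2).const_add c)
        rw [← h6.liminf_eq]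
        refine liminf_le_liminf ?_
        filter_upwards [hn.tendsto_atTop.eventually_ge_atTop N] with k hk
        exact h3 (n k) l c fun i hi => h4 i (hk.trans hi)
    _ ≤ liminf (fun k => ∫⁻ t, F (n k) t ∂ν) atTop := lintegral_liminf_le' fun k => hF (n k)
    _ ≤ liminf (fun k => s (n k)) atTop := liminf_le_liminf (Eventually.of_forall fun k => hFs _)
    _ = I := (hsI.comp hn.tendsto_atTop).liminf_eq

end Lebesgue

end FracControl

end

/-! ### The control set and the integrand. -/

noncomputable section

namespace FracControl

variable {E U : Type*} [NormedAddCommGroup E] [InnerProductSpace ℝ E]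
  [NormedAddCommGroup U] [InnerProductSpace ℝ U]

theorem continuous_weakSpace_dual (l : U →L[ℝ] ℝ) :
    Continuous fun y : WeakSpace ℝ U => l ((toWeakSpace ℝ U).symm y) :=
  WeakBilin.eval_continuous (topDualPairing ℝ U).flip l

/-- Each functional is bounded on a weakly compact set, so the uniform boundedness principle
applies. -/
theorem IsWeaklyCompact.exists_norm_le [CompleteSpace U] {Uad : Set U} (h : IsWeaklyCompact Uad) :
    ∃ R : ℝ, ∀ u ∈ Uad, ‖u‖ ≤ R := by
  obtain ⟨R, hR⟩ := banach_steinhaus (g := fun u : Uad => innerSL ℝ (u : U)) fun z => by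
    obtain ⟨C, hC⟩ := h.exists_bound_of_continuousOn
      (continuous_weakSpace_dual (innerSL ℝ z)).continuousOn
    refine ⟨C, fun u => ?_⟩
    have := hC (toWeakSpace ℝ U u) (mem_image_of_mem _ u.2)
    simpa [real_inner_comm] using this
  exact ⟨R, fun u hu => by simpa using hR ⟨u, hu⟩⟩

theorem IsWeaklyCompact.isClosed {Uad : Set U} (h : IsWeaklyCompact Uad) : IsClosed Uad := by
  have h1 := IsCompact.isClosed h |>.preimage (toWeakSpaceCLM ℝ U).continuous
  have h2 : toWeakSpaceCLM ℝ U ⁻¹' (toWeakSpace ℝ U '' Uad) = Uad :=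
    preimage_image_eq _ (toWeakSpace ℝ U).injective
  rwa [h2] at h1

theorem WeakStrongLSC.lowerSemicontinuousOn {Uad : Set U} {φ : U → E → ℝ}
    (h : WeakStrongLSC Uad φ) (x : E) : LowerSemicontinuousOn (fun u => φ u x) Uad := by
  have h1 : Continuous fun u : U => (toWeakSpace ℝ U u, x) :=
    (toWeakSpaceCLM ℝ U).continuous.prodMk continuous_const
  exact LowerSemicontinuousOn.comp h h1.continuousOn
    fun u hu => ⟨mem_image_of_mem _ hu, mem_univ _⟩

/-- A tube lemma: lower semicontinuity gives the strict inequality near each point of the weakly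
compact `Uad`, and compactness makes the neighbourhood of `x` uniform in the control. -/
theorem WeakStrongLSC.eventually_forall_lt {Uad : Set U} {φ : U → E → ℝ}
    (h : WeakStrongLSC Uad φ) (hU : IsWeaklyCompact Uad) {l : U →L[ℝ] ℝ} {c : ℝ} {x : E}
    (hl : ∀ u ∈ Uad, c + l u < φ u x) : ∀ᶠ x' in 𝓝 x, ∀ u ∈ Uad, c + l u < φ u x' := by
  have h1 := IsCompact.eventually_forall_of_forall_eventually (x₀ := x) hU
    (P := fun x' y => y ∈ toWeakSpace ℝ U '' Uad →
      c + l ((toWeakSpace ℝ U).symm y) < φ ((toWeakSpace ℝ U).symm y) x') (by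
    rintro _ ⟨u, hu, rfl⟩
    obtain ⟨r, hr1, hr2⟩ := exists_between (hl u hu)
    have h2 := h (toWeakSpace ℝ U u, x) ⟨mem_image_of_mem _ hu, mem_univ _⟩ r (by simpa using hr2)
    rw [eventually_nhdsWithin_iff] at h2
    have h3 := (continuous_swap.tendsto (x, toWeakSpace ℝ U u)).eventually h2
    have h4 : ∀ᶠ z : E × WeakSpace ℝ U in 𝓝 (x, toWeakSpace ℝ U u),
        c + l ((toWeakSpace ℝ U).symm z.2) < r :=
      ((((continuous_weakSpace_dual l).comp continuous_snd).const_add c).tendsto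
        (x, toWeakSpace ℝ U u)).eventually_lt_const (by simpa using hr1)
    filter_upwards [h3, h4] with z h5 h6 h7
    exact h6.trans (h5 ⟨h7, mem_univ _⟩))
  filter_upwards [h1] with x' hx' u hu
  have := hx' _ (mem_image_of_mem _ hu) (mem_image_of_mem _ hu)
  simpa using this

/-- Hahn-Banach applied to the convex function `φ · x` gives an affine minorant with value `r' > r`
at `w`; lowering it by `r' - r` makes it strict, as the tube argument requires. -/
theorem WeakStrongLSC.exists_affine_lt {Uad : Set U} {φ : U → E → ℝ}
    (h : WeakStrongLSC Uad φ) (hU : IsWeaklyCompact Uad) {x : E}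
    (hφ : ConvexOn ℝ Uad fun u => φ u x) {w : U} (hw : w ∈ Uad) {r : ℝ} (hr : r < φ w x) :
    ∃ (l : U →L[ℝ] ℝ) (c : ℝ), (∀ᶠ x' in 𝓝 x, ∀ u ∈ Uad, c + l u < φ u x') ∧ c + l w = r := by
  obtain ⟨r', h1, h2⟩ := exists_between hr
  obtain ⟨l, c, h3, h4⟩ := ConvexOn.exists_affine_le_of_lt (𝕜 := ℝ) hw h2 hU.isClosed
    (h.lowerSemicontinuousOn x) hφ
  refine ⟨l, c - (r' - r), h.eventually_forall_lt hU fun u hu => ?_, ?_⟩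
  · have h5 : l u + c ≤ φ u x := h3 ⟨u, hu⟩
    linarith
  · have h5 : l w + c = r' := h4
    linarith

/-- On each good compact set the integrand is Borel along the pair, being lower semicontinuous
there; these sets exhaust `J` up to a null set. -/
theorem ApproxLSC.aemeasurable {a : ℝ} {Uad : Set U} {g : ℝ → U → E → ℝ}
    (hg : ApproxLSC a Uad g) (hU : IsClosed Uad) {v : ℝ → U} {x : ℝ → E}
    (hv : AEStronglyMeasurable v (vol a)) (hx : AEStronglyMeasurable x (vol a))
    (hvU : ∀ᵐ t ∂vol a, v t ∈ Uad) : AEMeasurable (fun t => g t (v t) (x t)) (vol a) := by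
  have hvm := hv.stronglyMeasurable_mk
  have hxm := hx.stronglyMeasurable_mk
  set v' := hv.mk v
  set x' := hx.mk x
  have hmain : AEMeasurable (fun t => g t (v' t) (x' t)) (vol a) := by
    choose K hK hKJ hKε hKg using fun n : ℕ => hg ((n : ℝ≥0∞) + 1)⁻¹ (by simp)
    have hUm : MeasurableSet (v' ⁻¹' Uad) := by
      borelize U
      exact hvm.measurable hU.measurableSet
    have hD : ∀ n, MeasurableSet (K n ∩ v' ⁻¹' Uad) := fun n => (hK n).measurableSet.inter hUm
    have h1 : ∀ n, AEMeasurable (fun t => g t (v' t) (x' t))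
        (volume.restrict (K n ∩ v' ⁻¹' Uad)) := by
      intro n
      refine aemeasurable_restrict_of_measurable_subtype (hD n) (measurable_of_Ioi fun r => ?_)
      obtain ⟨O, hO, hOr⟩ := lowerSemicontinuousOn_iff_preimage_Ioi.1 (hKg n) r
      have h2 : MeasurableSet ((fun t : ℝ => (t, v' t, x' t)) ⁻¹' O) := by
        have h3 : StronglyMeasurable fun t : ℝ => (t, v' t, x' t) :=
          stronglyMeasurable_id.prodMk (hvm.prodMk hxm)
        let _ : MeasurableSpace (ℝ × U × E) := borel _
        have : BorelSpace (ℝ × U × E) := ⟨rfl⟩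
        exact h3.measurable hO.measurableSet
      convert measurable_subtype_coe h2 using 1
      ext ⟨t, ht⟩
      have h4 := Set.ext_iff.1 hOr (t, v' t, x' t)
      simp only [mem_inter_iff, mem_prod, mem_preimage, mem_Ioi, mem_univ, and_true] at h4 ht ⊢
      tauto
    have h2 : (Icc 0 a : Set ℝ) =ᵐ[volume] ⋃ n, K n ∩ v' ⁻¹' Uad := by
      have h3 : volume (Icc 0 a \ ⋃ n, K n) = 0 := by
        refine le_antisymm (le_of_forall_pos_le_add fun ε hε => ?_) zero_le
        obtain ⟨n, hn⟩ := ENNReal.exists_inv_nat_lt hε.ne'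
        rw [zero_add]
        calc volume (Icc 0 a \ ⋃ n, K n) ≤ volume (Icc 0 a \ K n) :=
              measure_mono (sdiff_subset_sdiff_right (subset_iUnion K n))
          _ ≤ ((n : ℝ≥0∞) + 1)⁻¹ := (hKε n).le
          _ ≤ (n : ℝ≥0∞)⁻¹ := ENNReal.inv_le_inv.2 le_self_add
          _ ≤ ε := hn.le
      have h4 : ∀ᵐ t ∂vol a, v' t ∈ Uad := by
        filter_upwards [hvU, hv.ae_eq_mk] with t h5 h6
        rwa [h6] at h5
      rw [ae_restrict_iff' measurableSet_Icc] at h4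
      have h5 : ∀ᵐ t, t ∉ Icc 0 a \ ⋃ n, K n := measure_eq_zero_iff_ae_notMem.1 h3
      filter_upwards [h4, h5] with t h6 h7
      refine propext ⟨fun ht => ?_, fun ht => ?_⟩
      · have h8 : t ∈ ⋃ n, K n := by_contra fun h => h7 ⟨ht, h⟩
        obtain ⟨n, hn⟩ := mem_iUnion.1 h8
        exact mem_iUnion.2 ⟨n, hn, h6 ht⟩
      · obtain ⟨n, hn⟩ := mem_iUnion.1 ht
        exact hKJ n hn.1
    rw [vol, Measure.restrict_congr_set h2]
    exact (aemeasurable_iUnion_iff).2 h1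
  refine hmain.congr ?_
  filter_upwards [hv.ae_eq_mk, hx.ae_eq_mk] with t h1 h2
  rw [h1, h2]

theorem ofReal_add_abs_add_ofReal_neg {y s : ℝ} (h : -s ≤ y) :
    ENNReal.ofReal (y + |s|) + ENNReal.ofReal (-y) = ENNReal.ofReal y + ENNReal.ofReal |s| := by
  have h1 : 0 ≤ y + |s| := by linarith [le_abs_self s]
  rcases le_total 0 y with hy | hy
  · rw [ENNReal.ofReal_of_nonpos (neg_nonpos.2 hy), add_zero, ENNReal.ofReal_add hy (abs_nonneg s)]
  · rw [ENNReal.ofReal_of_nonpos hy, zero_add, ← ENNReal.ofReal_add h1 (neg_nonneg.2 hy)]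
    congr 1; ring

/-- Shifting by `|ψ|` makes the integrand nonnegative and changes the cost by a finite constant, so
minimisation can be done with values in `ℝ≥0∞`. -/
theorem cost_eq {a : ℝ} {g : ℝ → U → E → ℝ} {ψ : ℝ → ℝ} (hψ : IntegrableOn ψ (Icc 0 a))
    {v : Lp U 2 (vol a)} {x : Lp E 2 (vol a)}
    (hm : AEMeasurable (fun t => g t (v t) (x t)) (vol a))
    (hg : ∀ᵐ t ∂vol a, -ψ t ≤ g t (v t) (x t)) :
    cost a g v x = ((∫⁻ t, ENNReal.ofReal (g t (v t) (x t) + |ψ t|) ∂vol a : ℝ≥0∞) : EReal) -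
      ((∫⁻ t, ENNReal.ofReal |ψ t| ∂vol a : ℝ≥0∞) : EReal) := by
  have hk : ∫⁻ t, ENNReal.ofReal |ψ t| ∂vol a < ∞ := hψ.abs.lintegral_lt_top
  have hn : ∫⁻ t, ENNReal.ofReal (-g t (v t) (x t)) ∂vol a < ∞ := by
    refine lt_of_le_of_lt (lintegral_mono_ae ?_) hk
    filter_upwards [hg] with t ht
    exact ENNReal.ofReal_le_ofReal (by linarith [le_abs_self (ψ t)])
  have hsum : ∫⁻ t, ENNReal.ofReal (g t (v t) (x t) + |ψ t|) ∂vol a +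
      ∫⁻ t, ENNReal.ofReal (-g t (v t) (x t)) ∂vol a =
      ∫⁻ t, ENNReal.ofReal (g t (v t) (x t)) ∂vol a + ∫⁻ t, ENNReal.ofReal |ψ t| ∂vol a := by
    have hm' : AEMeasurable (fun t => -g t (v t) (x t)) (vol a) := hm.neg
    rw [← lintegral_add_right' _ hm'.ennreal_ofReal, ← lintegral_add_left' hm.ennreal_ofReal]
    refine lintegral_congr_ae ?_
    filter_upwards [hg] with t ht
    exact ofReal_add_abs_add_ofReal_neg ht
  rw [cost]
  generalize ∫⁻ t, ENNReal.ofReal (g t (v t) (x t) + |ψ t|) ∂vol a = I at *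
  generalize ∫⁻ t, ENNReal.ofReal (-g t (v t) (x t)) ∂vol a = n at *
  generalize ∫⁻ t, ENNReal.ofReal (g t (v t) (x t)) ∂vol a = P at *
  generalize ∫⁻ t, ENNReal.ofReal |ψ t| ∂vol a = k at *
  lift n to ℝ≥0 using hn.ne
  lift k to ℝ≥0 using hk.ne
  induction I with
  | top =>
    have : P = ∞ := by simpa [ENNReal.add_eq_top, eq_comm] using hsum
    subst this; rfl
  | coe I =>
    induction P with
    | top => simp [← ENNReal.coe_add] at hsum
    | coe P =>
      have h1 : (I : ℝ) + n = P + k := by exact_mod_cast hsum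
      change ((P : ℝ) : EReal) - ((n : ℝ) : EReal) = ((I : ℝ) : EReal) - ((k : ℝ) : EReal)
      rw [← EReal.coe_sub, ← EReal.coe_sub]
      congr 1; linarith

end FracControl

end

/-! ### From controls to states and costs. -/

noncomputable section

namespace FracControl

variable {E U : Type*} [NormedAddCommGroup E] [InnerProductSpace ℝ E] [CompleteSpace E]
  [NormedAddCommGroup U] [InnerProductSpace ℝ U] [CompleteSpace U]
  {α μ a : ℝ} {A : E →ₗ.[ℝ] E} {T S : ℝ → E →L[ℝ] E} {m : ℕ} {c τ : Fin m → ℝ}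
  {f : ℝ → E → E} {p : ℝ → ℝ} {b R : ℝ}

/-- The linear response to weakly convergent bounded controls converges pointwise. -/
theorem CoerciveFamily.tendsto_mildOp_control (H : CoerciveFamily α A T S μ)
    (hS : ∀ r ∈ Ioc 0 a, IsCompactOperator (S r)) (B : U →L[ℝ] E) (hR : 0 ≤ R)
    {v : ℕ → Lp U 2 (vol a)} {w : Lp U 2 (vol a)}
    (hw : ∀ z, Tendsto (fun n => ⟪v n, z⟫) atTop (𝓝 ⟪w, z⟫))
    (hvR : ∀ n, ∀ᵐ s ∂vol a, ‖B (v n s)‖ ≤ R) (hwR : ∀ᵐ s ∂vol a, ‖B (w s)‖ ≤ R)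
    {t : ℝ} (ht : t ≤ a) :
    Tendsto (fun n => mildOp S (fun s => B (v n s) - B (w s)) t) atTop (𝓝 0) := by
  -- `B` acts boundedly on `L²`, so `v n - w` is sent to a weakly null sequence of forcing terms.
  set L : Lp U 2 (vol a) →L[ℝ] Lp E 2 (vol a) := B.compLpL 2 (vol a) with hL
  have hco : ∀ n, L (v n - w) =ᵐ[vol a] fun s => B (v n s) - B (w s) := by
    intro n
    filter_upwards [B.coeFn_compLpL (v n - w), Lp.coeFn_sub (v n) w] with s h1 h2
    rw [h1, h2, Pi.sub_apply, map_sub]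
  have h1 := H.tendsto_mildOp_zero (R := R + R) ht hS (h := fun n => L (v n - w))
    (add_nonneg hR hR) (fun n => by
      filter_upwards [hco n, hvR n, hwR] with s h1 h2 h3
      rw [h1]
      exact (norm_sub_le _ _).trans (add_le_add h2 h3)) (fun z => by
      have h2 := (hw (ContinuousLinearMap.adjoint L z)).sub_const ⟪w, ContinuousLinearMap.adjoint L z⟫
      rw [sub_self] at h2
      refine h2.congr fun n => ?_
      rw [← inner_sub_left, ContinuousLinearMap.adjoint_inner_right])
  exact h1.congr fun n => mildOp_congr (hco n) ht

/-- Weakly convergent bounded controls have strongly convergent states. -/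
theorem Nonlinearity.ae_tendsto_state (hf : Nonlinearity a f p b) (H : CoerciveFamily α A T S μ)
    (hτ : ∀ k, τ k ∈ Icc 0 a) (hg : ∀ k, IsGoodTime α a p (τ k))
    (hc : (⨆ t : ℝ≥0, ‖T t‖ₑ) * ∑ k, ‖c k‖ₑ < 1)
    (hS : ∀ r ∈ Ioc 0 a, IsCompactOperator (S r)) (B : U →L[ℝ] E) (hR : 0 ≤ R)
    {v : ℕ → Lp U 2 (vol a)} {w : Lp U 2 (vol a)}
    (hw : ∀ z, Tendsto (fun n => ⟪v n, z⟫) atTop (𝓝 ⟪w, z⟫))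
    (hvR : ∀ n, ∀ᵐ s ∂vol a, ‖B (v n s)‖ ≤ R) (hwR : ∀ᵐ s ∂vol a, ‖B (w s)‖ ≤ R)
    {xn : ℕ → Lp E 2 (vol a)} {x : Lp E 2 (vol a)}
    (hxn : ∀ n, IsMildSolution a T S c τ B f (v n) (xn n))
    (hx : IsMildSolution a T S c τ B f w x) :
    ∀ᵐ t ∂vol a, Tendsto (fun n => xn n t) atTop (𝓝 (x t)) := by
  have hu := isUnit_one_sub_nodes (fun k => (hτ k).1) hc
  obtain ⟨z, hxz, hz⟩ := (hf.isMildSolution_iff H hτ hg hu hR B hwR x).1 hx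
  choose zn hxzn hzn using fun n =>
    (hf.isMildSolution_iff H hτ hg hu hR B (hvR n) (xn n)).1 (hxn n)
  exact hf.ae_tendsto_solution H hR hg hc (B.comp_memLp' (Lp.memLp w))
    (fun n => B.comp_memLp' (Lp.memLp (v n))) hwR hvR hxz hxzn hz hzn
    fun t ht => H.tendsto_mildOp_control hS B hR hw hvR hwR ht.2

theorem Nonlinearity.exists_isMildSolution (hf : Nonlinearity a f p b)
    (H : CoerciveFamily α A T S μ) (ha : 0 < a)
    (hτ : ∀ k, τ k ∈ Icc 0 a) (hg : ∀ k, IsGoodTime α a p (τ k))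
    (hc : (⨆ t : ℝ≥0, ‖T t‖ₑ) * ∑ k, ‖c k‖ₑ < 1) (B : U →L[ℝ] E) (hR : 0 ≤ R)
    {v : Lp U 2 (vol a)} (hvR : ∀ᵐ s ∂vol a, ‖B (v s)‖ ≤ R) :
    ∃ x, IsMildSolution a T S c τ B f v x := by
  obtain ⟨x, z, hx, hz⟩ := hf.exists_nonlocal_solution H ha hg hc hR
    (B.comp_memLp' (Lp.memLp v)) hvR
  exact ⟨x, (hf.isMildSolution_iff H hτ hg (isUnit_one_sub_nodes (fun k => (hτ k).1) hc) hR B hvR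
    x).2 ⟨z, hx, hz⟩⟩

/-- Lower semicontinuity of the shifted cost for weakly convergent controls and almost everywhere
strongly convergent states. -/
theorem lintegral_integrand_le_of_tendsto {Uad : Set U} (hU : IsWeaklyCompact Uad)
    {g : ℝ → U → E → ℝ} (hg_approx : ApproxLSC a Uad g)
    (hg_lsc : ∀ t ∈ Icc 0 a, WeakStrongLSC Uad (g t))
    (hg_convex : ∀ t ∈ Icc 0 a, ∀ x : E, ConvexOn ℝ Uad (fun u => g t u x))
    {ψ : ℝ → ℝ} (hψ : AEMeasurable ψ (vol a))
    {v : ℕ → Lp U 2 (vol a)} {w : Lp U 2 (vol a)}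
    (hw : ∀ z, Tendsto (fun n => ⟪v n, z⟫) atTop (𝓝 ⟪w, z⟫))
    (hvU : ∀ n, ∀ᵐ t ∂vol a, v n t ∈ Uad) (hwU : ∀ᵐ t ∂vol a, w t ∈ Uad)
    {xn : ℕ → Lp E 2 (vol a)} {x : Lp E 2 (vol a)}
    (hx : ∀ᵐ t ∂vol a, Tendsto (fun n => xn n t) atTop (𝓝 (x t)))
    {s : ℕ → ℝ≥0∞} {I : ℝ≥0∞} (hs : Antitone s) (hsI : Tendsto s atTop (𝓝 I))
    (hgs : ∀ n, ∫⁻ t, ENNReal.ofReal (g t (v n t) (xn n t) + ψ t) ∂vol a ≤ s n) :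
    ∫⁻ t, ENNReal.ofReal (g t (w t) (x t) + ψ t) ∂vol a ≤ I := by
  refine lintegral_le_of_weak_limit hw (fun n => ((hg_approx.aemeasurable hU.isClosed
    (Lp.aestronglyMeasurable _) (Lp.aestronglyMeasurable _) (hvU n)).add hψ).ennreal_ofReal)
    hs hsI hgs ?_
  filter_upwards [hx, hwU, ae_all_iff.2 hvU, ae_restrict_mem measurableSet_Icc]
    with t hxt hwt hvt ht r hr
  have hr' : r.toReal < g t (w t) (x t) + ψ t :=
    (ENNReal.lt_ofReal_iff_toReal_lt (ne_top_of_lt hr)).1 hr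
  -- The minorant holds for all states near `x t`, hence for `xn i t` with `i` large; the controls
  -- enter only through `l`, which is what weak convergence can handle.
  obtain ⟨l, d, h1, h2⟩ := (hg_lsc t ht).exists_affine_lt hU (hg_convex t ht (x t)) hwt
    (r := r.toReal - ψ t) (by linarith)
  obtain ⟨N, hN⟩ := eventually_atTop.1 (hxt.eventually h1)
  refine ⟨l, d + ψ t, N, fun i hi => ENNReal.ofReal_le_ofReal ?_, ?_⟩
  · change d + ψ t + l (v i t) ≤ g t (v i t) (xn i t) + ψ t
    linarith [hN i hi _ (hvt i)]
  · rw [show d + ψ t + l (w t) = r.toReal by linarith, ENNReal.ofReal_toReal (ne_top_of_lt hr)]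

end FracControl

end

/-! ### Existence of an optimal pair. -/

theorem mainTheorem8
    {E U : Type*} [NormedAddCommGroup E] [InnerProductSpace ℝ E] [CompleteSpace E]
    [NormedAddCommGroup U] [InnerProductSpace ℝ U] [CompleteSpace U]
    -- the nonlocal fractional system
    (α : ℝ) (hα₀ : 0 < α) (hα₁ : α < 1) (a : ℝ) (ha : 0 < a)
    (A : E →ₗ.[ℝ] E) (hA : FracControl.GeneratesC0Semigroup A)
    (T S : ℝ → E →L[ℝ] E)
    (hT : FracControl.IsSolutionOperator α A T) (hS : FracControl.IsResolventFamily α A S)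
    {m : ℕ} (c τ : Fin m → ℝ) (hτ : ∀ k, τ k ∈ Icc 0 a)
    (hc : (⨆ t : ℝ≥0, ‖T t‖ₑ) * ∑ k, ‖c k‖ₑ < 1)
    (B : U →L[ℝ] E) (f : ℝ → E → E) (hf : FracControl.IsCaratheodory a f)
    -- coercivity of `-A`
    (hA_coercive : ∃ μ : ℝ, 0 < μ ∧ ∀ x : A.domain, μ * ‖(x : E)‖ ^ 2 ≤ ⟪-(A x), (x : E)⟫)
    -- linear growth and negative monotonicity of `f`
    (p : ℝ → ℝ) (hp : MemLp p 2 (FracControl.vol a)) (b : ℝ) (hb : 0 < b)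
    (hf_growth : ∀ t ∈ Icc 0 a, ∀ x : E, ‖f t x‖ ≤ p t + b * ‖x‖)
    (hf_mono : ∀ t ∈ Icc 0 a, ∀ x y : E, ⟪f t x - f t y, x - y⟫ ≤ 0)
    -- this integrability holds automatically if `1 / 2 < α`
    (hp_nodes : ∀ k, IntegrableOn (fun s => (τ k - s) ^ (α - 1) * p s) (Ioo 0 (τ k)))
    -- compactness of the Green operators
    (hG : ∀ t s : ℝ, 0 ≤ s → s < t → t ≤ a →
      IsCompactOperator (FracControl.green T S c τ t s))
    -- the control set and the integrand of the cost
    (Uad : Set U) (hU_ne : Uad.Nonempty) (hU_convex : Convex ℝ Uad)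
    (hU_compact : FracControl.IsWeaklyCompact Uad)
    (g : ℝ → U → E → ℝ) (hg_approx : FracControl.ApproxLSC a Uad g)
    (hg_lsc : ∀ t ∈ Icc 0 a, FracControl.WeakStrongLSC Uad (g t))
    (hg_convex : ∀ t ∈ Icc 0 a, ∀ x : E, ConvexOn ℝ Uad (fun u => g t u x))
    (ψ : ℝ → ℝ) (hψ : IntegrableOn ψ (Icc 0 a))
    (hg_lower : ∀ t ∈ Icc 0 a, ∀ u ∈ Uad, ∀ x : E, -ψ t ≤ g t u x) :
    ∃ (v : Lp U 2 (FracControl.vol a)) (x : Lp E 2 (FracControl.vol a)),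
      FracControl.IsOptimalPair a T S c τ B f Uad g v x := by

  obtain ⟨μ, hμ, hA_coercive⟩ := hA_coercive
  have H : FracControl.CoerciveFamily α A T S μ := ⟨hα₀, hα₁, hT, hS, hμ, hA_coercive⟩
  have hN : FracControl.Nonlinearity a f p b := ⟨hf, hp, hb.le, hf_growth, hf_mono⟩
  have hgood := FracControl.isGoodTime_node hα₀ hτ hp_nodes
  have hSc : ∀ r ∈ Ioc 0 a, IsCompactOperator (S r) := fun r hr =>
    FracControl.isCompactOperator_resolvent hτ hc hG hr
  have hUc := hU_compact.isClosed
  obtain ⟨u₀, hu₀⟩ := hU_ne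
  obtain ⟨R, hR⟩ := hU_compact.exists_norm_le
  have hR0 : 0 ≤ R := (norm_nonneg _).trans (hR u₀ hu₀)
  have hBR0 : 0 ≤ ‖B‖ * R := by positivity
  have hBR : ∀ v : Lp U 2 (FracControl.vol a), (∀ᵐ t ∂FracControl.vol a, v t ∈ Uad) →
      ∀ᵐ t ∂FracControl.vol a, ‖B (v t)‖ ≤ ‖B‖ * R := by
    intro v hv
    filter_upwards [hv] with t ht
    exact B.le_opNorm_of_le (hR _ ht)
  set I : Lp U 2 (FracControl.vol a) × Lp E 2 (FracControl.vol a) → ℝ≥0∞ := fun q =>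
    ∫⁻ t, ENNReal.ofReal (g t (q.1 t) (q.2 t) + |ψ t|) ∂FracControl.vol a with hI
  set P : Set (Lp U 2 (FracControl.vol a) × Lp E 2 (FracControl.vol a)) :=
    {q | FracControl.IsAdmissiblePair a T S c τ B f Uad q.1 q.2} with hP
  have hcost : ∀ q ∈ P, FracControl.cost a g q.1 q.2 =
      (I q : EReal) - ((∫⁻ t, ENNReal.ofReal |ψ t| ∂FracControl.vol a : ℝ≥0∞) : EReal) := by
    intro q hq
    refine FracControl.cost_eq hψ (hg_approx.aemeasurable hUc (Lp.aestronglyMeasurable _)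
      (Lp.aestronglyMeasurable _) hq.1) ?_
    filter_upwards [hq.1, ae_restrict_mem measurableSet_Icc] with t h1 ht
    exact hg_lower t ht _ h1 _
  have hPne : P.Nonempty := by
    have hv : ∀ᵐ t ∂FracControl.vol a, (Lp.const 2 (FracControl.vol a) u₀ : Lp U 2 _) t ∈ Uad := by
      filter_upwards [Lp.coeFn_const 2 (FracControl.vol a) u₀] with t ht
      rw [ht]
      exact hu₀
    obtain ⟨x, hx⟩ := hN.exists_isMildSolution H ha hτ hgood hc B hBR0 (hBR _ hv)
    exact ⟨(_, x), hv, hx⟩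
  -- A decreasing minimising sequence of shifted costs; the infimum may be infinite, in which case
  -- every admissible pair is optimal.
  obtain ⟨s, hs, hsI, hsP⟩ := exists_seq_tendsto_sInf (hPne.image I) (OrderBot.bddBelow _)
  choose q hq hqs using hsP
  obtain ⟨w, φ, hφ, hw⟩ := FracControl.exists_weakly_convergent_subseq (u := fun n => (q n).1)
    (R := (measureUnivNNReal (FracControl.vol a) : ℝ) ^ (2 : ℝ≥0∞).toReal⁻¹ * R) fun n =>
      Lp.norm_le_of_ae_bound hR0 (by
        filter_upwards [(hq n).1] with t ht
        exact hR _ ht)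
  have hwU : ∀ᵐ t ∂FracControl.vol a, w t ∈ Uad :=
    FracControl.ae_mem_of_weak_limit hU_convex hUc (fun n => (hq (φ n)).1) hw
  -- The optimal state is not extracted from the minimising states: it is a solution for the limit
  -- control, to which those states converge by stability.
  obtain ⟨x, hx⟩ := hN.exists_isMildSolution H ha hτ hgood hc B hBR0 (hBR w hwU)
  have hlim := hN.ae_tendsto_state H hτ hgood hc hSc B hBR0 hw (fun n => hBR _ (hq (φ n)).1)
    (hBR w hwU) (fun n => (hq (φ n)).2) hx
  have hmin : I (w, x) ≤ sInf (I '' P) :=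
    FracControl.lintegral_integrand_le_of_tendsto hU_compact hg_approx hg_lsc hg_convex
      hψ.aemeasurable.norm hw (fun n => (hq (φ n)).1) hwU hlim
      (hs.comp_monotone hφ.monotone) (hsI.comp hφ.tendsto_atTop) fun n => (hqs (φ n)).le
  refine ⟨w, x, ⟨hwU, hx⟩, fun v' x' h' => ?_⟩
  rw [hcost (w, x) ⟨hwU, hx⟩, hcost (v', x') h']
  exact EReal.sub_le_sub (by
    exact_mod_cast hmin.trans (sInf_le (mem_image_of_mem I (show (v', x') ∈ P from h')))) le_rfl
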